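/- **Model.** There are $N\ge 2$ players and a state $\theta\in\{0,1\}$ with $\mathbb P[\theta=1]=p$. The safe arm pays the flow $s>0$. In state $\theta$, player $n$'s risky arm generates the payoff process $X^n_t=\alpha_\theta t+\sigma Z^n_t+hN^n_t$, where $Z^n$ is a standard Wiener process and $N^n$ is a Poisson process with intensity $\lambda_\theta$, all independent conditional on $\theta$; here $\sigma>0$, $h>0$, $\lambda_1\ge\lambda_0\ge 0$, and $m_0<s<m_1$ with $m_\theta=\alpha_\theta+\lambda_\theta h$. Put $m(p)=p\,m_1+(1-p)\,m_0$. The discount rate is $r>0$, actions can be changed only at $t=0,\Delta,2\Delta,\dots$ for a fixed $\Delta>0$, and $\delta=e^{-r\Delta}$. In each period every player chooses the risky arm ($k=1$) or the safe arm ($k=0$) as a measurable function of the public history: all past actions, the sample paths over each past period of all risky arms in use, and the past and current draws of a public randomization device (independent and uniform on $[0,1]$). The players share the Bayesian posterior belief $p_t$ about $\theta=1$, which is defined after all histories (it equals $1$ after a lump sum if $\lambda_1>\lambda_0=0$). Player $n$ maximizes $(1-\delta)\,\mathbb E\big[\sum_{\ell\ge0}\delta^\ell\{(1-k_{n,\ell\Delta})s+k_{n,\ell\Delta}m_\theta\}\big]$.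 A strongly symmetric equilibrium (SSE) is a perfect Bayesian equilibrium (no player can gain, after any history, by deviating to another, possibly mixed, strategy) in which all players' strategies prescribe the same behavior after every history. For $p\in[0,1]$, let $\overline W^\Delta(p)$ and $\underline W^\Delta(p)$ be the supremum and infimum of the set of payoffs over all pure-strategy SSEs, given prior belief $p$. Let $\mathcal E^\Delta_K w(p)$ be the expectation of $w(p_\Delta)$ when $p_0=p$ and $K$ players use the risky arm on $[0,\Delta)$. **Proposition.** Suppose that the discrete game with time increment $\Delta>0$ admits a pure-strategy SSE for every prior belief $p\in[0,1]$. Then $\overline W^\Delta$ and $\underline W^\Delta$ are bounded and Borel measurable, and the pair $(\overline w,\underline w)=(\overline W^\Delta,\underline W^\Delta)$ solves, for all $p\in[0,1]$, $$\overline w(p)=\max_{\kappa\in\mathcal K(p;\overline w,\underline w)}\Big\{(1-\delta)[(1-\kappa)s+\kappa m(p)]+\delta\,\mathcal E^\Delta_{N\kappa}\overline w(p)\Big\},$$ $$\underline w(p)=\min_{\kappa\in\mathcal K(p;\overline w,\underline w)}\ \max_{k\in\{0,1\}}\Big\{(1-\delta)[(1-k)s+k\,m(p)]+\delta\,\mathcal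 E^\Delta_{(N-1)\kappa+k}\underline w(p)\Big\},$$ where $\mathcal K(p;\overline w,\underline w)\subseteq\{0,1\}$, nonempty for a solution, is the set of all $\kappa\in\{0,1\}$ such that $$(1-\delta)[(1-\kappa)s+\kappa m(p)]+\delta\,\mathcal E^\Delta_{N\kappa}\overline w(p)\ \ge\ \max_{k\in\{0,1\}}\Big\{(1-\delta)[(1-k)s+k\,m(p)]+\delta\,\mathcal E^\Delta_{(N-1)\kappa+k}\underline w(p)\Big\}.$$ Moreover, $\underline W^\Delta\le\underline w\le\overline w\le\overline W^\Delta$ on $[0,1]$ for any solution $(\overline w,\underline w)$ consisting of bounded Borel measurable functions on $[0,1]$. -/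

import Mathlib

open MeasureTheory ProbabilityTheory
open scoped NNReal

noncomputable section

/-! ### Primitives -/

/-- Parameters of the experimentation game with period length `Δ`.  States of the world are
`θ : Fin 2`.  Player `n`'s risky arm yields, in state `θ`, the payoff process
`α θ * t + σ * Z t + h * J t`, with `Z` a Wiener process and `J` a Poisson process of intensity
`lam θ`; the safe arm yields the flow payoff `s`; `r` is the discount rate. -/
structure BanditGame where
  N : ℕ
  r : ℝ
  s : ℝ
  σ : ℝ
  h : ℝ
  α : Fin 2 → ℝ
  lam : Fin 2 → ℝ≥0
  Δ : ℝ≥0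
  two_le_N : 2 ≤ N
  r_pos : 0 < r
  s_pos : 0 < s
  σ_pos : 0 < σ
  h_pos : 0 < h
  lam_le : lam 0 ≤ lam 1
  Δ_pos : 0 < Δ
  m_zero_lt : α 0 + lam 0 * h < s
  lt_m_one : s < α 1 + lam 1 * h

/-- Standard Wiener process: all paths are continuous and start at `0`. -/
structure IsWienerMotion {Ω : Type*} [MeasurableSpace Ω] (Z : ℝ≥0 → Ω → ℝ) (P : Measure Ω) : Prop
    extends IsPreBrownianReal Z P where
  measurable : ∀ t, Measurable (Z t)
  zero : ∀ ω, Z 0 ω = 0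
  continuous : ∀ ω, Continuous fun t => Z t ω

/-- Poisson process of intensity `l`: a counting process (nondecreasing right-continuous paths
started at `0`) with independent increments that have Poisson laws. -/
structure IsPoissonCounting {Ω : Type*} [MeasurableSpace Ω] (J : ℝ≥0 → Ω → ℕ) (l : ℝ≥0)
    (P : Measure Ω) : Prop where
  measurable : ∀ t, Measurable (J t)
  zero : ∀ ω, J 0 ω = 0
  monotone : ∀ ω, Monotone fun t => J t ω
  rightContinuous : ∀ ω t, ContinuousWithinAt (fun u => J u ω) (Set.Ici t) t
  hasLaw_increment : ∀ t u, HasLaw (fun ω => J (t + u) ω - J t ω) (poissonMeasure (l * u)) P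
  indepIncrements : HasIndepIncrements J P

/-- A probability space carrying the noise that drives a single risky arm: a Wiener process `Z`
and, for each state `θ`, an independent Poisson process `J θ` of intensity `lam θ`. -/
structure ArmNoise (G : BanditGame) (Ω : Type*) [MeasurableSpace Ω] where
  P : Measure Ω
  isProb : IsProbabilityMeasure P
  Z : ℝ≥0 → Ω → ℝ
  J : Fin 2 → ℝ≥0 → Ω → ℕ
  wiener : IsWienerMotion Z P
  poisson : ∀ θ, IsPoissonCounting (J θ) (G.lam θ) P
  indep : ∀ θ, IndepFun (fun ω t => Z t ω) (fun ω t => J θ t ω) P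

namespace BanditGame

variable (G : BanditGame)

/-- One-period discount factor `δ = exp (-r Δ)`. -/
def δ : ℝ := Real.exp (-G.r * G.Δ)

/-- Expected flow payoff of the risky arm in state `θ`. -/
def mState (θ : Fin 2) : ℝ := G.α θ + G.lam θ * G.h

/-- Expected flow payoff of the risky arm at belief `p` (the probability of state `1`). -/
def m (p : unitInterval) : ℝ := p * G.mState 1 + (1 - p) * G.mState 0

/-! ### Observed sample paths -/

/-- `(x, j)` is a sample path of a risky arm over one period: `x` is the path of the cumulative
payoff since the beginning of the period, `j` the path of the number of lump sums it contains.
As `h ≠ 0`, the path `j` is determined by `x`. -/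
def IsSamplePath (y : (Set.Iic G.Δ → ℝ) × (Set.Iic G.Δ → ℕ)) : Prop :=
  y.1 ⟨0, Set.mem_Iic.2 zero_le⟩ = 0 ∧ y.2 ⟨0, Set.mem_Iic.2 zero_le⟩ = 0 ∧ Monotone y.2 ∧
    (∀ t, ContinuousWithinAt y.2 (Set.Ici t) t) ∧ Continuous fun t => y.1 t - G.h * y.2 t

/-- One-period sample paths of a risky arm, with the σ-algebra generated by the evaluations. -/
def SamplePath : Type := {y : (Set.Iic G.Δ → ℝ) × (Set.Iic G.Δ → ℕ) // G.IsSamplePath y}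

instance : MeasurableSpace G.SamplePath :=
  inferInstanceAs (MeasurableSpace
    {y : (Set.Iic G.Δ → ℝ) × (Set.Iic G.Δ → ℕ) // G.IsSamplePath y})

variable {G}

/-- Cumulative payoff over the period. -/
def SamplePath.total (y : G.SamplePath) : ℝ := y.1.1 ⟨G.Δ, Set.mem_Iic.2 le_rfl⟩

/-- Number of lump sums over the period. -/
def SamplePath.jumps (y : G.SamplePath) : ℕ := y.1.2 ⟨G.Δ, Set.mem_Iic.2 le_rfl⟩

end BanditGame

namespace ArmNoise

open BanditGame

variable {G : BanditGame} {Ω : Type*} [MeasurableSpace Ω] (X : ArmNoise G Ω)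

/-- The payoff process of a risky arm in state `θ`. -/
def cumPayoff (θ : Fin 2) (t : ℝ≥0) (ω : Ω) : ℝ :=
  G.α θ * t + G.σ * X.Z t ω + G.h * X.J θ t ω

/-- The sample path of the payoff process over a period of length `Δ`. -/
def samplePath (θ : Fin 2) (ω : Ω) : G.SamplePath :=
  ⟨(fun t => X.cumPayoff θ t ω, fun t => X.J θ t ω), by
    refine ⟨?_, ?_, ?_, ?_, ?_⟩
    · simp [cumPayoff, X.wiener.zero, (X.poisson θ).zero]
    · exact (X.poisson θ).zero ω
    · exact fun a b hab => (X.poisson θ).monotone ω hab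
    · intro t
      exact ((X.poisson θ).rightContinuous ω t).comp continuous_subtype_val.continuousWithinAt
        (fun u hu => hu)
    · have hc := X.wiener.continuous ω
      have : (fun t : Set.Iic G.Δ => X.cumPayoff θ t ω - G.h * (X.J θ t ω : ℝ)) =
          fun t : Set.Iic G.Δ => G.α θ * ((t : ℝ≥0) : ℝ) + G.σ * X.Z t ω := by
        funext t
        simp [cumPayoff]
      change Continuous (fun t : Set.Iic G.Δ => X.cumPayoff θ t ω - G.h * (X.J θ t ω : ℝ))
      rw [this]
      fun_prop⟩

theorem measurable_samplePath (θ : Fin 2) : Measurable (X.samplePath θ) := by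
  have hJ : Measurable fun ω => fun t : Set.Iic G.Δ => X.J θ t ω :=
    measurable_pi_lambda _ fun t => (X.poisson θ).measurable t
  have hY : Measurable fun ω => fun t : Set.Iic G.Δ => X.cumPayoff θ t ω := ?_
  · exact (hY.prodMk hJ).subtype_mk
  refine measurable_pi_lambda _ fun t => ?_
  have h1 := X.wiener.measurable t
  have h2 := (X.poisson θ).measurable t
  have h3 : Measurable fun ω => (X.J θ t ω : ℝ) := measurable_from_top.comp h2
  unfold cumPayoff
  fun_prop

/-- Law of the one-period sample path of a risky arm, conditional on the state `θ`. -/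
def pathLaw (θ : Fin 2) : Measure G.SamplePath := X.P.map (X.samplePath θ)

instance (θ : Fin 2) : IsProbabilityMeasure (X.pathLaw θ) :=
  haveI := X.isProb
  Measure.isProbabilityMeasure_map (X.measurable_samplePath θ).aemeasurable

end ArmNoise

namespace BanditGame

variable (G : BanditGame)

/-! ### Beliefs -/

/-- What a period reveals about one player: `inl ()` if that player used the safe arm, and
`inr y` if that player used the risky arm and generated the sample path `y`. -/
abbrev Obs : Type := Unit ⊕ G.SamplePath

variable {G}

/-- Likelihood ratio (state `1` against state `0`) of one player's observation, where
`lam 1 / lam 0` is read as `1` if `lam 0 = 0` (if also `lam 1 > 0`, this matters only in the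
absence of lump sums; see `bayesUpdate`). -/
def likelihoodRatio : G.Obs → ℝ
  | .inl _ => 1
  | .inr y =>
      Real.exp ((G.α 1 - G.α 0) / G.σ ^ 2 * (y.total - G.α 0 * G.Δ - G.h * y.jumps)
          - ((G.α 1 - G.α 0) ^ 2 / (2 * G.σ ^ 2) + (G.lam 1 - G.lam 0)) * G.Δ)
        * (if G.lam 0 = 0 then 1 else (G.lam 1 / G.lam 0 : ℝ)) ^ y.jumps

/-- The observation shows that some lump sum has arrived. -/
def HasJump : G.Obs → Prop
  | .inl _ => False
  | .inr y => 0 < y.jumps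

theorem likelihoodRatio_pos (o : G.Obs) : 0 < likelihoodRatio o := by
  rcases o with _ | y
  · exact one_pos
  · refine mul_pos (Real.exp_pos _) (pow_pos ?_ _)
    split_ifs with h0
    · exact one_pos
    · have h1 : 0 < G.lam 0 := pos_iff_ne_zero.2 h0
      have h2 : 0 < G.lam 1 := h1.trans_le G.lam_le
      positivity

theorem bayes_mem (p : unitInterval) {L : ℝ} (hL : 0 < L) :
    (p : ℝ) * L / (p * L + (1 - p)) ∈ Set.Icc (0 : ℝ) 1 := by
  have h0 := p.2.1
  have h1 : (0 : ℝ) ≤ 1 - p := sub_nonneg.2 p.2.2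
  have h2 : 0 ≤ (p : ℝ) * L := mul_nonneg h0 hL.le
  exact ⟨by positivity, div_le_one_of_le₀ (by linarith) (by positivity)⟩

open Classical in
/-- Bayesian updating of the belief `p` after the observations `o` in one period.  If lump sums
arrive in state `1` only, the belief is `1` once a lump sum has been observed. -/
def bayesUpdate {ι : Type} [Fintype ι] (p : unitInterval) (o : ι → G.Obs) : unitInterval :=
  if G.lam 0 = 0 ∧ 0 < G.lam 1 ∧ ∃ i, HasJump (o i) then 1
  else ⟨p * (∏ i, likelihoodRatio (o i)) / (p * (∏ i, likelihoodRatio (o i)) + (1 - p)),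
    bayes_mem p (Finset.prod_pos fun i _ => likelihoodRatio_pos (o i))⟩

section Law

variable {Ω : Type*} [MeasurableSpace Ω] (X : ArmNoise G Ω)

/-- Distribution `F_K(· | p)` of the belief at the end of a period that starts with belief `p`
and during which `K` players use the risky arm. -/
def beliefLaw (K : ℕ) (p : unitInterval) : Measure unitInterval :=
  (ENNReal.ofReal p • Measure.pi (fun _ : Fin K => X.pathLaw 1) +
      ENNReal.ofReal (1 - p) • Measure.pi (fun _ : Fin K => X.pathLaw 0)).map
    fun y => bayesUpdate p fun i => (Sum.inr (y i) : G.Obs)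

/-- `𝓔_K w (p)`: expectation of `w` at the end-of-period belief. -/
def expect (K : ℕ) (w : unitInterval → ℝ) (p : unitInterval) : ℝ :=
  ∫ q, w q ∂(beliefLaw X K p)

end Law

variable (G)

/-! ### Histories, strategies, and play -/

/-- Public record of one period: the draw of the public randomization device and the
observations about all players (which reveal their actions). -/
abbrev Stage : Type := unitInterval × (Fin G.N → G.Obs)

/-- Histories of length `t` (in periods). -/
abbrev Hist (t : ℕ) : Type := Fin t → G.Stage

/-- What is publicly known when actions are chosen in period `t`: the history and the current
draw of the public randomization device. -/
abbrev Node (t : ℕ) : Type := G.Hist t × unitInterval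

/-- A behavioral strategy: the probability of using the risky arm, as a measurable function of
the history. -/
structure Strategy where
  act : ∀ t, G.Node t → unitInterval
  measurable_act : ∀ t, Measurable (act t)

variable {G}

/-- A pure strategy takes values in the degenerate distributions only. -/
def Strategy.IsPure (τ : G.Strategy) : Prop := ∀ t x, τ.act t x = 0 ∨ τ.act t x = 1

/-- The common belief after a history, starting from the prior `p`. -/
def belief (p : unitInterval) : {t : ℕ} → G.Hist t → unitInterval
  | 0, _ => p
  | _ + 1, g => bayesUpdate (belief p (Fin.init g)) (g (Fin.last _)).2

variable (G)

/-- Random draws used to move from one decision node to the next: private randomizations of the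
players, potential sample paths of all risky arms, next draw of the public device. -/
abbrev Draws : Type := (Fin G.N → unitInterval) × (Fin G.N → G.SamplePath) × unitInterval

variable {G}

open Classical in
/-- What is observed about a player who uses the risky arm with probability `q`, given a private
draw `v` from the uniform distribution on `[0,1]` and the potential sample path `y`. -/
def observe (q v : unitInterval) (y : G.SamplePath) : G.Obs :=
  if v < q ∨ q = 1 then .inr y else .inl ()

/-- The decision node reached `ℓ` periods after the node `x` under the profile `σ`, as a
function of the random draws. -/
def play (σ : Fin G.N → G.Strategy) {t : ℕ} (x : G.Node t) (d : ℕ → G.Draws) :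
    (ℓ : ℕ) → G.Node (t + ℓ)
  | 0 => x
  | ℓ + 1 =>
      let z := play σ x d ℓ
      (Fin.snoc z.1
        (z.2, fun n => observe ((σ n).act (t + ℓ) z) ((d ℓ).1 n) ((d ℓ).2.1 n)), (d ℓ).2.2)

/-! ### Payoffs and equilibria -/

section Payoffs

variable {Ω : Type*} [MeasurableSpace Ω] (X : ArmNoise G Ω)

/-- Law of the sequence of random draws conditional on the state: independent across periods and
players; randomization devices are uniform on `[0,1]`. -/
def drawsLaw (θ : Fin 2) : Measure (ℕ → G.Draws) :=
  Measure.infinitePi fun _ : ℕ =>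
    (Measure.pi fun _ : Fin G.N => (volume : Measure unitInterval)).prod
      ((Measure.pi fun _ : Fin G.N => X.pathLaw θ).prod (volume : Measure unitInterval))

/-- Expected discounted payoff of player `n`, in per-period units, from the node `x` onwards,
conditional on the state `θ`. -/
def statePayoff (θ : Fin 2) (σ : Fin G.N → G.Strategy) {t : ℕ} (x : G.Node t) (n : Fin G.N) : ℝ :=
  ∫ d, (1 - G.δ) * ∑' ℓ : ℕ, G.δ ^ ℓ *
      ((1 - ((σ n).act (t + ℓ) (play σ x d ℓ) : ℝ)) * G.s +
        ((σ n).act (t + ℓ) (play σ x d ℓ) : ℝ) * G.mState θ) ∂(drawsLaw X θ)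

/-- Continuation payoff of player `n` at the node `x` when the prior is `p`, evaluated with the
belief that corresponds to the history at `x`. -/
def payoffAt (p : unitInterval) (σ : Fin G.N → G.Strategy) {t : ℕ} (x : G.Node t)
    (n : Fin G.N) : ℝ :=
  (belief p x.1 : ℝ) * statePayoff X 1 σ x n + (1 - belief p x.1) * statePayoff X 0 σ x n

/-- Payoff of player `n` in the game with prior `p`. -/
def payoff (p : unitInterval) (σ : Fin G.N → G.Strategy) (n : Fin G.N) : ℝ :=
  ∫ u : unitInterval, payoffAt X p σ (((Fin.elim0 : G.Hist 0), u) : G.Node 0) n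

/-- Perfect Bayesian equilibrium for the prior `p`: after every history, on or off the path of
play, no player can gain by switching to another strategy. -/
def IsPBE (p : unitInterval) (σ : Fin G.N → G.Strategy) : Prop :=
  ∀ (t : ℕ) (x : G.Node t) (n : Fin G.N) (τ : G.Strategy),
    payoffAt X p (Function.update σ n τ) x n ≤ payoffAt X p σ x n

/-- Strongly symmetric equilibrium: a PBE in which all players use the same strategy. -/
def IsSSE (p : unitInterval) (σ : Fin G.N → G.Strategy) : Prop :=
  IsPBE X p σ ∧ ∀ n n' t x, (σ n).act t x = (σ n').act t x

/-- Strongly symmetric equilibrium in pure strategies. -/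
def IsPureSSE (p : unitInterval) (σ : Fin G.N → G.Strategy) : Prop :=
  IsSSE X p σ ∧ ∀ n, (σ n).IsPure

/-- The set of (common) payoffs over all pure-strategy SSE, given the prior `p`. -/
def pureSSEPayoffs (p : unitInterval) : Set ℝ :=
  {v | ∃ σ, IsPureSSE X p σ ∧ ∀ n, payoff X p σ n = v}

/-- Best pure-strategy SSE payoff. -/
def Wsup (p : unitInterval) : ℝ := sSup (pureSSEPayoffs X p)

/-- Worst pure-strategy SSE payoff. -/
def Winf (p : unitInterval) : ℝ := sInf (pureSSEPayoffs X p)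

/-! ### The functional equations -/

/-- `(1-δ)[(1-k)s + k m(p)] + δ 𝓔_K w (p)`: use action `k` for one period while `K` players in
total use the risky arm, with continuation payoffs `w`. -/
def oneStep (k K : ℕ) (w : unitInterval → ℝ) (p : unitInterval) : ℝ :=
  (1 - G.δ) * ((1 - k) * G.s + k * G.m p) + G.δ * expect X K w p

/-- Payoff of the best action against opponents who all use `κ`, with continuation payoffs `w`:
the maximum of `oneStep` over `k ∈ {0, 1}`. -/
def bestReply (κ : ℕ) (w : unitInterval → ℝ) (p : unitInterval) : ℝ :=
  max (oneStep X 0 ((G.N - 1) * κ + 0) w p) (oneStep X 1 ((G.N - 1) * κ + 1) w p)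

/-- The set `𝓚(p; w̄, w̲)` of enforceable common actions. -/
def enforceable (wbar wlow : unitInterval → ℝ) (p : unitInterval) : Set ℕ :=
  {κ | κ ∈ ({0, 1} : Set ℕ) ∧ bestReply X κ wlow p ≤ oneStep X κ (G.N * κ) wbar p}

/-- The pair of bounded Borel functions `(w̄, w̲)` solves the coupled functional equations; the
maximum and the minimum are over a nonempty set and are attained. -/
structure IsSolution (wbar wlow : unitInterval → ℝ) : Prop where
  measurable_bar : Measurable wbar
  measurable_low : Measurable wlow
  bounded_bar : ∃ C, ∀ p, |wbar p| ≤ C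
  bounded_low : ∃ C, ∀ p, |wlow p| ≤ C
  eq_bar : ∀ p, IsGreatest
    ((fun κ => oneStep X κ (G.N * κ) wbar p) '' enforceable X wbar wlow p) (wbar p)
  eq_low : ∀ p, IsLeast
    ((fun κ => bestReply X κ wlow p) '' enforceable X wbar wlow p) (wlow p)

end Payoffs

end BanditGame

end

/-! The proof is a dynamic programming argument in the style of Abreu, Pearce and Stacchetti, with
the belief as state variable. It bounds equilibrium payoffs by iterating the right-hand sides of the
functional equations, and it realizes any solution of these equations by an equilibrium.

Bounds. Suppose that all continuation payoffs of a pure-strategy SSE one period ahead lie between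
`wlow` and `wbar` at the current belief. If the common action at a node is `κ`, the payoff there is
at most `oneStep` of `κ` with `wbar`. It is at least `bestReply` against `κ` with `wlow`, because no
one-period deviation is profitable. Hence `κ` is enforceable, and the bounds can be replaced by
their image under `bellman` (`IsPureSSE.exists_enforceable`). Starting from a constant that bounds
all flow payoffs, one obtains a decreasing sequence of upper bounds and an increasing sequence of
lower bounds; the assumed existence of equilibria keeps all enforceable sets nonempty. Since these
sets decrease inside `{0, 1}`, they are eventually constant at each belief, and dominated
convergence shows that the limit is a bounded Borel solution (`exists_isSolution`). No selection of
equilibria across beliefs is needed.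

Realization. Every bounded Borel solution is the pair of values of an automaton with a good and a
bad state. Any detected deviation leads to the bad state. Compliance in the good state is followed
by the good state; compliance in the bad state is followed by the good state with the probability
that makes the value exactly `wlow` (`automaton_supports`). Discounting extends one-period
optimality to arbitrary deviations (`Automaton.Supports.payoffAt_update_le`), so both functions are
equilibrium payoffs. Every solution therefore lies between the infimum and the supremum, and the
limit solution attains both.

Both halves rest on the recursion `payoffAt_recursion` in terms of beliefs. The model specifies laws
conditional on the state and an explicit updating formula, so it has to be shown that the formula is
Bayes' rule: off the conclusive lump sums the stated likelihood ratio is the density of the path law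
in state 1 with respect to state 0 (`pathLaw_restrict_eq_withDensity`). This follows from
exponential tilting of the independent Gaussian and Poisson increments. -/

/-! ### Densities of product measures and of images -/

theorem withDensity_comp_map {α β : Type*} [MeasurableSpace α] [MeasurableSpace β]
    (μ : Measure α) {g : α → β} (hg : Measurable g) {f : β → ENNReal} (hf : Measurable f) :
    (μ.withDensity fun a => f (g a)).map g = (μ.map g).withDensity f := by
  ext s hs
  rw [Measure.map_apply hg hs, withDensity_apply _ (hg hs), withDensity_apply _ hs,
    setLIntegral_map hs hf hg]

/-- A product measure is determined by its values on boxes. On a box the integrand is a product of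
functions of single coordinates, and these are independent under `Measure.pi μ`. -/
theorem pi_withDensity {ι : Type*} [Fintype ι] {E : ι → Type*} [∀ i, MeasurableSpace (E i)]
    (μ : ∀ i, Measure (E i)) [∀ i, IsProbabilityMeasure (μ i)] {f : ∀ i, E i → ENNReal}
    (hf : ∀ i, Measurable (f i)) [∀ i, SigmaFinite ((μ i).withDensity (f i))] :
    Measure.pi (fun i => (μ i).withDensity (f i)) =
      (Measure.pi μ).withDensity fun x => ∏ i, f i (x i) := by
  refine Measure.pi_eq fun s hs => ?_
  rw [withDensity_apply _ (MeasurableSet.univ_pi hs),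
    ← lintegral_indicator (MeasurableSet.univ_pi hs)]
  have hind : ∀ x : ∀ i, E i, (Set.univ.pi s).indicator (fun x => ∏ i, f i (x i)) x =
      ∏ i, (s i).indicator (f i) (x i) := by
    intro x
    by_cases hx : x ∈ Set.univ.pi s
    · rw [Set.indicator_of_mem hx]
      exact Finset.prod_congr rfl fun i _ => (Set.indicator_of_mem (hx i trivial) _).symm
    · rw [Set.indicator_of_notMem hx]
      obtain ⟨i, hi⟩ : ∃ i, x i ∉ s i := by simpa [Set.mem_pi] using hx
      exact (Finset.prod_eq_zero (Finset.mem_univ i) (Set.indicator_of_notMem hi _)).symm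
  simp_rw [hind]
  have hm : ∀ i, Measurable ((s i).indicator (f i)) := fun i => (hf i).indicator (hs i)
  rw [lintegral_prod_eq_prod_lintegral_of_indepFun Finset.univ
    (fun i (x : ∀ i, E i) => (s i).indicator (f i) (x i))
    (iIndepFun_pi fun i => (hm i).aemeasurable) fun i => (hm i).comp (measurable_pi_apply i)]
  refine Finset.prod_congr rfl fun i _ => ?_
  have := (measurePreserving_eval μ i).lintegral_comp (hm i)
  simp only [Function.eval] at this
  rw [this, lintegral_indicator (hs i), withDensity_apply _ (hs i)]

/-! ### Change of measure for processes with independent increments -/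

/-- Arranges finitely many times in a grid from `0`, so that path values at these times become sums
of increments. The last clause keeps the grid inside the period. -/
theorem exists_monotone_grid (I : Finset ℝ≥0) : ∃ (t : ℕ → ℝ≥0) (n : ℕ), Monotone t ∧ t 0 = 0 ∧
    (∀ i ∈ I, ∃ k ≤ n, t k = i) ∧ ∀ b, (∀ i ∈ I, i ≤ b) → ∀ k, t k ≤ b := by
  induction I using Finset.induction_on_max with
  | empty => exact ⟨fun _ => 0, 0, fun _ _ _ => le_rfl, rfl, by simp, by simp⟩
  | insert a s hs ih =>
    obtain ⟨t, n, ht, h0, hmem, hb⟩ := ih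
    have hta : ∀ k, t k ≤ a := hb a fun i hi => (hs i hi).le
    refine ⟨fun k => if k ≤ n then t k else a, n + 1, ?_, by simp [h0], ?_, ?_⟩
    · intro j k hjk
      dsimp only
      split_ifs with h1 h2 h2
      · exact ht hjk
      · exact hta j
      · omega
      · exact le_rfl
    · intro i hi
      rcases Finset.mem_insert.1 hi with rfl | hi
      · exact ⟨n + 1, le_rfl, by simp⟩
      · obtain ⟨k, hk, hki⟩ := hmem i hi
        exact ⟨k, by omega, by simp [hk, hki]⟩
    · intro b hab k
      dsimp only
      split_ifs with h1
      · exact hb b (fun i hi => hab i (Finset.mem_insert_of_mem hi)) k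
      · exact hab a (Finset.mem_insert_self _ _)

theorem sum_fin_ite_lt_eq_sub (y : ℕ → ℝ) {n k : ℕ} (hk : k ≤ n) :
    ∑ j : Fin n, (if (j : ℕ) < k then y (j + 1) - y j else 0) = y k - y 0 := by
  rw [Fin.sum_univ_eq_sum_range (fun j => if j < k then y (j + 1) - y j else 0) n,
    ← Finset.sum_range_sub y k, ← Finset.sum_filter]
  refine Finset.sum_congr ?_ fun _ _ => rfl
  ext j
  simp only [Finset.mem_filter, Finset.mem_range]
  omega

/-- If the increments of `Y₁` have exponential densities with respect to those of `Y₀`, then so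
does the law of the path of `Y₁` over a period with respect to that of `Y₀`. -/
theorem map_path_eq_withDensity {Ω : Type*} [MeasurableSpace Ω] (P : Measure Ω)
    [IsProbabilityMeasure P] (D : ℝ≥0) {Y₀ Y₁ : ℝ≥0 → Ω → ℝ} (hm₀ : ∀ t, Measurable (Y₀ t))
    (hm₁ : ∀ t, Measurable (Y₁ t)) (hz₀ : ∀ ω, Y₀ 0 ω = 0) (hz₁ : ∀ ω, Y₁ 0 ω = 0)
    (hi₀ : HasIndepIncrements Y₀ P) (hi₁ : HasIndepIncrements Y₁ P) (c d : ℝ)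
    (hlaw : ∀ t u, P.map (fun ω => Y₁ (t + u) ω - Y₁ t ω) =
      (P.map fun ω => Y₀ (t + u) ω - Y₀ t ω).withDensity
        fun x => ENNReal.ofReal (Real.exp (c * x - d * u))) :
    P.map (fun ω (t : Set.Iic D) => Y₁ t ω) =
      (P.map fun ω (t : Set.Iic D) => Y₀ t ω).withDensity
        fun y => ENNReal.ofReal (Real.exp (c * y ⟨D, Set.mem_Iic.2 le_rfl⟩ - d * D)) := by
  have hp₀ : Measurable fun ω (t : Set.Iic D) => Y₀ t ω := measurable_pi_lambda _ fun t => hm₀ t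
  have hp₁ : Measurable fun ω (t : Set.Iic D) => Y₁ t ω := measurable_pi_lambda _ fun t => hm₁ t
  have : IsProbabilityMeasure (P.map fun ω (t : Set.Iic D) => Y₁ t ω) :=
    Measure.isProbabilityMeasure_map hp₁.aemeasurable
  -- A finite measure on path space is determined by its finite-dimensional marginals, here those of
  -- the law of `Y₁`.
  refine IsProjectiveLimit.unique
    (P := fun I => (P.map fun ω (t : Set.Iic D) => Y₁ t ω).map I.restrict)
    (fun I => rfl) fun I => ?_
  classical
  -- The endpoint `D` joins the grid because the density is evaluated there.
  obtain ⟨t, n, ht, ht0, htI, htb⟩ := exists_monotone_grid (insert D (I.image Subtype.val))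
  have htD : ∀ k, t k ≤ D := htb D fun i hi => by
    rcases Finset.mem_insert.1 hi with rfl | hi
    · exact le_rfl
    · obtain ⟨j, -, rfl⟩ := Finset.mem_image.1 hi
      exact j.2
  have htn : t n = D := by
    obtain ⟨k, hk, hkD⟩ := htI D (Finset.mem_insert_self _ _)
    exact le_antisymm (htD n) (hkD ▸ ht hk)
  have hk : ∀ i : I, ∃ k ≤ n, t k = i := fun i =>
    htI i (Finset.mem_insert_of_mem (Finset.mem_image_of_mem _ i.2))
  choose k hkn hki using hk
  -- the increments, and the values on the grid as sums of increments
  let R : (ℝ≥0 → Ω → ℝ) → Ω → Fin n → ℝ := fun Y ω j => Y (t (j + 1)) ω - Y (t j) ω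
  let S : (Fin n → ℝ) → I → ℝ := fun x i => ∑ j : Fin n, if (j : ℕ) < k i then x j else 0
  have hS : Measurable S := measurable_pi_lambda _ fun i =>
    Finset.measurable_sum _ fun j _ => by split_ifs <;> fun_prop
  have hR : ∀ Y : ℝ≥0 → Ω → ℝ, (∀ t, Measurable (Y t)) → Measurable (R Y) := fun Y hY =>
    measurable_pi_lambda _ fun j => (hY _).sub (hY _)
  have hSR : ∀ Y : ℝ≥0 → Ω → ℝ, (∀ ω, Y 0 ω = 0) → ∀ ω,
      I.restrict (fun s : Set.Iic D => Y s ω) = S (R Y ω) := by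
    intro Y hY ω
    funext i
    have := sum_fin_ite_lt_eq_sub (fun j => Y (t j) ω) (hkn i)
    simp only [S, R, this, hki, ht0, hY, sub_zero]
    rfl
  have hsum : ∀ Y : ℝ≥0 → Ω → ℝ, (∀ ω, Y 0 ω = 0) → ∀ ω, ∑ j, R Y ω j = Y D ω := by
    intro Y hY ω
    have := sum_fin_ite_lt_eq_sub (fun j => Y (t j) ω) (le_refl n)
    simpa [R, ht0, hY, htn] using this
  have hlen : ∑ j : Fin n, ((t (j + 1) : ℝ) - t j) = D := by
    have := sum_fin_ite_lt_eq_sub (fun j => (t j : ℝ)) (le_refl n)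
    simpa [ht0, htn] using this
  have hind : ∀ Y : ℝ≥0 → Ω → ℝ, (∀ t, Measurable (Y t)) → HasIndepIncrements Y P →
      P.map (R Y) = Measure.pi fun j : Fin n => P.map fun ω => Y (t (j + 1)) ω - Y (t j) ω :=
    fun Y hY hYi => ((hYi.nat ht).precomp Fin.val_injective).map_fun_eq_pi_map
      fun j => ((hY _).sub (hY _)).aemeasurable
  let f : Fin n → ℝ → ENNReal := fun j x =>
    ENNReal.ofReal (Real.exp (c * x - d * ((t (j + 1) : ℝ) - t j)))
  have hf : ∀ j, Measurable (f j) := fun j => by dsimp only [f]; fun_prop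
  have hinc : ∀ j : Fin n, P.map (fun ω => Y₁ (t (j + 1)) ω - Y₁ (t j) ω) =
      (P.map fun ω => Y₀ (t (j + 1)) ω - Y₀ (t j) ω).withDensity (f j) := by
    intro j
    have hle : t j ≤ t (j + 1) := ht (Nat.le_succ _)
    have := hlaw (t j) (t (j + 1) - t j)
    rw [add_tsub_cancel_of_le hle, NNReal.coe_sub hle] at this
    exact this
  have hpr : ∀ (Y : ℝ≥0 → Ω → ℝ), (∀ t, Measurable (Y t)) → ∀ j : Fin n,
      IsProbabilityMeasure (P.map fun ω => Y (t (j + 1)) ω - Y (t j) ω) := fun Y hY j =>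
    Measure.isProbabilityMeasure_map ((hY _).sub (hY _)).aemeasurable
  -- The log-densities are affine in the increment and in the length of the interval, so their sum
  -- depends only on the total increment and on `D`. This is why the density sees only the endpoint
  -- of the path.
  have hprod : ∀ x : Fin n → ℝ, ∏ j, f j (x j) =
      ENNReal.ofReal (Real.exp (c * ∑ j, x j - d * D)) := by
    intro x
    rw [← ENNReal.ofReal_prod_of_nonneg fun _ _ => (Real.exp_pos _).le, ← Real.exp_sum,
      Finset.sum_sub_distrib, ← Finset.mul_sum, ← Finset.mul_sum, hlen]
  have key : P.map (R Y₁) = (P.map (R Y₀)).withDensity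
      fun x => ENNReal.ofReal (Real.exp (c * ∑ j, x j - d * D)) := by
    have h0 := hpr Y₀ hm₀
    have h1 : ∀ j : Fin n, SigmaFinite
        ((P.map fun ω => Y₀ (t (j + 1)) ω - Y₀ (t j) ω).withDensity (f j)) := fun j => by
      rw [← hinc j]
      have := hpr Y₁ hm₁ j
      infer_instance
    rw [hind _ hm₁ hi₁, hind _ hm₀ hi₀]
    simp_rw [hinc]
    rw [pi_withDensity _ hf]
    simp_rw [hprod]
  have hrestr : Measurable (I.restrict : (Set.Iic D → ℝ) → I → ℝ) :=
    Finset.measurable_restrict I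
  have hg : Measurable fun x : ℝ => ENNReal.ofReal (Real.exp (c * x - d * D)) := by fun_prop
  ext E hE
  rw [Measure.map_apply hrestr hE, withDensity_apply _ (hrestr hE),
    setLIntegral_map (hrestr hE) (by fun_prop) hp₀, Measure.map_apply hrestr hE,
    Measure.map_apply hp₁ (hrestr hE)]
  have e1 : (fun ω (s : Set.Iic D) => Y₁ s ω) ⁻¹' (I.restrict ⁻¹' E) = R Y₁ ⁻¹' (S ⁻¹' E) := by
    ext ω; simp only [Set.mem_preimage]; rw [hSR _ hz₁]
  have e0 : (fun ω (s : Set.Iic D) => Y₀ s ω) ⁻¹' (I.restrict ⁻¹' E) = R Y₀ ⁻¹' (S ⁻¹' E) := by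
    ext ω; simp only [Set.mem_preimage]; rw [hSR _ hz₀]
  rw [e1, e0, ← Measure.map_apply (hR _ hm₁) (hS hE), key, withDensity_apply _ (hS hE),
    setLIntegral_map (hS hE) (by fun_prop) (hR _ hm₀)]
  simp_rw [hsum _ hz₀]

/-! ### Exponential tilting of Gaussian and Poisson laws -/

/-- With equal variances the quadratic terms of the two log-densities cancel, which leaves an affine
function of `x`. -/
theorem gaussianReal_eq_withDensity (a₀ a₁ : ℝ) {b : ℝ} (hb : 0 < b) (u : ℝ≥0) {v : ℝ≥0}
    (hv : (v : ℝ) = b ^ 2 * u) :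
    gaussianReal (a₁ * u) v = (gaussianReal (a₀ * u) v).withDensity fun x =>
      ENNReal.ofReal (Real.exp ((a₁ - a₀) / b ^ 2 * x
        - (a₁ ^ 2 - a₀ ^ 2) / (2 * b ^ 2) * u)) := by
  have hg : Measurable fun x : ℝ => ENNReal.ofReal (Real.exp ((a₁ - a₀) / b ^ 2 * x
        - (a₁ ^ 2 - a₀ ^ 2) / (2 * b ^ 2) * u)) := by fun_prop
  -- For `u = 0` there are no Gaussian densities: both laws are the point mass at `0`, where the
  -- tilting factor equals `1`.
  rcases eq_or_ne u 0 with rfl | hu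
  · have : v = 0 := NNReal.coe_eq_zero.1 (by rw [hv, NNReal.coe_zero, mul_zero])
    subst this
    simp only [NNReal.coe_zero, mul_zero, sub_zero, gaussianReal_zero_var]
    simp only [NNReal.coe_zero, mul_zero, sub_zero] at hg
    ext s hs
    rw [withDensity_apply _ hs, ← lintegral_indicator hs, lintegral_dirac' _ (hg.indicator hs)]
    by_cases h0 : (0 : ℝ) ∈ s <;> simp [h0, hs]
  · have hu' : (0 : ℝ) < u := by positivity
    have hv0 : v ≠ 0 := by
      rintro rfl
      have : 0 < b ^ 2 * (u : ℝ) := by positivity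
      simp at hv
      rcases hv with h | h
      · exact hb.ne' h
      · exact hu h
    rw [gaussianReal_of_var_ne_zero _ hv0, gaussianReal_of_var_ne_zero _ hv0,
      ← withDensity_mul _ (measurable_gaussianPDF _ _) hg]
    congr 1
    funext x
    rw [Pi.mul_apply, gaussianPDF_def, gaussianPDF_def,
      ← ENNReal.ofReal_mul (gaussianPDFReal_nonneg _ _ _)]
    simp only [gaussianPDFReal]
    rw [mul_assoc _ (Real.exp _) (Real.exp _), ← Real.exp_add, hv]
    congr 3
    field_simp
    ring

/-- The ratio of point masses is `(l₁ / l₀) ^ n` times a constant. Positivity of both intensities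
allows the power to be written as an exponential, as `map_path_eq_withDensity` requires. -/
theorem poissonMeasure_eq_withDensity {l₀ l₁ : ℝ≥0} (h0 : 0 < l₀) (h1 : 0 < l₁) (u : ℝ≥0) :
    poissonMeasure (l₁ * u) = (poissonMeasure (l₀ * u)).withDensity fun n =>
      ENNReal.ofReal (Real.exp (Real.log (l₁ / l₀) * n - (l₁ - l₀) * u)) := by
  refine Measure.ext_of_singleton fun n => ?_
  rw [withDensity_apply _ (measurableSet_singleton n), lintegral_singleton,
    poissonMeasure_singleton, poissonMeasure_singleton, ← ENNReal.ofReal_mul (Real.exp_pos _).le]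
  congr 1
  have h0' : (0 : ℝ) < l₀ := h0
  have h1' : (0 : ℝ) < l₁ := h1
  have hl : Real.exp (Real.log ((l₁ : ℝ) / l₀) * n) = ((l₁ : ℝ) / l₀) ^ n := by
    rw [mul_comm, Real.exp_nat_mul, Real.exp_log (by positivity)]
  rw [sub_eq_add_neg, Real.exp_add, hl]
  push_cast
  have he : Real.exp (-((l₁ : ℝ) * u)) =
      Real.exp (-((l₁ - l₀ : ℝ) * u)) * Real.exp (-((l₀ : ℝ) * u)) := by
    rw [← Real.exp_add]; congr 1; ring
  rw [he, mul_pow, mul_pow, div_pow]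
  field_simp

/-! ### Law of a sample path of a risky arm: likelihood ratio of the two states -/

namespace BanditGame

theorem measurable_total (G : BanditGame) : Measurable (SamplePath.total (G := G)) :=
  (measurable_pi_apply _).comp (measurable_fst.comp measurable_subtype_coe)

theorem measurable_jumps (G : BanditGame) : Measurable (SamplePath.jumps (G := G)) :=
  (measurable_pi_apply _).comp (measurable_snd.comp measurable_subtype_coe)

/-- Log-likelihood gain per lump sum. -/
noncomputable def logJump (G : BanditGame) : ℝ :=
  if G.lam 0 = 0 then 0 else Real.log (G.lam 1 / G.lam 0)

/-- Separates the contribution of the continuous part of the payoff path from that of the lump sums.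
These parts are independent, and the factors are the densities in `map_drifted_path` and
`map_counted_path`. -/
theorem likelihoodRatio_inr {G : BanditGame} (y : G.SamplePath) :
    likelihoodRatio (.inr y : G.Obs) =
      Real.exp ((G.α 1 - G.α 0) / G.σ ^ 2 * (y.total - G.h * y.jumps)
          - (G.α 1 ^ 2 - G.α 0 ^ 2) / (2 * G.σ ^ 2) * G.Δ) *
        Real.exp (G.logJump * y.jumps - (G.lam 1 - G.lam 0) * G.Δ) := by
  have hs := G.σ_pos.ne'
  have hr : (if G.lam 0 = 0 then 1 else (G.lam 1 / G.lam 0 : ℝ)) ^ y.jumps =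
      Real.exp (G.logJump * y.jumps) := by
    unfold logJump
    split_ifs with h0
    · simp
    · have h0 : 0 < G.lam 0 := pos_iff_ne_zero.2 h0
      have h1 : 0 < G.lam 1 := h0.trans_le G.lam_le
      rw [mul_comm, Real.exp_nat_mul, Real.exp_log (by positivity)]
  rw [likelihoodRatio, hr, ← Real.exp_add, ← Real.exp_add]
  congr 1
  field_simp
  ring

end BanditGame

namespace ArmNoise

open BanditGame

variable {G : BanditGame} {Ω : Type*} [MeasurableSpace Ω] (X : ArmNoise G Ω)

/-- Payoff process of a risky arm net of lump sums. -/
noncomputable def drifted (θ : Fin 2) (t : ℝ≥0) (ω : Ω) : ℝ := G.α θ * t + G.σ * X.Z t ω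

/-- Number of lump sums, as a real number. -/
def counted (θ : Fin 2) (t : ℝ≥0) (ω : Ω) : ℝ := X.J θ t ω

theorem measurable_drifted (θ : Fin 2) (t : ℝ≥0) : Measurable (X.drifted θ t) := by
  have := X.wiener.measurable t
  unfold drifted
  fun_prop

theorem measurable_counted (θ : Fin 2) (t : ℝ≥0) : Measurable (X.counted θ t) :=
  measurable_from_top.comp ((X.poisson θ).measurable t)

theorem hasIndepIncrements_drifted (θ : Fin 2) : HasIndepIncrements (X.drifted θ) X.P := by
  have h := X.wiener.toIsPreBrownianReal.hasIndepIncrements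
  intro n t ht
  have := (h n t ht).comp (fun i x => G.α θ * ((t i.succ : ℝ) - t i.castSucc) + G.σ * x)
    fun i => by fun_prop
  refine this.congr fun i => .of_forall fun ω => ?_
  simp only [Function.comp, drifted]
  ring

theorem hasIndepIncrements_counted (θ : Fin 2) : HasIndepIncrements (X.counted θ) X.P := by
  intro n t ht
  have := ((X.poisson θ).indepIncrements n t ht).comp (fun i (x : ℕ) => (x : ℝ))
    fun i => measurable_from_top
  refine this.congr fun i => .of_forall fun ω => ?_
  -- Increments of `J` are truncated differences of natural numbers; monotone paths make them agree
  -- with real differences.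
  have hle : t i.castSucc ≤ t i.succ := ht (Fin.castSucc_le_succ i)
  simp only [Function.comp, counted]
  rw [Nat.cast_sub ((X.poisson θ).monotone ω hle)]

theorem map_drifted_sub (θ : Fin 2) (t u : ℝ≥0) :
    X.P.map (fun ω => X.drifted θ (t + u) ω - X.drifted θ t ω) =
      gaussianReal (G.α θ * u) (NNReal.mk (G.σ ^ 2) (sq_nonneg _) * u) := by
  have h := X.wiener.toIsPreBrownianReal.hasLaw_sub (t + u) t
  have hd : nndist (t + u : ℝ≥0).1 t.1 = u := by
    ext
    change dist ((t + u : ℝ≥0) : ℝ) (t : ℝ) = u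
    simp
  rw [hd] at h
  have h2 := (gaussianReal_const_add (gaussianReal_const_mul h G.σ) (G.α θ * u)).map_eq
  simp only [mul_zero, zero_add, Pi.sub_apply] at h2
  rw [← h2]
  congr 1
  funext ω
  simp only [drifted]
  push_cast
  ring

theorem map_counted_sub (θ : Fin 2) (t u : ℝ≥0) :
    X.P.map (fun ω => X.counted θ (t + u) ω - X.counted θ t ω) =
      (poissonMeasure (G.lam θ * u)).map (Nat.cast : ℕ → ℝ) := by
  have h := (X.poisson θ).hasLaw_increment t u
  have hm : Measurable fun ω => X.J θ (t + u) ω - X.J θ t ω :=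
    ((X.poisson θ).measurable _).sub ((X.poisson θ).measurable _)
  rw [← h.map_eq, Measure.map_map measurable_from_top hm]
  congr 1
  funext ω
  simp only [counted, Function.comp]
  rw [Nat.cast_sub ((X.poisson θ).monotone ω le_self_add)]

theorem map_drifted_path :
    X.P.map (fun ω (t : Set.Iic G.Δ) => X.drifted 1 t ω) =
      (X.P.map fun ω (t : Set.Iic G.Δ) => X.drifted 0 t ω).withDensity fun y =>
        ENNReal.ofReal (Real.exp ((G.α 1 - G.α 0) / G.σ ^ 2 * y ⟨G.Δ, Set.mem_Iic.2 le_rfl⟩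
          - (G.α 1 ^ 2 - G.α 0 ^ 2) / (2 * G.σ ^ 2) * G.Δ)) := by
  have := X.isProb
  refine map_path_eq_withDensity X.P G.Δ (X.measurable_drifted 0) (X.measurable_drifted 1)
    (fun ω => by simp [drifted, X.wiener.zero]) (fun ω => by simp [drifted, X.wiener.zero])
    (X.hasIndepIncrements_drifted 0) (X.hasIndepIncrements_drifted 1) _ _ fun t u => ?_
  rw [map_drifted_sub, map_drifted_sub]
  exact gaussianReal_eq_withDensity _ _ G.σ_pos u (by rw [NNReal.coe_mul, NNReal.coe_mk])

theorem measure_jumps_eq_zero (θ : Fin 2) :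
    X.P {ω | X.J θ G.Δ ω = 0} = ENNReal.ofReal (Real.exp (-(G.lam θ * G.Δ))) := by
  have h := (X.poisson θ).hasLaw_increment 0 G.Δ
  have hm : Measurable fun ω => X.J θ (0 + G.Δ) ω - X.J θ 0 ω :=
    ((X.poisson θ).measurable _).sub ((X.poisson θ).measurable _)
  have h1 := congrArg (fun μ => μ {0}) h.map_eq
  simp only [poissonMeasure_singleton] at h1
  rw [Measure.map_apply hm (measurableSet_singleton 0)] at h1
  simp only [pow_zero, Nat.factorial_zero, Nat.cast_one, mul_one, div_one, NNReal.coe_mul] at h1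
  rw [← h1]
  congr 1
  ext ω
  simp [(X.poisson θ).zero]

theorem ae_jumps_eq_zero {θ : Fin 2} (h0 : G.lam θ = 0) : ∀ᵐ ω ∂X.P, X.J θ G.Δ ω = 0 := by
  have := X.isProb
  have hm : MeasurableSet {ω | X.J θ G.Δ ω = 0} :=
    (X.poisson θ).measurable _ (measurableSet_singleton 0)
  refine (prob_compl_eq_zero_iff hm).2 ?_
  rw [X.measure_jumps_eq_zero, h0]
  simp

theorem counted_path_eq_zero {θ : Fin 2} {ω : Ω} (h : X.J θ G.Δ ω = 0) :
    (fun t : Set.Iic G.Δ => X.counted θ t ω) = 0 := by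
  funext t
  have := (X.poisson θ).monotone ω t.2
  simp only [counted, Pi.zero_apply, Nat.cast_eq_zero]
  dsimp only at this
  omega

/-- Paths of the counting process that do not reveal state `1` with certainty. -/
def inconclusive (G : BanditGame) : Set (Set.Iic G.Δ → ℝ) :=
  {j | G.lam 0 = 0 → 0 < G.lam 1 → j ⟨G.Δ, Set.mem_Iic.2 le_rfl⟩ = 0}

theorem measurableSet_inconclusive : MeasurableSet (inconclusive G) := by
  have : MeasurableSet {j : Set.Iic G.Δ → ℝ | j ⟨G.Δ, Set.mem_Iic.2 le_rfl⟩ = 0} :=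
    measurable_pi_apply (⟨G.Δ, Set.mem_Iic.2 le_rfl⟩ : Set.Iic G.Δ) (measurableSet_singleton 0)
  exact (MeasurableSet.const _).imp ((MeasurableSet.const _).imp this)

/-- If `lam 0 = 0`, the law in state 0 is the point mass at the zero path, and the inconclusive part
of the law in state 1 is `exp (-lam 1 * Δ)` times that point mass. If `lam 0 > 0`, every path is
inconclusive and Poisson tilting applies. -/
theorem map_counted_path :
    (X.P.map fun ω (t : Set.Iic G.Δ) => X.counted 1 t ω).restrict (inconclusive G) =
      (X.P.map fun ω (t : Set.Iic G.Δ) => X.counted 0 t ω).withDensity fun y =>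
        ENNReal.ofReal (Real.exp (G.logJump * y ⟨G.Δ, Set.mem_Iic.2 le_rfl⟩
          - (G.lam 1 - G.lam 0) * G.Δ)) := by
  have := X.isProb
  have hp : ∀ θ, Measurable fun ω (t : Set.Iic G.Δ) => X.counted θ t ω := fun θ =>
    measurable_pi_lambda _ fun t => X.measurable_counted θ t
  rcases eq_or_ne (G.lam 0) 0 with h0 | h0
  · ext E hE
    rw [Measure.restrict_apply hE, withDensity_apply _ hE,
      Measure.map_apply (hp 1) (hE.inter measurableSet_inconclusive),
      setLIntegral_map hE (by fun_prop) (hp 0), ← lintegral_indicator (hp 0 hE)]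
    have e0 : ∀ᵐ ω ∂X.P, ((fun ω (t : Set.Iic G.Δ) => X.counted 0 t ω) ⁻¹' E).indicator
        (fun ω => ENNReal.ofReal (Real.exp (G.logJump * X.counted 0 G.Δ ω
          - (G.lam 1 - G.lam 0) * G.Δ))) ω =
        E.indicator (fun _ => ENNReal.ofReal (Real.exp (-(G.lam 1 * G.Δ)))) 0 := by
      filter_upwards [X.ae_jumps_eq_zero h0] with ω hω
      have hz := X.counted_path_eq_zero hω
      by_cases hE0 : (0 : Set.Iic G.Δ → ℝ) ∈ E
      · rw [Set.indicator_of_mem hE0, Set.indicator_of_mem (by simpa [Set.mem_preimage, hz])]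
        simp [counted, hω, h0]
      · rw [Set.indicator_of_notMem hE0,
          Set.indicator_of_notMem (by simpa [Set.mem_preimage, hz])]
    rw [lintegral_congr_ae e0, lintegral_const, measure_univ, mul_one]
    -- If `lam 1 = 0` as well, all paths count as inconclusive, but almost surely there is no lump
    -- sum, so the two events still have equal probability.
    have e1 : X.P ((fun ω (t : Set.Iic G.Δ) => X.counted 1 t ω) ⁻¹' (E ∩ inconclusive G)) =
        X.P ((fun ω (t : Set.Iic G.Δ) => X.counted 1 t ω) ⁻¹' E ∩ {ω | X.J 1 G.Δ ω = 0}) := by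
      rcases eq_or_ne (G.lam 1) 0 with h1 | h1
      · refine measure_congr ?_
        filter_upwards [X.ae_jumps_eq_zero h1] with ω hω
        refine propext ?_
        change (_ ∧ _) ↔ (_ ∧ X.J 1 G.Δ ω = 0)
        simp [inconclusive, h1, hω]
      · congr 1
        ext ω
        simp [inconclusive, h0, pos_iff_ne_zero.2 h1, counted]
    rw [e1]
    by_cases hE0 : (0 : Set.Iic G.Δ → ℝ) ∈ E
    · rw [Set.indicator_of_mem hE0, ← X.measure_jumps_eq_zero]
      congr 1
      ext ω
      simp only [Set.mem_inter_iff, Set.mem_preimage, Set.mem_ofPred_eq, and_iff_right_iff_imp]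
      intro hω
      rwa [X.counted_path_eq_zero hω]
    · rw [Set.indicator_of_notMem hE0]
      convert measure_empty (μ := X.P)
      ext ω
      simp only [Set.mem_inter_iff, Set.mem_preimage, Set.mem_ofPred_eq, Set.mem_empty_iff_false,
        iff_false, not_and]
      intro h1 hω
      rw [X.counted_path_eq_zero hω] at h1
      exact hE0 h1
  · have h0' : 0 < G.lam 0 := pos_iff_ne_zero.2 h0
    have h1' : 0 < G.lam 1 := h0'.trans_le G.lam_le
    have hu : inconclusive G = Set.univ := by simp [inconclusive, h0]
    rw [hu, Measure.restrict_univ]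
    refine map_path_eq_withDensity X.P G.Δ (X.measurable_counted 0) (X.measurable_counted 1)
      (fun ω => by simp [counted, (X.poisson 0).zero])
      (fun ω => by simp [counted, (X.poisson 1).zero])
      (X.hasIndepIncrements_counted 0) (X.hasIndepIncrements_counted 1) _ _ fun t u => ?_
    rw [map_counted_sub, map_counted_sub, poissonMeasure_eq_withDensity h0' h1',
      ← withDensity_comp_map _ measurable_from_top (by fun_prop)]
    simp [logJump, h0]

theorem indepFun_paths (θ : Fin 2) :
    IndepFun (fun ω (t : Set.Iic G.Δ) => X.drifted θ t ω)
      (fun ω (t : Set.Iic G.Δ) => X.counted θ t ω) X.P :=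
  (X.indep θ).comp (φ := fun (z : ℝ≥0 → ℝ) (t : Set.Iic G.Δ) => G.α θ * ((t : ℝ≥0) : ℝ) + G.σ * z t)
    (ψ := fun (j : ℝ≥0 → ℕ) (t : Set.Iic G.Δ) => (j t : ℝ))
    (measurable_pi_lambda _ fun t => by fun_prop)
    (measurable_pi_lambda _ fun t => measurable_from_top.comp (measurable_pi_apply _))

theorem map_paths (θ : Fin 2) :
    X.P.map (fun ω => ((fun t : Set.Iic G.Δ => X.drifted θ t ω),
      fun t : Set.Iic G.Δ => X.counted θ t ω)) =
      (X.P.map fun ω (t : Set.Iic G.Δ) => X.drifted θ t ω).prod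
        (X.P.map fun ω (t : Set.Iic G.Δ) => X.counted θ t ω) :=
  haveI := X.isProb
  (indepFun_iff_map_prod_eq_prod_map_map
    (measurable_pi_lambda _ fun t : Set.Iic G.Δ => X.measurable_drifted θ t).aemeasurable
    (measurable_pi_lambda _ fun t : Set.Iic G.Δ => X.measurable_counted θ t).aemeasurable).1
    (X.indepFun_paths θ)

/-- A lump sum that reveals state `1` with certainty has been observed. -/
def conclusive (G : BanditGame) : Set G.SamplePath :=
  {y | G.lam 0 = 0 ∧ 0 < G.lam 1 ∧ 0 < y.jumps}

theorem measurableSet_conclusive : MeasurableSet (conclusive G) :=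
  (MeasurableSet.const _).inter ((MeasurableSet.const _).inter
    (G.measurable_jumps measurableSet_Ioi))

theorem pathLaw_zero_conclusive : X.pathLaw 0 (conclusive G) = 0 := by
  rw [pathLaw, Measure.map_apply (X.measurable_samplePath 0) measurableSet_conclusive]
  by_cases h0 : G.lam 0 = 0
  · refine measure_mono_null (fun ω hω => ?_) (X.ae_jumps_eq_zero h0)
    exact (show 0 < X.J 0 G.Δ ω from hω.2.2).ne'
  · simp [conclusive, h0]

/-- On inconclusive sample paths, `likelihoodRatio` is the density of the law in state `1` with
respect to the law in state `0`. -/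
theorem pathLaw_restrict_eq_withDensity :
    (X.pathLaw 1).restrict (conclusive G)ᶜ =
      (X.pathLaw 0).withDensity fun y => ENNReal.ofReal (likelihoodRatio (.inr y)) := by
  have := X.isProb
  have hW : ∀ θ, Measurable fun ω (t : Set.Iic G.Δ) => X.drifted θ t ω := fun θ =>
    measurable_pi_lambda _ fun t => X.measurable_drifted θ t
  have hJ : ∀ θ, Measurable fun ω (t : Set.Iic G.Δ) => X.counted θ t ω := fun θ =>
    measurable_pi_lambda _ fun t => X.measurable_counted θ t
  have hmt := G.measurable_total
  have hmj : Measurable fun y : G.SamplePath => (y.jumps : ℝ) :=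
    measurable_from_top.comp G.measurable_jumps
  -- recovering the sample path from its two components
  let Φ : (Set.Iic G.Δ → ℝ) × (Set.Iic G.Δ → ℝ) → (Set.Iic G.Δ → ℝ) × (Set.Iic G.Δ → ℕ) :=
    fun w => (fun t => w.1 t + G.h * w.2 t, fun t => ⌊w.2 t⌋₊)
  have hΦ : Measurable Φ := by
    refine Measurable.prodMk (measurable_pi_lambda _ fun t => by fun_prop)
      (measurable_pi_lambda _ fun t => Nat.measurable_floor.comp (by fun_prop))
  have hΦs : ∀ θ ω, Φ (fun t => X.drifted θ t ω, fun t => X.counted θ t ω) =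
      (X.samplePath θ ω).1 := by
    intro θ ω
    simp only [Φ, samplePath, counted, drifted, cumPayoff, Nat.floor_natCast]
  ext E hE
  have hE' := hE
  obtain ⟨E', hEm, hEE⟩ := hE
  have hmem : ∀ y : G.SamplePath, y ∈ E ↔ y.1 ∈ E' := fun y => by rw [← hEE]; rfl
  have hlr : Measurable fun y : G.SamplePath => ENNReal.ofReal (likelihoodRatio (.inr y)) := by
    simp_rw [likelihoodRatio_inr]
    fun_prop
  -- Conclusiveness concerns the lump sums only. The restricted law is thus still a product, and its
  -- density is the product of the densities of the two components.
  have key := Measure.prod_restrict (μ := X.P.map fun ω (t : Set.Iic G.Δ) => X.drifted 1 t ω)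
    (ν := X.P.map fun ω (t : Set.Iic G.Δ) => X.counted 1 t ω) Set.univ (inconclusive G)
  rw [X.map_counted_path, Measure.restrict_univ, X.map_drifted_path,
      prod_withDensity (by fun_prop) (by fun_prop), ← X.map_drifted_path] at key
  replace key := key.symm
  have hF := hΦ hEm
  have key2 := DFunLike.congr_fun key (Φ ⁻¹' E')
  rw [Measure.restrict_apply hF, withDensity_apply _ hF, ← X.map_paths 1, ← X.map_paths 0,
    Measure.map_apply ((hW 1).prodMk (hJ 1))
      (hF.inter (MeasurableSet.univ.prod measurableSet_inconclusive)),
    setLIntegral_map hF (by fun_prop) ((hW 0).prodMk (hJ 0))] at key2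
  rw [Measure.restrict_apply hE', withDensity_apply _ hE', pathLaw, pathLaw,
    Measure.map_apply (X.measurable_samplePath 1) (hE'.inter measurableSet_conclusive.compl),
    setLIntegral_map hE' hlr (X.measurable_samplePath 0)]
  convert key2 using 1
  · congr 1
    ext ω
    have hj : (X.samplePath 1 ω).jumps = X.J 1 G.Δ ω := rfl
    have hc : X.counted 1 G.Δ ω = 0 ↔ X.J 1 G.Δ ω = 0 := Nat.cast_eq_zero
    simp only [Set.mem_preimage, Set.mem_inter_iff, hΦs, Set.mem_prod, Set.mem_univ, true_and,
      conclusive, inconclusive, Set.mem_compl_iff, Set.mem_ofPred_eq, not_and, not_lt,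
      Nat.le_zero, hc, hmem, hj]
  · have e : X.samplePath 0 ⁻¹' E =
        (fun ω => ((fun t : Set.Iic G.Δ => X.drifted 0 t ω),
          fun t : Set.Iic G.Δ => X.counted 0 t ω)) ⁻¹' (Φ ⁻¹' E') := by
      ext ω
      simp only [Set.mem_preimage, hΦs, hmem]
    rw [e]
    refine lintegral_congr fun ω => ?_
    rw [likelihoodRatio_inr, ENNReal.ofReal_mul (Real.exp_pos _).le]
    have h1 : (X.samplePath 0 ω).total - G.h * (X.samplePath 0 ω).jumps = X.drifted 0 G.Δ ω := by
      simp [SamplePath.total, SamplePath.jumps, samplePath, cumPayoff, drifted]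
    have h2 : ((X.samplePath 0 ω).jumps : ℝ) = X.counted 0 G.Δ ω := rfl
    rw [h1, h2]

end ArmNoise

namespace BanditGame

variable {G : BanditGame} {Ω : Type*} [MeasurableSpace Ω] (X : ArmNoise G Ω)

/-! ### Measurability of Bayesian updating -/

theorem measurable_likelihoodRatio : Measurable (likelihoodRatio (G := G)) := by
  refine measurable_fun_sum measurable_const ?_
  have := G.measurable_total
  have : Measurable fun y : G.SamplePath => (y.jumps : ℝ) :=
    measurable_from_top.comp G.measurable_jumps
  change Measurable fun y : G.SamplePath => likelihoodRatio (.inr y : G.Obs)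
  simp_rw [likelihoodRatio_inr]
  fun_prop

/-- Observations of one player that reveal state `1` with certainty. -/
def conclusiveObs (G : BanditGame) : Set G.Obs := {o | G.lam 0 = 0 ∧ 0 < G.lam 1 ∧ HasJump o}

theorem inl_notMem_conclusiveObs (u : Unit) : (.inl u : G.Obs) ∉ conclusiveObs G :=
  fun h => h.2.2

theorem measurableSet_conclusiveObs : MeasurableSet (conclusiveObs G) := by
  refine measurableSet_sum_iff.2 ⟨?_, ?_⟩
  · convert MeasurableSet.empty
    ext u
    simpa using inl_notMem_conclusiveObs u
  · exact ArmNoise.measurableSet_conclusive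

/-- Observations of all players among which one reveals state `1` with certainty. -/
def conclusiveProfile (G : BanditGame) (ι : Type) : Set (ι → G.Obs) :=
  {o | ∃ i, o i ∈ conclusiveObs G}

theorem compl_conclusiveProfile (ι : Type) :
    (conclusiveProfile G ι)ᶜ = Set.univ.pi fun _ => (conclusiveObs G)ᶜ := by
  ext o
  simp [conclusiveProfile]

theorem measurableSet_conclusiveProfile (ι : Type) [Fintype ι] :
    MeasurableSet (conclusiveProfile G ι) := by
  rw [← MeasurableSet.compl_iff, compl_conclusiveProfile]
  exact MeasurableSet.univ_pi fun _ => measurableSet_conclusiveObs.compl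

theorem bayesUpdate_of_mem {ι : Type} [Fintype ι] (p : unitInterval) {o : ι → G.Obs}
    (ho : o ∈ conclusiveProfile G ι) : bayesUpdate p o = 1 := by
  obtain ⟨i, h0, h1, hi⟩ := ho
  exact if_pos ⟨h0, h1, i, hi⟩

theorem bayesUpdate_of_notMem {ι : Type} [Fintype ι] (p : unitInterval) {o : ι → G.Obs}
    (ho : o ∉ conclusiveProfile G ι) :
    (bayesUpdate p o : ℝ) = p * (∏ i, likelihoodRatio (o i)) /
      (p * (∏ i, likelihoodRatio (o i)) + (1 - p)) := by
  rw [bayesUpdate, if_neg]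
  rintro ⟨h0, h1, i, hi⟩
  exact ho ⟨i, h0, h1, hi⟩

theorem measurable_bayesUpdate {ι : Type} [Fintype ι] :
    Measurable fun x : unitInterval × (ι → G.Obs) => bayesUpdate x.1 x.2 := by
  classical
  have hL : ∀ i, Measurable fun x : unitInterval × (ι → G.Obs) => likelihoodRatio (x.2 i) :=
    fun i => measurable_likelihoodRatio.comp ((measurable_pi_apply i).comp measurable_snd)
  have hP : Measurable fun x : unitInterval × (ι → G.Obs) => ∏ i, likelihoodRatio (x.2 i) :=
    Finset.measurable_prod _ fun i _ => hL i
  have hp : Measurable fun x : unitInterval × (ι → G.Obs) => (x.1 : ℝ) :=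
    measurable_subtype_coe.comp measurable_fst
  have : (fun x : unitInterval × (ι → G.Obs) => (bayesUpdate x.1 x.2 : ℝ)) =
    fun x : unitInterval × (ι → G.Obs) =>
      if x ∈ Prod.snd ⁻¹' conclusiveProfile G ι then 1
      else x.1 * (∏ i, likelihoodRatio (x.2 i)) /
        (x.1 * (∏ i, likelihoodRatio (x.2 i)) + (1 - x.1)) := by
    funext x
    split_ifs with h
    · rw [bayesUpdate_of_mem _ h]; rfl
    · exact bayesUpdate_of_notMem _ h
  refine Measurable.subtype_mk (f := fun x : unitInterval × (ι → G.Obs) =>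
    (bayesUpdate x.1 x.2 : ℝ)) (h := fun x => (bayesUpdate x.1 x.2).2) ?_
  rw [this]
  exact Measurable.ite (measurable_snd (measurableSet_conclusiveProfile ι)) measurable_const
    (by fun_prop)

/-! ### Law of the observations of one period -/

/-- Law of the observation about a player who uses the risky arm with probability `q`,
conditional on the state `θ`. -/
noncomputable def obsLaw (θ : Fin 2) (q : unitInterval) : Measure G.Obs :=
  ENNReal.ofReal q • (X.pathLaw θ).map .inr + ENNReal.ofReal (1 - q) • Measure.dirac (.inl ())

theorem ofReal_add_ofReal_one_sub (q : unitInterval) :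
    ENNReal.ofReal q + ENNReal.ofReal (1 - q) = 1 := by
  rw [← ENNReal.ofReal_add q.2.1 (sub_nonneg.2 q.2.2)]
  simp

theorem isProbabilityMeasure_mixture {E : Type*} [MeasurableSpace E] (μ ν : Measure E)
    [IsProbabilityMeasure μ] [IsProbabilityMeasure ν] (q : unitInterval) :
    IsProbabilityMeasure (ENNReal.ofReal q • μ + ENNReal.ofReal (1 - q) • ν) :=
  ⟨by simp [ofReal_add_ofReal_one_sub]⟩

instance (θ : Fin 2) : IsProbabilityMeasure ((X.pathLaw θ).map (.inr : G.SamplePath → G.Obs)) :=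
  Measure.isProbabilityMeasure_map measurable_inr.aemeasurable

instance (θ : Fin 2) (q : unitInterval) : IsProbabilityMeasure (obsLaw X θ q) :=
  isProbabilityMeasure_mixture _ _ q

theorem obsLaw_one (θ : Fin 2) : obsLaw X θ 1 = (X.pathLaw θ).map .inr := by simp [obsLaw]

theorem obsLaw_zero (θ : Fin 2) : obsLaw X θ 0 = Measure.dirac (.inl ()) := by simp [obsLaw]

theorem obsLaw_eq_mixture (θ : Fin 2) (q : unitInterval) :
    obsLaw X θ q = ENNReal.ofReal q • obsLaw X θ 1 + ENNReal.ofReal (1 - q) • obsLaw X θ 0 := by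
  rw [obsLaw_one, obsLaw_zero, obsLaw]

theorem obsLaw_zero_conclusiveObs (q : unitInterval) : obsLaw X 0 q (conclusiveObs G) = 0 := by
  have h1 : (X.pathLaw 0).map .inr (conclusiveObs G) = 0 := by
    rw [Measure.map_apply measurable_inr measurableSet_conclusiveObs]
    exact X.pathLaw_zero_conclusive
  have h2 : Measure.dirac (.inl () : G.Obs) (conclusiveObs G) = 0 := by
    rw [Measure.dirac_apply' _ measurableSet_conclusiveObs,
      Set.indicator_of_notMem (inl_notMem_conclusiveObs ())]
  simp [obsLaw, h1, h2]

/-- The probability `q` of using the risky arm is the same in both states, so the choice of arm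
carries no information. Only the sample path contributes to the likelihood ratio. -/
theorem obsLaw_restrict_eq_withDensity (q : unitInterval) :
    (obsLaw X 1 q).restrict (conclusiveObs G)ᶜ =
      (obsLaw X 0 q).withDensity fun o => ENNReal.ofReal (likelihoodRatio o) := by
  have hm := measurable_likelihoodRatio (G := G)
  rw [obsLaw, obsLaw, Measure.restrict_add, Measure.restrict_smul, Measure.restrict_smul,
    withDensity_add_measure, withDensity_smul_measure, withDensity_smul_measure,
    Measure.restrict_map measurable_inr measurableSet_conclusiveObs.compl,
    ← withDensity_comp_map _ measurable_inr (by fun_prop)]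
  congr 2
  · congr 1
    exact X.pathLaw_restrict_eq_withDensity
  · ext s hs
    rw [withDensity_apply _ hs, ← lintegral_indicator hs,
      lintegral_dirac' _ ((by fun_prop : Measurable fun o : G.Obs =>
        ENNReal.ofReal (likelihoodRatio o)).indicator hs), Measure.restrict_apply hs,
      Measure.dirac_apply' _ (hs.inter measurableSet_conclusiveObs.compl)]
    by_cases h : (.inl () : G.Obs) ∈ s
    · rw [Set.indicator_of_mem h, Set.indicator_of_mem (Set.mem_inter h (inl_notMem_conclusiveObs ()))]
      simp [likelihoodRatio]
    · rw [Set.indicator_of_notMem h, Set.indicator_of_notMem fun h' => h h'.1]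

/-! ### Bayes' rule for profiles of observations -/

section Profile

variable {ι : Type} [Fintype ι]

/-- Law of the observations about all players who use the mixed actions `q`, conditional on the
state `θ`. -/
noncomputable def stageLaw (θ : Fin 2) (q : ι → unitInterval) : Measure (ι → G.Obs) :=
  Measure.pi fun i => obsLaw X θ (q i)

instance (θ : Fin 2) (q : ι → unitInterval) : IsProbabilityMeasure (stageLaw X θ q) := by
  unfold stageLaw; infer_instance

theorem stageLaw_zero_conclusiveProfile (q : ι → unitInterval) :
    stageLaw X 0 q (conclusiveProfile G ι) = 0 := by
  rw [← prob_compl_eq_one_iff (measurableSet_conclusiveProfile ι), compl_conclusiveProfile,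
    stageLaw, Measure.pi_pi]
  refine Finset.prod_eq_one fun i _ => ?_
  rw [prob_compl_eq_one_iff measurableSet_conclusiveObs]
  exact obsLaw_zero_conclusiveObs X (q i)

/-- Inconclusive profiles form a box, so the density of the product law is the product of the
individual likelihood ratios. -/
theorem stageLaw_restrict_eq_withDensity (q : ι → unitInterval) :
    (stageLaw X 1 q).restrict (conclusiveProfile G ι)ᶜ =
      (stageLaw X 0 q).withDensity fun o => ENNReal.ofReal (∏ i, likelihoodRatio (o i)) := by
  have hm := measurable_likelihoodRatio (G := G)
  have : ∀ i : ι, SigmaFinite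
      ((obsLaw X 0 (q i)).withDensity fun o => ENNReal.ofReal (likelihoodRatio o)) := fun i => by
    rw [← obsLaw_restrict_eq_withDensity]; infer_instance
  rw [compl_conclusiveProfile, stageLaw, Measure.restrict_pi_pi]
  simp_rw [obsLaw_restrict_eq_withDensity]
  rw [pi_withDensity _ fun i => by fun_prop]
  simp_rw [ENNReal.ofReal_prod_of_nonneg fun i _ => (likelihoodRatio_pos _).le]
  rfl

/-- Law of the observations about all players at the common belief `p`. -/
noncomputable def mixedStageLaw (p : unitInterval) (q : ι → unitInterval) : Measure (ι → G.Obs) :=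
  ENNReal.ofReal p • stageLaw X 1 q + ENNReal.ofReal (1 - p) • stageLaw X 0 q

instance (p : unitInterval) (q : ι → unitInterval) :
    IsProbabilityMeasure (mixedStageLaw X p q) := isProbabilityMeasure_mixture _ _ p

/-- Lebesgue decomposition with respect to the law in state 0. The density is the denominator of the
updating formula, and the singular part lives on conclusive profiles, where the posterior is `1`. -/
theorem mixedStageLaw_eq (p : unitInterval) (q : ι → unitInterval) :
    mixedStageLaw X p q = (stageLaw X 0 q).withDensity (fun o =>
        ENNReal.ofReal (p * (∏ i, likelihoodRatio (o i)) + (1 - p))) +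
      ENNReal.ofReal p • (stageLaw X 1 q).restrict (conclusiveProfile G ι) := by
  have hm := measurable_likelihoodRatio (G := G)
  have hL : Measurable fun o : ι → G.Obs => ∏ i, likelihoodRatio (o i) :=
    Finset.measurable_prod _ fun i _ => hm.comp (measurable_pi_apply i)
  have e : (stageLaw X 1 q) = (stageLaw X 1 q).restrict (conclusiveProfile G ι) +
      (stageLaw X 1 q).restrict (conclusiveProfile G ι)ᶜ :=
    (Measure.restrict_add_restrict_compl (measurableSet_conclusiveProfile ι)).symm
  have hd : (fun o : ι → G.Obs => ENNReal.ofReal (p * (∏ i, likelihoodRatio (o i)) + (1 - p))) =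
      (ENNReal.ofReal p • fun o : ι → G.Obs => ENNReal.ofReal (∏ i, likelihoodRatio (o i))) +
        fun _ => ENNReal.ofReal (1 - p) := by
    funext o
    have h0 : 0 ≤ ∏ i, likelihoodRatio (o i) :=
      Finset.prod_nonneg fun i _ => (likelihoodRatio_pos _).le
    rw [Pi.add_apply, Pi.smul_apply, smul_eq_mul, ← ENNReal.ofReal_mul p.2.1,
      ← ENNReal.ofReal_add (mul_nonneg p.2.1 h0) (sub_nonneg.2 p.2.2)]
  rw [mixedStageLaw, hd, withDensity_add_right _ measurable_const, withDensity_const,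
    withDensity_smul _ (by fun_prop), ← stageLaw_restrict_eq_withDensity]
  conv_lhs => rw [e]
  rw [smul_add]
  abel

theorem ae_stageLaw_zero_notMem (q : ι → unitInterval) :
    ∀ᵐ o ∂(stageLaw X 0 q), o ∉ conclusiveProfile G ι := by
  rw [ae_iff]
  simpa using stageLaw_zero_conclusiveProfile X q

/-- Bayes' rule for state `1`. -/
theorem smul_stageLaw_one (p : unitInterval) (q : ι → unitInterval) :
    ENNReal.ofReal p • stageLaw X 1 q =
      (mixedStageLaw X p q).withDensity fun o => ENNReal.ofReal (bayesUpdate p o) := by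
  have hm := measurable_likelihoodRatio (G := G)
  have hL : Measurable fun o : ι → G.Obs => ∏ i, likelihoodRatio (o i) :=
    Finset.measurable_prod _ fun i _ => hm.comp (measurable_pi_apply i)
  have hb : Measurable fun o : ι → G.Obs => (bayesUpdate p o : ℝ) :=
    measurable_subtype_coe.comp (measurable_bayesUpdate.comp measurable_prodMk_left)
  have h1 : (stageLaw X 1 q).restrict (conclusiveProfile G ι) =
      ((stageLaw X 1 q).restrict (conclusiveProfile G ι)).withDensity
        fun o => ENNReal.ofReal (bayesUpdate p o) := by
    conv_lhs => rw [← withDensity_one (μ := (stageLaw X 1 q).restrict (conclusiveProfile G ι))]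
    refine withDensity_congr_ae ?_
    filter_upwards [ae_restrict_mem (measurableSet_conclusiveProfile ι)] with o ho
    simp [bayesUpdate_of_mem p ho]
  -- Off conclusive profiles the denominator of the posterior cancels against the density of the
  -- mixed law.
  have h2 : (stageLaw X 0 q).withDensity ((fun o =>
        ENNReal.ofReal (p * (∏ i, likelihoodRatio (o i)) + (1 - p))) *
          fun o => ENNReal.ofReal (bayesUpdate p o)) =
      (stageLaw X 0 q).withDensity
        (ENNReal.ofReal p • fun o => ENNReal.ofReal (∏ i, likelihoodRatio (o i))) := by
    refine withDensity_congr_ae ?_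
    filter_upwards [ae_stageLaw_zero_notMem X q] with o ho
    have h0 : 0 < ∏ i, likelihoodRatio (o i) := Finset.prod_pos fun i _ => likelihoodRatio_pos _
    have hp0 := p.2.1
    have hp1 := sub_nonneg.2 p.2.2
    have hne : 0 < (p : ℝ) * (∏ i, likelihoodRatio (o i)) + (1 - p) := by
      rcases hp0.eq_or_lt with h | h
      · rw [← h]; simp
      · positivity
    rw [Pi.mul_apply, Pi.smul_apply, smul_eq_mul, ← ENNReal.ofReal_mul hne.le,
      ← ENNReal.ofReal_mul hp0, bayesUpdate_of_notMem p ho, mul_div_cancel₀ _ hne.ne']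
  rw [mixedStageLaw_eq, withDensity_add_measure, withDensity_smul_measure, ← h1,
    ← withDensity_mul _ (by fun_prop) (by fun_prop), h2, withDensity_smul _ (by fun_prop),
    ← stageLaw_restrict_eq_withDensity, ← smul_add, add_comm,
    Measure.restrict_add_restrict_compl (measurableSet_conclusiveProfile ι)]

/-- Bayes' rule for state `0`. -/
theorem smul_stageLaw_zero (p : unitInterval) (q : ι → unitInterval) :
    ENNReal.ofReal (1 - p) • stageLaw X 0 q =
      (mixedStageLaw X p q).withDensity fun o => ENNReal.ofReal (1 - bayesUpdate p o) := by
  have hm := measurable_likelihoodRatio (G := G)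
  have hL : Measurable fun o : ι → G.Obs => ∏ i, likelihoodRatio (o i) :=
    Finset.measurable_prod _ fun i _ => hm.comp (measurable_pi_apply i)
  have hb : Measurable fun o : ι → G.Obs => (bayesUpdate p o : ℝ) :=
    measurable_subtype_coe.comp (measurable_bayesUpdate.comp measurable_prodMk_left)
  have h1 : ((stageLaw X 1 q).restrict (conclusiveProfile G ι)).withDensity
        (fun o => ENNReal.ofReal (1 - bayesUpdate p o)) = 0 := by
    refine (withDensity_eq_zero_iff (Measurable.aemeasurable (by fun_prop))).2 ?_
    filter_upwards [ae_restrict_mem (measurableSet_conclusiveProfile ι)] with o ho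
    simp [bayesUpdate_of_mem p ho]
  have h2 : (stageLaw X 0 q).withDensity ((fun o =>
        ENNReal.ofReal (p * (∏ i, likelihoodRatio (o i)) + (1 - p))) *
          fun o => ENNReal.ofReal (1 - bayesUpdate p o)) =
      (stageLaw X 0 q).withDensity fun _ => ENNReal.ofReal (1 - p) := by
    refine withDensity_congr_ae ?_
    filter_upwards [ae_stageLaw_zero_notMem X q] with o ho
    have h0 : 0 < ∏ i, likelihoodRatio (o i) := Finset.prod_pos fun i _ => likelihoodRatio_pos _
    have hp0 := p.2.1
    have hp1 := sub_nonneg.2 p.2.2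
    have hne : 0 < (p : ℝ) * (∏ i, likelihoodRatio (o i)) + (1 - p) := by
      rcases hp0.eq_or_lt with h | h
      · rw [← h]; simp
      · positivity
    rw [Pi.mul_apply, ← ENNReal.ofReal_mul hne.le, bayesUpdate_of_notMem p ho, mul_sub, mul_one,
      mul_div_cancel₀ _ hne.ne', add_sub_cancel_left]
  rw [mixedStageLaw_eq, withDensity_add_measure, withDensity_smul_measure, h1,
    ← withDensity_mul _ (by fun_prop) (by fun_prop), h2, withDensity_const, smul_zero, add_zero]

end Profile

end BanditGame

namespace BanditGame

variable {G : BanditGame} {Ω : Type*} [MeasurableSpace Ω] (X : ArmNoise G Ω)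

/-- Outcome of a period: the observations about all players and the next draw of the public
randomization device. -/
abbrev Outcome (G : BanditGame) : Type := (Fin G.N → G.Obs) × unitInterval

/-- Law of the outcome of a period, conditional on the state `θ`. -/
noncomputable def outcomeLaw (θ : Fin 2) (q : Fin G.N → unitInterval) : Measure G.Outcome :=
  (stageLaw X θ q).prod volume

/-- Law of the outcome of a period at the common belief `p`. -/
noncomputable def mixedOutcomeLaw (p : unitInterval) (q : Fin G.N → unitInterval) :
    Measure G.Outcome :=
  (mixedStageLaw X p q).prod volume

instance (p : unitInterval) (q : Fin G.N → unitInterval) :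
    IsProbabilityMeasure (mixedOutcomeLaw X p q) := by
  unfold mixedOutcomeLaw; infer_instance

theorem integrable_of_abs_le {E : Type*} [MeasurableSpace E] {μ : Measure E} [IsFiniteMeasure μ]
    {f : E → ℝ} (hf : Measurable f) {C : ℝ} (hC : ∀ x, |f x| ≤ C) : Integrable f μ :=
  .of_bound hf.aestronglyMeasurable C (.of_forall hC)

theorem abs_integral_le_of_abs_le {E : Type*} [MeasurableSpace E] {μ : Measure E}
    [IsProbabilityMeasure μ] {f : E → ℝ} {C : ℝ} (hC : ∀ x, |f x| ≤ C) : |∫ x, f x ∂μ| ≤ C := by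
  simpa using norm_integral_le_of_norm_le_const (μ := μ) (f := f) (.of_forall hC)

theorem measurable_bayesUpdate_right (p : unitInterval) {ι : Type} [Fintype ι] :
    Measurable fun o : ι → G.Obs => bayesUpdate p o :=
  measurable_bayesUpdate.comp measurable_prodMk_left

/-- Bayes' rule: averaging state-contingent values with the prior and the conditional laws is the
same as averaging them with the posterior and the mixed law. -/
theorem integral_bayes (p : unitInterval) (q : Fin G.N → unitInterval) {f₁ f₀ : G.Outcome → ℝ}
    (h₁ : Measurable f₁) (h₀ : Measurable f₀) {C : ℝ} (hC₁ : ∀ z, |f₁ z| ≤ C)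
    (hC₀ : ∀ z, |f₀ z| ≤ C) :
    p * ∫ z, f₁ z ∂(outcomeLaw X 1 q) + (1 - p) * ∫ z, f₀ z ∂(outcomeLaw X 0 q) =
      ∫ z, (bayesUpdate p z.1 * f₁ z + (1 - bayesUpdate p z.1) * f₀ z)
        ∂(mixedOutcomeLaw X p q) := by
  have hb : Measurable fun z : G.Outcome => (bayesUpdate p z.1 : ℝ) :=
    measurable_subtype_coe.comp ((measurable_bayesUpdate_right p).comp measurable_fst)
  have hb' : Measurable fun o : Fin G.N → G.Obs => (bayesUpdate p o : ℝ) :=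
    measurable_subtype_coe.comp (measurable_bayesUpdate_right p)
  have e1 : ENNReal.ofReal p • outcomeLaw X 1 q =
      (mixedOutcomeLaw X p q).withDensity fun z => ENNReal.ofReal (bayesUpdate p z.1) := by
    rw [outcomeLaw, ← Measure.prod_smul_left, smul_stageLaw_one, prod_withDensity_left (by fun_prop)]
    rfl
  have e0 : ENNReal.ofReal (1 - p) • outcomeLaw X 0 q =
      (mixedOutcomeLaw X p q).withDensity fun z => ENNReal.ofReal (1 - bayesUpdate p z.1) := by
    rw [outcomeLaw, ← Measure.prod_smul_left, smul_stageLaw_zero,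
      prod_withDensity_left (by fun_prop)]
    rfl
  have i1 := integral_smul_measure (μ := outcomeLaw X 1 q) f₁ (ENNReal.ofReal p)
  have i0 := integral_smul_measure (μ := outcomeLaw X 0 q) f₀ (ENNReal.ofReal (1 - p))
  rw [e1, ENNReal.toReal_ofReal p.2.1, smul_eq_mul,
    integral_withDensity_eq_integral_toReal_smul (by fun_prop)
      (.of_forall fun _ => ENNReal.ofReal_lt_top)] at i1
  rw [e0, ENNReal.toReal_ofReal (sub_nonneg.2 p.2.2), smul_eq_mul,
    integral_withDensity_eq_integral_toReal_smul (by fun_prop)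
      (.of_forall fun _ => ENNReal.ofReal_lt_top)] at i0
  have b0 : ∀ z : G.Outcome, (0 : ℝ) ≤ bayesUpdate p z.1 := fun z => (bayesUpdate p z.1).2.1
  have b1 : ∀ z : G.Outcome, (0 : ℝ) ≤ 1 - bayesUpdate p z.1 :=
    fun z => sub_nonneg.2 (bayesUpdate p z.1).2.2
  rw [← i1, ← i0, ← integral_add]
  · refine integral_congr_ae (.of_forall fun z => ?_)
    simp only [ENNReal.toReal_ofReal (b0 z), ENNReal.toReal_ofReal (b1 z), smul_eq_mul]
  · refine integrable_of_abs_le (C := C) (by fun_prop) fun z => ?_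
    rw [ENNReal.toReal_ofReal (b0 z), smul_eq_mul, abs_mul, abs_of_nonneg (b0 z)]
    exact (mul_le_of_le_one_left (abs_nonneg _) (bayesUpdate p z.1).2.2).trans (hC₁ z)
  · refine integrable_of_abs_le (C := C) (by fun_prop) fun z => ?_
    rw [ENNReal.toReal_ofReal (b1 z), smul_eq_mul, abs_mul, abs_of_nonneg (b1 z)]
    exact (mul_le_of_le_one_left (abs_nonneg _)
      (sub_le_self _ (bayesUpdate p z.1).2.1)).trans (hC₀ z)

/-! ### Mixed actions -/

/-- The product law is affine in each player's mixed action. Hence a mixed deviation is an average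
of the two pure ones and needs no separate incentive condition. -/
theorem stageLaw_update {ι : Type} [Fintype ι] [DecidableEq ι] (θ : Fin 2) (q : ι → unitInterval)
    (n : ι) (a : unitInterval) :
    stageLaw X θ (Function.update q n a) =
      ENNReal.ofReal a • stageLaw X θ (Function.update q n 1) +
        ENNReal.ofReal (1 - a) • stageLaw X θ (Function.update q n 0) := by
  refine Measure.pi_eq fun s hs => ?_
  have h : ∀ b : unitInterval, ∏ i, obsLaw X θ (Function.update q n b i) (s i) =
      obsLaw X θ b (s n) * ∏ i ∈ Finset.univ.erase n, obsLaw X θ (q i) (s i) := by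
    intro b
    rw [← Finset.mul_prod_erase _ _ (Finset.mem_univ n), Function.update_self]
    congr 1
    refine Finset.prod_congr rfl fun i hi => ?_
    rw [Function.update_of_ne (Finset.ne_of_mem_erase hi)]
  rw [Measure.add_apply, Measure.smul_apply, Measure.smul_apply, stageLaw, stageLaw,
    Measure.pi_pi, Measure.pi_pi, h, h, h, obsLaw_eq_mixture X θ a]
  simp only [Measure.add_apply, Measure.smul_apply, smul_eq_mul]
  ring

theorem mixedOutcomeLaw_update (p : unitInterval) (q : Fin G.N → unitInterval) (n : Fin G.N)
    (a : unitInterval) :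
    mixedOutcomeLaw X p (Function.update q n a) =
      ENNReal.ofReal a • mixedOutcomeLaw X p (Function.update q n 1) +
        ENNReal.ofReal (1 - a) • mixedOutcomeLaw X p (Function.update q n 0) := by
  have : mixedStageLaw X p (Function.update q n a) =
      ENNReal.ofReal a • mixedStageLaw X p (Function.update q n 1) +
        ENNReal.ofReal (1 - a) • mixedStageLaw X p (Function.update q n 0) := by
    simp only [mixedStageLaw]
    rw [stageLaw_update X 1 q n a, stageLaw_update X 0 q n a]
    simp only [smul_add, smul_comm (ENNReal.ofReal a) (ENNReal.ofReal p),
      smul_comm (ENNReal.ofReal a) (ENNReal.ofReal (1 - p)),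
      smul_comm (ENNReal.ofReal (1 - a)) (ENNReal.ofReal p),
      smul_comm (ENNReal.ofReal (1 - a)) (ENNReal.ofReal (1 - p))]
    abel
  simp only [mixedOutcomeLaw]
  rw [this, Measure.add_prod, Measure.prod_smul_left, Measure.prod_smul_left]

theorem integral_mixedOutcomeLaw_update (p : unitInterval) (q : Fin G.N → unitInterval)
    (n : Fin G.N) (a : unitInterval) {f : G.Outcome → ℝ} (hf : Measurable f) {C : ℝ}
    (hC : ∀ z, |f z| ≤ C) :
    ∫ z, f z ∂(mixedOutcomeLaw X p (Function.update q n a)) =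
      a * ∫ z, f z ∂(mixedOutcomeLaw X p (Function.update q n 1)) +
        (1 - a) * ∫ z, f z ∂(mixedOutcomeLaw X p (Function.update q n 0)) := by
  rw [mixedOutcomeLaw_update, integral_add_measure, integral_smul_measure, integral_smul_measure,
    ENNReal.toReal_ofReal a.2.1, ENNReal.toReal_ofReal (sub_nonneg.2 a.2.2), smul_eq_mul,
    smul_eq_mul]
  · exact (integrable_of_abs_le hf hC).smul_measure ENNReal.ofReal_ne_top
  · exact (integrable_of_abs_le hf hC).smul_measure ENNReal.ofReal_ne_top

/-! ### Pure actions -/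

theorem ae_isRight_obsLaw (θ : Fin 2) {a : unitInterval} (ha : a = 0 ∨ a = 1) :
    ∀ᵐ o ∂(obsLaw X θ a), (o.isRight ↔ a = 1) := by
  rcases ha with rfl | rfl
  · rw [obsLaw_zero]
    refine (ae_dirac_iff ?_).2 (by simp)
    simp only [zero_ne_one, iff_false, Bool.not_eq_true, Sum.isRight_eq_false]
    exact measurableSet_sum_iff.2 ⟨by simp, by simp⟩
  · rw [obsLaw_one]
    refine (ae_map_iff measurable_inr.aemeasurable ?_).2 (by simp)
    simp only [iff_true]
    exact measurableSet_sum_iff.2 ⟨by simp, by simp⟩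

/-- Pure actions can be read off from the observations. This lets the automaton recognize compliance
and detect deviations. -/
theorem ae_isRight_mixedOutcomeLaw (p : unitInterval) {q : Fin G.N → unitInterval}
    (hq : ∀ i, q i = 0 ∨ q i = 1) :
    ∀ᵐ z ∂(mixedOutcomeLaw X p q), ∀ i, ((z.1 i).isRight ↔ q i = 1) := by
  have h : ∀ θ, ∀ᵐ o ∂(stageLaw X θ q), ∀ i, ((o i).isRight ↔ q i = 1) := fun θ =>
    Filter.eventually_all.2 fun i =>
      (Measure.tendsto_eval_ae_ae (μ := fun i => obsLaw X θ (q i)) (i := i)).eventually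
        (ae_isRight_obsLaw X θ (hq i))
  have h2 : ∀ᵐ o ∂(mixedStageLaw X p q), ∀ i, ((o i).isRight ↔ q i = 1) :=
    ae_add_measure_iff.2 ⟨Measure.ae_smul_measure (h 1) _, Measure.ae_smul_measure (h 0) _⟩
  exact Measure.quasiMeasurePreserving_fst.ae h2

theorem map_pi_comp_of_injective {ι κ E : Type*} [Fintype ι] [Fintype κ] [MeasurableSpace E]
    (μ : Measure E) [IsProbabilityMeasure μ] {e : κ → ι} (he : Function.Injective e) :
    (Measure.pi fun _ : ι => μ).map (fun y k => y (e k)) = Measure.pi fun _ : κ => μ := by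
  have h := (iIndepFun_pi (μ := fun _ : ι => μ) (X := fun _ => id)
    fun _ => aemeasurable_id).precomp he
  have := h.map_fun_eq_pi_map fun k => (measurable_pi_apply (e k)).aemeasurable
  refine this.trans ?_
  congr 1
  funext k
  exact (measurePreserving_eval (fun _ : ι => μ) (e k)).map_eq

theorem stageLaw_of_pure {ι : Type} [Fintype ι] (θ : Fin 2) {q : ι → unitInterval}
    (hq : ∀ i, q i = 0 ∨ q i = 1) [DecidablePred fun i => q i = 1] :
    stageLaw X θ q = (Measure.pi fun _ : ι => X.pathLaw θ).map
      fun y i => if q i = 1 then .inr (y i) else .inl () := by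
  have h : ∀ i, (X.pathLaw θ).map (fun y => if q i = 1 then (.inr y : G.Obs) else .inl ()) =
      obsLaw X θ (q i) := by
    intro i
    rcases hq i with hi | hi
    · simp [hi, obsLaw_zero]
    · simp only [hi, if_true, obsLaw_one]
  have hm : ∀ i, Measurable fun y => if q i = 1 then (.inr y : G.Obs) else .inl () := by
    intro i
    split_ifs
    · exact measurable_inr
    · exact measurable_const
  have : ∀ i, IsProbabilityMeasure
      ((X.pathLaw θ).map fun y => if q i = 1 then (.inr y : G.Obs) else .inl ()) := fun i => by
    rw [h]; infer_instance
  rw [stageLaw, Measure.pi_map_pi fun i => (hm i).aemeasurable]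
  simp_rw [h]

/-- Players on the safe arm have likelihood ratio `1` and no lump sums, so they can be left out of
the update. -/
theorem bayesUpdate_comp {ι κ : Type} [Fintype ι] [Fintype κ] (p : unitInterval) {e : κ → ι}
    (he : Function.Injective e) {o : ι → G.Obs} (ho : ∀ i ∉ Set.range e, o i = .inl ()) :
    bayesUpdate p (fun k => o (e k)) = bayesUpdate p o := by
  classical
  have hprod : ∏ k, likelihoodRatio (o (e k)) = ∏ i, likelihoodRatio (o i) := by
    rw [← Finset.prod_image (s := Finset.univ) (g := e) (f := fun i => likelihoodRatio (o i))
      fun _ _ _ _ h => he h]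
    refine Finset.prod_subset (Finset.subset_univ _) fun i _ hi => ?_
    rw [ho i (by simpa using hi), likelihoodRatio]
  have hex : (∃ k, HasJump (o (e k))) ↔ ∃ i, HasJump (o i) := by
    refine ⟨fun ⟨k, hk⟩ => ⟨e k, hk⟩, fun ⟨i, hi⟩ => ?_⟩
    by_cases h : i ∈ Set.range e
    · obtain ⟨k, rfl⟩ := h
      exact ⟨k, hi⟩
    · rw [ho i h] at hi
      exact hi.elim
  simp only [bayesUpdate, hprod, hex]

/-- The risky arms are identically distributed, so the law of the posterior depends only on how many
are in use. This connects the game with `beliefLaw`. -/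
theorem stageLaw_map_bayesUpdate {ι : Type} [Fintype ι] (θ : Fin 2) (p : unitInterval)
    {q : ι → unitInterval} (hq : ∀ i, q i = 0 ∨ q i = 1) {K : ℕ}
    (hK : Nat.card {i // q i = 1} = K) :
    (stageLaw X θ q).map (bayesUpdate p) = (Measure.pi fun _ : Fin K => X.pathLaw θ).map
      fun y => bayesUpdate p fun i => (.inr (y i) : G.Obs) := by
  classical
  have e' : Fin K ≃ {i // q i = 1} := (Finite.equivFinOfCardEq hK).symm
  have he : Function.Injective fun k => (e' k : ι) := Subtype.val_injective.comp e'.injective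
  have hm : Measurable fun (y : ι → G.SamplePath) i =>
      if q i = 1 then (.inr (y i) : G.Obs) else .inl () := by
    refine measurable_pi_lambda _ fun i => ?_
    split_ifs
    · exact measurable_inr.comp (measurable_pi_apply i)
    · exact measurable_const
  have hm2 : Measurable fun y : Fin K → G.SamplePath =>
      bayesUpdate p fun i => (.inr (y i) : G.Obs) :=
    (measurable_bayesUpdate_right p).comp
      (measurable_pi_lambda _ fun i => measurable_inr.comp (measurable_pi_apply i))
  rw [stageLaw_of_pure X θ hq, ← map_pi_comp_of_injective (X.pathLaw θ) he,
    Measure.map_map (measurable_bayesUpdate_right p) hm,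
    Measure.map_map hm2
      (measurable_pi_lambda _ fun k => measurable_pi_apply (e' k : ι))]
  congr 1
  funext y
  simp only [Function.comp]
  rw [← bayesUpdate_comp p he]
  · congr 1
    funext k
    simp [(e' k).2]
  · intro i hi
    rw [if_neg]
    exact fun h => hi ⟨e'.symm ⟨i, h⟩, by simp⟩

theorem integral_mixedOutcomeLaw_of_pure (p : unitInterval) {q : Fin G.N → unitInterval}
    (hq : ∀ i, q i = 0 ∨ q i = 1) {K : ℕ} (hK : Nat.card {i // q i = 1} = K)
    {w : unitInterval → ℝ} (hw : Measurable w) :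
    ∫ z, w (bayesUpdate p z.1) ∂(mixedOutcomeLaw X p q) = expect X K w p := by
  have hb := measurable_bayesUpdate_right (G := G) (ι := Fin G.N) p
  have hm2 : Measurable fun y : Fin K → G.SamplePath =>
      bayesUpdate p fun i => (.inr (y i) : G.Obs) :=
    (measurable_bayesUpdate_right p).comp
      (measurable_pi_lambda _ fun i => measurable_inr.comp (measurable_pi_apply i))
  have hb2 : Measurable fun z : G.Outcome => bayesUpdate p z.1 := hb.comp measurable_fst
  have h : (mixedOutcomeLaw X p q).map (fun z => bayesUpdate p z.1) = beliefLaw X K p := by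
    change Measure.map (bayesUpdate p ∘ Prod.fst) _ = _
    rw [← Measure.map_map hb measurable_fst, mixedOutcomeLaw, Measure.map_fst_prod, measure_univ,
      one_smul, mixedStageLaw, Measure.map_add _ _ hb, Measure.map_smul, Measure.map_smul,
      stageLaw_map_bayesUpdate X 1 p hq hK, stageLaw_map_bayesUpdate X 0 p hq hK, beliefLaw,
      Measure.map_add _ _ hm2, Measure.map_smul, Measure.map_smul]
  rw [expect, ← h, integral_map hb2.aemeasurable hw.aestronglyMeasurable]

end BanditGame

/-! ### Splitting off the first coordinate of an infinite product -/

/-- The sequence with first term `a.1` and remaining terms `a.2`. -/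
def seqCons {E : Type*} (a : E × (ℕ → E)) : ℕ → E
  | 0 => a.1
  | k + 1 => a.2 k

theorem measurable_seqCons {E : Type*} [MeasurableSpace E] : Measurable (seqCons (E := E)) := by
  refine measurable_pi_lambda _ fun k => ?_
  cases k with
  | zero => exact measurable_fst
  | succ k => exact (measurable_pi_apply k).comp measurable_snd

/-- After the first period the sequence of draws has its original law and is independent of the
first draw. The recursion for payoffs comes from this; the proof compares finite boxes. -/
theorem map_seqCons {E : Type*} [MeasurableSpace E] (ν : Measure E) [IsProbabilityMeasure ν] :
    (ν.prod (Measure.infinitePi fun _ : ℕ => ν)).map seqCons =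
      Measure.infinitePi fun _ : ℕ => ν := by
  classical
  refine Measure.eq_infinitePi (μ := fun _ : ℕ => ν) fun s t ht => ?_
  rw [Measure.map_apply measurable_seqCons
    (MeasurableSet.pi s.countable_toSet fun i _ => ht i)]
  let s' : Finset ℕ := s.preimage Nat.succ (Nat.succ_injective.injOn)
  have hpre : seqCons ⁻¹' (Set.pi s t) =
      (if 0 ∈ s then t 0 else Set.univ) ×ˢ Set.pi (s' : Set ℕ) (fun k => t (k + 1)) := by
    ext ⟨a, d⟩
    simp only [Set.mem_preimage, Set.mem_pi, Set.mem_prod, SetLike.mem_coe]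
    refine ⟨fun h => ⟨?_, fun k hk => h (k + 1) (by simpa [s'] using hk)⟩, fun h k hk => ?_⟩
    · split_ifs with h0
      · exact h 0 h0
      · trivial
    · cases k with
      | zero =>
        have h0 : 0 ∈ s := hk
        have := h.1
        rwa [if_pos h0] at this
      | succ k => exact h.2 k (by simpa [s'] using hk)
  rw [hpre, Measure.prod_prod, Measure.infinitePi_pi _ fun i _ => ht (i + 1)]
  have hs' : ∏ k ∈ s', ν (t (k + 1)) = ∏ k ∈ s.erase 0, ν (t k) := by
    refine Finset.prod_bij (fun k _ => k + 1) (fun k hk => ?_) (fun _ _ _ _ h => by omega)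
      (fun k hk => ?_) fun _ _ => rfl
    · simpa [s'] using hk
    · obtain ⟨h0, hk⟩ := Finset.mem_erase.1 hk
      obtain ⟨j, rfl⟩ := Nat.exists_eq_succ_of_ne_zero h0
      exact ⟨j, by simpa [s'] using hk, rfl⟩
  rw [hs']
  split_ifs with h0
  · rw [Finset.mul_prod_erase s (fun k => ν (t k)) h0]
  · rw [measure_univ, one_mul, Finset.erase_eq_of_notMem h0]

namespace BanditGame

variable {G : BanditGame} {Ω : Type*} [MeasurableSpace Ω] (X : ArmNoise G Ω)

/-! ### Outcome of a period as a function of the random draws -/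

/-- Outcome of a period under the mixed actions `q`, as a function of the random draws. -/
noncomputable def outcomeOf (q : Fin G.N → unitInterval) (d : G.Draws) : G.Outcome :=
  (fun n => observe (q n) (d.1 n) (d.2.1 n), d.2.2)

/-- Law of the random draws of one period, conditional on the state `θ`. -/
noncomputable def periodLaw (θ : Fin 2) : Measure G.Draws :=
  (Measure.pi fun _ : Fin G.N => (volume : Measure unitInterval)).prod
    ((Measure.pi fun _ : Fin G.N => X.pathLaw θ).prod (volume : Measure unitInterval))

instance (θ : Fin 2) : IsProbabilityMeasure (periodLaw X θ) := by
  unfold periodLaw; infer_instance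

instance (θ : Fin 2) : IsProbabilityMeasure (drawsLaw X θ) := by
  change IsProbabilityMeasure (Measure.infinitePi fun _ : ℕ => periodLaw X θ)
  infer_instance

theorem measurable_observe {E : Type*} [MeasurableSpace E] {q v : E → unitInterval}
    {y : E → G.SamplePath} (hq : Measurable q) (hv : Measurable v) (hy : Measurable y) :
    Measurable fun e => observe (q e) (v e) (y e) := by
  classical
  have : (fun e => observe (q e) (v e) (y e)) = fun e =>
      if v e < q e ∨ q e = 1 then (.inr (y e) : G.Obs) else .inl () := by
    funext e; simp only [observe]
  rw [this]
  exact Measurable.ite ((measurableSet_lt hv hq).union (hq (measurableSet_singleton 1)))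
    (measurable_inr.comp hy) measurable_const

theorem measurable_outcomeOf {E : Type*} [MeasurableSpace E] {q : E → Fin G.N → unitInterval}
    {d : E → G.Draws} (hq : Measurable q) (hd : Measurable d) :
    Measurable fun e => outcomeOf (q e) (d e) := by
  refine Measurable.prodMk (measurable_pi_lambda _ fun n => measurable_observe ?_ ?_ ?_) ?_
  · exact (measurable_pi_apply n).comp hq
  · exact (measurable_pi_apply n).comp (measurable_fst.comp hd)
  · exact (measurable_pi_apply n).comp (measurable_fst.comp (measurable_snd.comp hd))
  · exact measurable_snd.comp (measurable_snd.comp hd)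

theorem map_observe (θ : Fin 2) (q : unitInterval) :
    ((volume : Measure unitInterval).prod (X.pathLaw θ)).map (fun e => observe q e.1 e.2) =
      obsLaw X θ q := by
  classical
  ext E hE
  have hm : Measurable fun e : unitInterval × G.SamplePath => (observe q e.1 e.2 : G.Obs) :=
    measurable_observe measurable_const measurable_fst measurable_snd
  rw [Measure.map_apply hm hE]
  -- The clause `q = 1` only adds the null event of drawing the endpoint `1`. It makes the pure
  -- risky action certain instead of almost sure.
  let R : Set unitInterval := {v | v < q ∨ q = 1}
  have hR : MeasurableSet R := (measurableSet_lt measurable_id measurable_const).union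
    (MeasurableSet.const _)
  have hvol : volume R = ENNReal.ofReal q := by
    by_cases h1 : q = 1
    · have : R = Set.univ := by ext; simp [R, h1]
      rw [this, measure_univ, h1]; simp
    · have : R = Set.Iio q := by ext; simp [R, h1]
      rw [this, unitInterval.volume_Iio]
  have hvolc : volume Rᶜ = ENNReal.ofReal (1 - q) := by
    rw [prob_compl_eq_one_sub hR, hvol, ENNReal.ofReal_sub _ q.2.1, ENNReal.ofReal_one]
  have hpre : (fun e : unitInterval × G.SamplePath => (observe q e.1 e.2 : G.Obs)) ⁻¹' E =
      (R ×ˢ (Sum.inr ⁻¹' E)) ∪ (Rᶜ ×ˢ {_y | (.inl () : G.Obs) ∈ E}) := by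
    ext ⟨v, y⟩
    by_cases h : v < q ∨ q = 1
    · have hv : v ∈ R := h
      simp [observe, h, hv]
    · have hv : v ∉ R := h
      simp [observe, h, hv]
  rw [hpre, measure_union _ (hR.compl.prod (MeasurableSet.const _)), Measure.prod_prod,
    Measure.prod_prod, hvol, hvolc, obsLaw, Measure.add_apply, Measure.smul_apply,
    Measure.smul_apply, Measure.map_apply measurable_inr hE, Measure.dirac_apply' _ hE,
    smul_eq_mul, smul_eq_mul]
  · congr 2
    by_cases h : (.inl () : G.Obs) ∈ E <;> simp [h]
  · refine Set.disjoint_left.2 ?_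
    rintro ⟨v, y⟩ h1 h2
    exact h2.1 h1.1

/-- Pairing each player's private draw with that player's sample path turns the draws into a product
over players, which can be pushed forward coordinate by coordinate. -/
theorem map_outcomeOf (θ : Fin 2) (q : Fin G.N → unitInterval) :
    (periodLaw X θ).map (outcomeOf q) = outcomeLaw X θ q := by
  have hobs : ∀ n, Measurable fun e : unitInterval × G.SamplePath =>
      (observe (q n) e.1 e.2 : G.Obs) := fun n =>
    measurable_observe measurable_const measurable_fst measurable_snd
  have hm1 : Measurable fun (e : (Fin G.N → unitInterval) × (Fin G.N → G.SamplePath)) n =>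
      (observe (q n) (e.1 n) (e.2 n) : G.Obs) :=
    measurable_pi_lambda _ fun n => measurable_observe measurable_const
      ((measurable_pi_apply n).comp measurable_fst)
      ((measurable_pi_apply n).comp measurable_snd)
  have h1 : ((Measure.pi fun _ : Fin G.N => (volume : Measure unitInterval)).prod
      (Measure.pi fun _ : Fin G.N => X.pathLaw θ)).map
        (fun e n => (observe (q n) (e.1 n) (e.2 n) : G.Obs)) = stageLaw X θ q := by
    rw [← (measurePreserving_arrowProdEquivProdArrow unitInterval G.SamplePath (Fin G.N)
      (fun _ => volume) fun _ => X.pathLaw θ).map_eq, Measure.map_map hm1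
        (MeasurableEquiv.measurable _)]
    have hpi := Measure.pi_map_pi (ι := Fin G.N)
      (μ := fun _ => (volume : Measure unitInterval).prod (X.pathLaw θ))
      (f := fun n e => (observe (q n) e.1 e.2 : G.Obs))
      (hμ := fun n => by rw [map_observe]; infer_instance) fun n => (hobs n).aemeasurable
    refine Eq.trans ?_ (hpi.trans ?_)
    · rfl
    · simp_rw [map_observe]; rfl
  have h2 := Measure.map_prod_map
    ((Measure.pi fun _ : Fin G.N => (volume : Measure unitInterval)).prod
      (Measure.pi fun _ : Fin G.N => X.pathLaw θ)) (volume : Measure unitInterval) hm1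
    measurable_id
  rw [h1, Measure.map_id] at h2
  rw [outcomeLaw, h2,
    ← (measurePreserving_prodAssoc (Measure.pi fun _ : Fin G.N => (volume : Measure unitInterval))
      (Measure.pi fun _ : Fin G.N => X.pathLaw θ) (volume : Measure unitInterval)).symm.map_eq,
    Measure.map_map (hm1.prodMap measurable_id) (MeasurableEquiv.measurable _)]
  rfl

/-! ### Play from one decision node to the next -/

/-- The decision node that follows `x` after the outcome `z`. -/
def nextNode {t : ℕ} (x : G.Node t) (z : G.Outcome) : G.Node (t + 1) :=
  (Fin.snoc x.1 (x.2, z.1), z.2)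

theorem measurable_nextNode {E : Type*} [MeasurableSpace E] {t : ℕ} {x : E → G.Node t}
    {z : E → G.Outcome} (hx : Measurable x) (hz : Measurable z) :
    Measurable fun e => nextNode (x e) (z e) := by
  refine Measurable.prodMk (measurable_pi_lambda _ fun i => ?_) (measurable_snd.comp hz)
  induction i using Fin.lastCases with
  | last =>
    simp only [Fin.snoc_last]
    exact (measurable_snd.comp hx).prodMk (measurable_fst.comp hz)
  | cast i =>
    simp only [Fin.snoc_castSucc]
    exact (measurable_pi_apply i).comp (measurable_fst.comp hx)

@[simp]
theorem belief_nextNode (p : unitInterval) {t : ℕ} (x : G.Node t) (z : G.Outcome) :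
    belief p (nextNode x z).1 = bayesUpdate (belief p x.1) z.1 := by
  simp only [nextNode, belief, Fin.init_snoc, Fin.snoc_last]

/-- Probabilities of the risky action prescribed by the profile `σ` at the node `x`. -/
def actions (σ : Fin G.N → G.Strategy) {t : ℕ} (x : G.Node t) : Fin G.N → unitInterval :=
  fun n => (σ n).act t x

theorem measurable_actions (σ : Fin G.N → G.Strategy) (t : ℕ) :
    Measurable fun x : G.Node t => actions σ x :=
  measurable_pi_lambda _ fun n => (σ n).measurable_act t

theorem play_succ (σ : Fin G.N → G.Strategy) {t : ℕ} (x : G.Node t) (d : ℕ → G.Draws) (ℓ : ℕ) :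
    play σ x d (ℓ + 1) = nextNode (play σ x d ℓ) (outcomeOf (actions σ (play σ x d ℓ)) (d ℓ)) :=
  rfl

theorem measurable_play (σ : Fin G.N → G.Strategy) (t ℓ : ℕ) :
    Measurable fun e : G.Node t × (ℕ → G.Draws) => play σ e.1 e.2 ℓ := by
  induction ℓ with
  | zero => exact measurable_fst
  | succ ℓ ih =>
    simp_rw [play_succ]
    exact measurable_nextNode ih (measurable_outcomeOf ((measurable_actions σ _).comp ih)
      ((measurable_pi_apply ℓ).comp measurable_snd))

/-- `play` appends periods at the end, whereas the payoff recursion removes the first one. The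
lengths `t + (ℓ + 1)` and `t + 1 + ℓ` are not definitionally equal, hence the sigma type. -/
theorem sigma_play_succ (σ : Fin G.N → G.Strategy) {t : ℕ} (x : G.Node t) (d : ℕ → G.Draws)
    (ℓ : ℕ) :
    (⟨t + (ℓ + 1), play σ x d (ℓ + 1)⟩ : Σ t, G.Node t) =
      ⟨t + 1 + ℓ, play σ (nextNode x (outcomeOf (actions σ x) (d 0))) (fun k => d (k + 1)) ℓ⟩ := by
  induction ℓ with
  | zero => rfl
  | succ ℓ ih =>
    let step : (Σ t, G.Node t) → Σ t, G.Node t := fun z =>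
      ⟨z.1 + 1, nextNode z.2 (outcomeOf (actions σ z.2) (d (ℓ + 1)))⟩
    exact congrArg step ih

theorem act_play_succ (σ : Fin G.N → G.Strategy) (τ : G.Strategy) {t : ℕ} (x : G.Node t)
    (d : ℕ → G.Draws) (ℓ : ℕ) :
    τ.act (t + (ℓ + 1)) (play σ x d (ℓ + 1)) = τ.act (t + 1 + ℓ)
      (play σ (nextNode x (outcomeOf (actions σ x) (d 0))) (fun k => d (k + 1)) ℓ) :=
  congrArg (fun z : Σ t, G.Node t => τ.act z.1 z.2) (sigma_play_succ σ x d ℓ)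

theorem play_congr {σ σ' : Fin G.N → G.Strategy} {t : ℕ}
    (h : ∀ n t', t ≤ t' → (σ n).act t' = (σ' n).act t') (x : G.Node t) (d : ℕ → G.Draws) (ℓ : ℕ) :
    play σ x d ℓ = play σ' x d ℓ := by
  induction ℓ with
  | zero => rfl
  | succ ℓ ih =>
    have : actions σ (play σ' x d ℓ) = actions σ' (play σ' x d ℓ) := by
      funext n
      simp only [actions, h n (t + ℓ) (Nat.le_add_right _ _)]
    rw [play_succ, play_succ, ih, this]

/-! ### Recursive structure of payoffs -/

theorem δ_pos : 0 < G.δ := Real.exp_pos _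

theorem δ_lt_one : G.δ < 1 := by
  rw [δ, Real.exp_lt_one_iff]
  have h1 := G.r_pos
  have h2 : (0 : ℝ) < G.Δ := G.Δ_pos
  nlinarith [mul_pos h1 h2]

/-- Expected flow payoff in state `θ` of the mixed action `a`. -/
def flow (θ : Fin 2) (a : unitInterval) : ℝ := (1 - a) * G.s + a * G.mState θ

/-- A bound for all flow payoffs. -/
def payoffBound (G : BanditGame) : ℝ := max |G.s| (max |G.mState 0| |G.mState 1|)

theorem abs_convex_comb_le {a u v C : ℝ} (h0 : 0 ≤ a) (h1 : a ≤ 1) (hu : |u| ≤ C)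
    (hv : |v| ≤ C) : |(1 - a) * u + a * v| ≤ C := by
  rw [abs_le] at *
  constructor <;> nlinarith

theorem abs_mState_le (θ : Fin 2) : |G.mState θ| ≤ G.payoffBound := by
  fin_cases θ
  · exact (le_max_left _ _).trans (le_max_right _ _)
  · exact (le_max_right _ _).trans (le_max_right _ _)

theorem abs_flow_le (θ : Fin 2) (a : unitInterval) : |G.flow θ a| ≤ G.payoffBound :=
  abs_convex_comb_le a.2.1 a.2.2 (le_max_left _ _) (abs_mState_le θ)

theorem payoffBound_nonneg : 0 ≤ G.payoffBound := (abs_nonneg _).trans (le_max_left _ _)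

theorem measurable_flow (θ : Fin 2) : Measurable (G.flow θ) := by
  have : Measurable fun a : unitInterval => (a : ℝ) := measurable_subtype_coe
  unfold flow
  fun_prop

/-- Realized discounted flow payoffs. -/
noncomputable def discounted (θ : Fin 2) (σ : Fin G.N → G.Strategy) {t : ℕ} (x : G.Node t)
    (n : Fin G.N) (d : ℕ → G.Draws) : ℝ :=
  (1 - G.δ) * ∑' ℓ : ℕ, G.δ ^ ℓ * G.flow θ ((σ n).act (t + ℓ) (play σ x d ℓ))

theorem statePayoff_eq (θ : Fin 2) (σ : Fin G.N → G.Strategy) {t : ℕ} (x : G.Node t)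
    (n : Fin G.N) : statePayoff X θ σ x n = ∫ d, discounted θ σ x n d ∂(drawsLaw X θ) := rfl

theorem summable_flow (θ : Fin 2) (a : ℕ → unitInterval) :
    Summable fun ℓ => G.δ ^ ℓ * G.flow θ (a ℓ) := by
  refine Summable.of_norm_bounded (g := fun ℓ => G.δ ^ ℓ * G.payoffBound)
    ((summable_geometric_of_lt_one δ_pos.le δ_lt_one).mul_right _) fun ℓ => ?_
  rw [norm_mul, Real.norm_of_nonneg (pow_nonneg δ_pos.le _)]
  exact mul_le_mul_of_nonneg_left (abs_flow_le θ _) (pow_nonneg δ_pos.le _)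

theorem abs_discounted_le (θ : Fin 2) (σ : Fin G.N → G.Strategy) {t : ℕ} (x : G.Node t)
    (n : Fin G.N) (d : ℕ → G.Draws) : |discounted θ σ x n d| ≤ G.payoffBound := by
  have h1 : (0 : ℝ) < 1 - G.δ := sub_pos.2 δ_lt_one
  have hg := (hasSum_geometric_of_lt_one (δ_pos (G := G)).le δ_lt_one).mul_right G.payoffBound
  have := tsum_of_norm_bounded hg
    (f := fun ℓ => G.δ ^ ℓ * G.flow θ ((σ n).act (t + ℓ) (play σ x d ℓ))) fun ℓ => by
      rw [norm_mul, Real.norm_of_nonneg (pow_nonneg δ_pos.le _)]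
      exact mul_le_mul_of_nonneg_left (abs_flow_le θ _) (pow_nonneg δ_pos.le _)
  rw [discounted, abs_mul, abs_of_pos h1]
  calc _ ≤ (1 - G.δ) * ((1 - G.δ)⁻¹ * G.payoffBound) := mul_le_mul_of_nonneg_left this h1.le
    _ = G.payoffBound := by field_simp

theorem measurable_discounted (θ : Fin 2) (σ : Fin G.N → G.Strategy) {t : ℕ} (n : Fin G.N)
    {E : Type*} [MeasurableSpace E] {x : E → G.Node t} {d : E → ℕ → G.Draws} (hx : Measurable x)
    (hd : Measurable d) : Measurable fun e => discounted θ σ (x e) n (d e) := by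
  refine Measurable.const_mul ?_ _
  refine measurable_of_tendsto_metrizable
    (f := fun k (e : E) => ∑ ℓ ∈ Finset.range k,
      G.δ ^ ℓ * G.flow θ ((σ n).act (t + ℓ) (play σ (x e) (d e) ℓ))) (fun k => ?_) ?_
  · exact Finset.measurable_sum _ fun ℓ _ => Measurable.const_mul
      ((measurable_flow θ).comp (((σ n).measurable_act _).comp
        ((measurable_play σ t ℓ).comp (hx.prodMk hd)))) _
  · exact tendsto_pi_nhds.2 fun e => (summable_flow θ _).hasSum.tendsto_sum_nat

theorem abs_statePayoff_le (θ : Fin 2) (σ : Fin G.N → G.Strategy) {t : ℕ} (x : G.Node t)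
    (n : Fin G.N) : |statePayoff X θ σ x n| ≤ G.payoffBound := by
  rw [statePayoff_eq]
  exact abs_integral_le_of_abs_le fun d => abs_discounted_le θ σ x n d

theorem measurable_statePayoff (θ : Fin 2) (σ : Fin G.N → G.Strategy) (t : ℕ) (n : Fin G.N) :
    Measurable fun x : G.Node t => statePayoff X θ σ x n := by
  simp_rw [statePayoff_eq]
  exact (measurable_discounted θ σ n measurable_fst
    measurable_snd).stronglyMeasurable.integral_prod_right'.measurable

theorem discounted_seqCons (θ : Fin 2) (σ : Fin G.N → G.Strategy) {t : ℕ} (x : G.Node t)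
    (n : Fin G.N) (e : G.Draws × (ℕ → G.Draws)) :
    discounted θ σ x n (seqCons e) = (1 - G.δ) * G.flow θ (actions σ x n) +
      G.δ * discounted θ σ (nextNode x (outcomeOf (actions σ x) e.1)) n e.2 := by
  rw [discounted, (summable_flow θ _).tsum_eq_zero_add, discounted]
  simp_rw [act_play_succ, pow_succ']
  simp_rw [mul_assoc, tsum_mul_left]
  have : ∀ ℓ, play σ (nextNode x (outcomeOf (actions σ x) (seqCons e 0)))
      (fun k => seqCons e (k + 1)) ℓ =
        play σ (nextNode x (outcomeOf (actions σ x) e.1)) e.2 ℓ := fun ℓ => rfl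
  simp_rw [this]
  simp only [pow_zero, one_mul, mul_add]
  congr 1
  ring

/-- Conditional on the state, the draws after the first period are independent of it, so Fubini's
theorem separates the current flow from the continuation. -/
theorem statePayoff_recursion (θ : Fin 2) (σ : Fin G.N → G.Strategy) {t : ℕ} (x : G.Node t)
    (n : Fin G.N) :
    statePayoff X θ σ x n = (1 - G.δ) * G.flow θ (actions σ x n) +
      G.δ * ∫ z, statePayoff X θ σ (nextNode x z) n ∂(outcomeLaw X θ (actions σ x)) := by
  have hd : Measurable fun d => discounted θ σ x n d :=
    measurable_discounted θ σ n measurable_const measurable_id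
  have hn : Measurable fun z : G.Outcome => nextNode x z :=
    measurable_nextNode measurable_const measurable_id
  have ho : Measurable fun d : G.Draws => outcomeOf (actions σ x) d :=
    measurable_outcomeOf measurable_const measurable_id
  have hf : Measurable fun e : G.Draws × (ℕ → G.Draws) =>
      discounted θ σ (nextNode x (outcomeOf (actions σ x) e.1)) n e.2 :=
    measurable_discounted θ σ n (hn.comp (ho.comp measurable_fst)) measurable_snd
  have hi : Integrable (fun e : G.Draws × (ℕ → G.Draws) =>
      discounted θ σ (nextNode x (outcomeOf (actions σ x) e.1)) n e.2)
        ((periodLaw X θ).prod (drawsLaw X θ)) :=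
    integrable_of_abs_le hf fun e => abs_discounted_le θ σ _ n e.2
  have hsplit : drawsLaw X θ = ((periodLaw X θ).prod (drawsLaw X θ)).map seqCons :=
    (map_seqCons (periodLaw X θ)).symm
  have e1 : statePayoff X θ σ x n =
      ∫ e, discounted θ σ x n (seqCons e) ∂((periodLaw X θ).prod (drawsLaw X θ)) := by
    rw [← integral_map measurable_seqCons.aemeasurable hd.aestronglyMeasurable, ← hsplit]
    rfl
  have e2 : ∫ z, statePayoff X θ σ (nextNode x z) n ∂(outcomeLaw X θ (actions σ x)) =
      ∫ d, statePayoff X θ σ (nextNode x (outcomeOf (actions σ x) d)) n ∂(periodLaw X θ) := by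
    rw [← map_outcomeOf]
    exact integral_map ho.aemeasurable
      ((measurable_statePayoff X θ σ (t + 1) n).comp hn).aestronglyMeasurable
  have e3 := integral_prod _ hi
  rw [e1, e2, integral_congr_ae (.of_forall (discounted_seqCons θ σ x n)),
    integral_add (integrable_const _) (hi.const_mul _), integral_const_mul, integral_const_mul, e3,
    integral_const, probReal_univ, one_smul]
  rfl

theorem abs_payoffAt_le (p : unitInterval) (σ : Fin G.N → G.Strategy) {t : ℕ} (x : G.Node t)
    (n : Fin G.N) : |payoffAt X p σ x n| ≤ G.payoffBound := by
  rw [payoffAt, add_comm]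
  exact abs_convex_comb_le (belief p x.1).2.1 (belief p x.1).2.2 (abs_statePayoff_le X 0 σ x n)
    (abs_statePayoff_le X 1 σ x n)

theorem measurable_belief (p : unitInterval) (t : ℕ) :
    Measurable fun g : G.Hist t => belief p g := by
  induction t with
  | zero => exact measurable_const
  | succ t ih =>
    refine measurable_bayesUpdate.comp (Measurable.prodMk (ih.comp ?_) ?_)
    · exact measurable_pi_lambda _ fun i => measurable_pi_apply _
    · exact measurable_snd.comp (measurable_pi_apply (Fin.last t))

theorem measurable_payoffAt (p : unitInterval) (σ : Fin G.N → G.Strategy) (t : ℕ) (n : Fin G.N) :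
    Measurable fun x : G.Node t => payoffAt X p σ x n := by
  have hb : Measurable fun x : G.Node t => (belief p x.1 : ℝ) :=
    measurable_subtype_coe.comp ((measurable_belief p t).comp measurable_fst)
  have h1 := measurable_statePayoff X 1 σ t n
  have h0 := measurable_statePayoff X 0 σ t n
  unfold payoffAt
  fun_prop

/-- Expected flow payoff of the mixed action `a` at the belief `p`. -/
def beliefFlow (p a : unitInterval) : ℝ := (1 - a) * G.s + a * G.m p

/-- The belief becomes the state variable. `integral_bayes` turns the two state-contingent
continuation payoffs, weighted by the prior, into a single payoff evaluated at the posterior. -/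
theorem payoffAt_recursion (p : unitInterval) (σ : Fin G.N → G.Strategy) {t : ℕ} (x : G.Node t)
    (n : Fin G.N) :
    payoffAt X p σ x n = (1 - G.δ) * G.beliefFlow (belief p x.1) (actions σ x n) +
      G.δ * ∫ z, payoffAt X p σ (nextNode x z) n
        ∂(mixedOutcomeLaw X (belief p x.1) (actions σ x)) := by
  have hn : Measurable fun z : G.Outcome => nextNode x z :=
    measurable_nextNode measurable_const measurable_id
  have h := integral_bayes X (belief p x.1) (actions σ x)
    ((measurable_statePayoff X 1 σ (t + 1) n).comp hn)
    ((measurable_statePayoff X 0 σ (t + 1) n).comp hn)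
    (fun z => abs_statePayoff_le X 1 σ _ n) (fun z => abs_statePayoff_le X 0 σ _ n)
  simp only [Function.comp] at h
  simp only [payoffAt, belief_nextNode]
  rw [← h, statePayoff_recursion, statePayoff_recursion X 0]
  simp only [beliefFlow, flow, m]
  ring

theorem payoffAt_congr (p : unitInterval) {σ σ' : Fin G.N → G.Strategy} {t : ℕ}
    (h : ∀ n t', t ≤ t' → (σ n).act t' = (σ' n).act t') (x : G.Node t) (n : Fin G.N) :
    payoffAt X p σ x n = payoffAt X p σ' x n := by
  have hs : ∀ θ, statePayoff X θ σ x n = statePayoff X θ σ' x n := by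
    intro θ
    simp only [statePayoff, play_congr h, h n _ (Nat.le_add_right t _)]
  rw [payoffAt, payoffAt, hs, hs]

end BanditGame

/-! ### Extrema over sets of binary actions -/

open Classical in
/-- The maximum of `f` over a nonempty set `S ⊆ {0, 1}`. -/
noncomputable def binaryMax (S : Set ℕ) (f : ℕ → ℝ) : ℝ :=
  if 0 ∈ S then if 1 ∈ S then max (f 0) (f 1) else f 0 else f 1

theorem isGreatest_binaryMax {S : Set ℕ} (hS : S ⊆ {0, 1}) (hne : S.Nonempty) (f : ℕ → ℝ) :
    IsGreatest (f '' S) (binaryMax S f) := by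
  have h1 : 0 ∉ S → 1 ∈ S := by
    intro h0
    obtain ⟨k, hk⟩ := hne
    rcases hS hk with rfl | rfl
    · exact (h0 hk).elim
    · exact hk
  constructor
  · unfold binaryMax
    split_ifs with h h'
    · rcases max_choice (f 0) (f 1) with e | e <;> rw [e]
      · exact ⟨0, h, rfl⟩
      · exact ⟨1, h', rfl⟩
    · exact ⟨0, h, rfl⟩
    · exact ⟨1, h1 h, rfl⟩
  · rintro _ ⟨k, hk, rfl⟩
    unfold binaryMax
    rcases hS hk with rfl | rfl <;> split_ifs <;> simp_all

/-- The minimum of `f` over a nonempty set `S ⊆ {0, 1}`. -/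
noncomputable def binaryMin (S : Set ℕ) (f : ℕ → ℝ) : ℝ := -binaryMax S fun k => -f k

theorem isLeast_binaryMin {S : Set ℕ} (hS : S ⊆ {0, 1}) (hne : S.Nonempty) (f : ℕ → ℝ) :
    IsLeast (f '' S) (binaryMin S f) := by
  obtain ⟨⟨k, hk, hkf⟩, hub⟩ := isGreatest_binaryMax hS hne fun k => -f k
  refine ⟨⟨k, hk, ?_⟩, ?_⟩
  · rw [binaryMin, ← hkf, neg_neg]
  · rintro _ ⟨j, hj, rfl⟩
    have := hub ⟨j, hj, rfl⟩
    rw [binaryMin]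
    dsimp only at this
    linarith

/-- The definition by cases on membership of `0` and `1` reduces measurability to that of two sets
and two functions. -/
theorem measurable_binaryMax {E : Type*} [MeasurableSpace E] {S : E → Set ℕ} {f : E → ℕ → ℝ}
    (hS : ∀ k, MeasurableSet {e | k ∈ S e}) (hf : ∀ k ∈ ({0, 1} : Set ℕ), Measurable fun e => f e k) :
    Measurable fun e => binaryMax (S e) (f e) := by
  have h0 := hf 0 (by simp)
  have h1 := hf 1 (by simp)
  exact Measurable.ite (hS 0) (Measurable.ite (hS 1) (h0.max h1) h0) h1

theorem measurable_binaryMin {E : Type*} [MeasurableSpace E] {S : E → Set ℕ} {f : E → ℕ → ℝ}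
    (hS : ∀ k, MeasurableSet {e | k ∈ S e}) (hf : ∀ k ∈ ({0, 1} : Set ℕ), Measurable fun e => f e k) :
    Measurable fun e => binaryMin (S e) (f e) :=
  (measurable_binaryMax hS fun k hk => (hf k hk).neg).neg

theorem tendsto_binaryMax (S : Set ℕ) {f : ℕ → ℕ → ℝ} {g : ℕ → ℝ}
    (h : ∀ k ∈ ({0, 1} : Set ℕ), Filter.Tendsto (fun n => f n k) .atTop (nhds (g k))) :
    Filter.Tendsto (fun n => binaryMax S (f n)) .atTop (nhds (binaryMax S g)) := by
  have h0 := h 0 (by simp)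
  have h1 := h 1 (by simp)
  unfold binaryMax
  split_ifs
  exacts [h0.max h1, h0, h1]

theorem tendsto_binaryMin (S : Set ℕ) {f : ℕ → ℕ → ℝ} {g : ℕ → ℝ}
    (h : ∀ k ∈ ({0, 1} : Set ℕ), Filter.Tendsto (fun n => f n k) .atTop (nhds (g k))) :
    Filter.Tendsto (fun n => binaryMin S (f n)) .atTop (nhds (binaryMin S g)) :=
  (tendsto_binaryMax S fun k hk => (h k hk).neg).neg

theorem abs_binaryMax_le (S : Set ℕ) {f : ℕ → ℝ} {C : ℝ}
    (h : ∀ k ∈ ({0, 1} : Set ℕ), |f k| ≤ C) : |binaryMax S f| ≤ C := by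
  have h0 := h 0 (by simp)
  have h1 := h 1 (by simp)
  unfold binaryMax
  split_ifs
  · exact abs_max_le_max_abs_abs.trans (max_le h0 h1)
  · exact h0
  · exact h1

theorem abs_binaryMin_le (S : Set ℕ) {f : ℕ → ℝ} {C : ℝ}
    (h : ∀ k ∈ ({0, 1} : Set ℕ), |f k| ≤ C) : |binaryMin S f| ≤ C := by
  rw [binaryMin, abs_neg]
  exact abs_binaryMax_le S fun k hk => by rw [abs_neg]; exact h k hk

/-- A decreasing sequence of subsets of `{0, 1}` is eventually constant. -/
theorem eventually_eq_iInter_of_antitone {S : ℕ → Set ℕ} (hS : ∀ n, S n ⊆ {0, 1})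
    (ha : Antitone S) : ∀ᶠ n in .atTop, S n = ⋂ j, S j := by
  have h : ∀ k : ℕ, ∀ᶠ n in Filter.atTop, (k ∈ S n → ∀ j, k ∈ S j) := by
    intro k
    by_cases hk : ∀ j, k ∈ S j
    · exact .of_forall fun _ _ => hk
    · obtain ⟨j, hj⟩ := not_forall.1 hk
      filter_upwards [Filter.eventually_ge_atTop j] with n hn hkn
      exact (hj (ha hn hkn)).elim
  filter_upwards [h 0, h 1] with n h0 h1
  refine Set.Subset.antisymm (fun k hk => Set.mem_iInter.2 ?_) (Set.iInter_subset _ n)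
  rcases hS n hk with rfl | rfl
  exacts [h0 hk, h1 hk]

namespace BanditGame

variable {G : BanditGame} {Ω : Type*} [MeasurableSpace Ω] (X : ArmNoise G Ω)

/-! ### Expected continuation values -/

theorem measurable_bayesUpdate_inr (K : ℕ) (p : unitInterval) :
    Measurable fun y : Fin K → G.SamplePath => bayesUpdate p fun i => (.inr (y i) : G.Obs) :=
  (measurable_bayesUpdate_right p).comp
    (measurable_pi_lambda _ fun i => measurable_inr.comp (measurable_pi_apply i))

instance (K : ℕ) (p : unitInterval) : IsProbabilityMeasure (beliefLaw X K p) := by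
  have := isProbabilityMeasure_mixture (Measure.pi fun _ : Fin K => X.pathLaw 1)
    (Measure.pi fun _ : Fin K => X.pathLaw 0) p
  exact Measure.isProbabilityMeasure_map (measurable_bayesUpdate_inr K p).aemeasurable

theorem measurable_expect (K : ℕ) {w : unitInterval → ℝ} (hw : Measurable w) {C : ℝ}
    (hC : ∀ p, |w p| ≤ C) : Measurable (expect X K w) := by
  have hf : Measurable fun e : unitInterval × (Fin K → G.SamplePath) =>
      w (bayesUpdate e.1 fun i => (.inr (e.2 i) : G.Obs)) :=
    hw.comp (measurable_bayesUpdate.comp (measurable_fst.prodMk (measurable_pi_lambda _ fun i =>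
      measurable_inr.comp ((measurable_pi_apply i).comp measurable_snd))))
  have h : ∀ θ, Measurable fun p : unitInterval =>
      ∫ y, w (bayesUpdate p fun i => (.inr (y i) : G.Obs))
        ∂(Measure.pi fun _ : Fin K => X.pathLaw θ) := fun θ =>
    hf.stronglyMeasurable.integral_prod_right'.measurable
  -- Written this way, the measures no longer depend on `p`, and measurability of integrals with a
  -- parameter applies.
  have e : expect X K w = fun p : unitInterval =>
      p * ∫ y, w (bayesUpdate p fun i => (.inr (y i) : G.Obs))
          ∂(Measure.pi fun _ : Fin K => X.pathLaw 1) +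
        (1 - p) * ∫ y, w (bayesUpdate p fun i => (.inr (y i) : G.Obs))
          ∂(Measure.pi fun _ : Fin K => X.pathLaw 0) := by
    funext p
    have hy : Measurable fun y : Fin K → G.SamplePath =>
        w (bayesUpdate p fun i => (.inr (y i) : G.Obs)) := hw.comp (measurable_bayesUpdate_inr K p)
    rw [expect, beliefLaw, integral_map (measurable_bayesUpdate_inr K p).aemeasurable
      hw.aestronglyMeasurable, integral_add_measure, integral_smul_measure, integral_smul_measure,
      ENNReal.toReal_ofReal p.2.1, ENNReal.toReal_ofReal (sub_nonneg.2 p.2.2)]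
    · rfl
    · exact (integrable_of_abs_le hy fun _ => hC _).smul_measure ENNReal.ofReal_ne_top
    · exact (integrable_of_abs_le hy fun _ => hC _).smul_measure ENNReal.ofReal_ne_top
  have hp : Measurable fun p : unitInterval => (p : ℝ) := measurable_subtype_coe
  have h1 := h 1
  have h0 := h 0
  rw [e]
  fun_prop

/-- Measurable functions of the belief that are bounded by `C`. -/
structure IsValue (C : ℝ) (w : unitInterval → ℝ) : Prop where
  measurable : Measurable w
  abs_le : ∀ p, |w p| ≤ C

variable {X}

theorem expect_mono (K : ℕ) (p : unitInterval) {w w' : unitInterval → ℝ} {C C' : ℝ}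
    (hw : IsValue C w) (hw' : IsValue C' w') (h : ∀ q, w q ≤ w' q) :
    expect X K w p ≤ expect X K w' p :=
  integral_mono (integrable_of_abs_le hw.measurable hw.abs_le)
    (integrable_of_abs_le hw'.measurable hw'.abs_le) h

theorem oneStep_mono (k K : ℕ) (p : unitInterval) {w w' : unitInterval → ℝ} {C C' : ℝ}
    (hw : IsValue C w) (hw' : IsValue C' w') (h : ∀ q, w q ≤ w' q) :
    oneStep X k K w p ≤ oneStep X k K w' p :=
  add_le_add_right (mul_le_mul_of_nonneg_left (expect_mono K p hw hw' h) δ_pos.le) _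

theorem bestReply_mono (κ : ℕ) (p : unitInterval) {w w' : unitInterval → ℝ} {C C' : ℝ}
    (hw : IsValue C w) (hw' : IsValue C' w') (h : ∀ q, w q ≤ w' q) :
    bestReply X κ w p ≤ bestReply X κ w' p :=
  max_le_max (oneStep_mono _ _ p hw hw' h) (oneStep_mono _ _ p hw hw' h)

/-- Larger rewards for compliance and harsher punishments can enforce more actions. -/
theorem enforceable_mono (p : unitInterval) {wbar wlow wbar' wlow' : unitInterval → ℝ} {C C' : ℝ}
    (hb : IsValue C wbar) (hb' : IsValue C' wbar') (hl : IsValue C wlow) (hl' : IsValue C' wlow')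
    (hbar : ∀ q, wbar q ≤ wbar' q) (hlow : ∀ q, wlow' q ≤ wlow q) :
    enforceable X wbar wlow p ⊆ enforceable X wbar' wlow' p := fun κ hκ =>
  ⟨hκ.1, (bestReply_mono κ p hl' hl hlow).trans (hκ.2.trans (oneStep_mono _ _ p hb hb' hbar))⟩

theorem enforceable_subset (wbar wlow : unitInterval → ℝ) (p : unitInterval) :
    enforceable X wbar wlow p ⊆ {0, 1} := fun _ h => h.1

theorem abs_m_le (p : unitInterval) : |G.m p| ≤ G.payoffBound := by
  rw [m, add_comm]
  exact abs_convex_comb_le p.2.1 p.2.2 (abs_mState_le 0) (abs_mState_le 1)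

theorem abs_oneStep_le {k : ℕ} (hk : k ∈ ({0, 1} : Set ℕ)) (K : ℕ) (p : unitInterval)
    {w : unitInterval → ℝ} {C : ℝ} (hC : G.payoffBound ≤ C) (hw : IsValue C w) :
    |oneStep X k K w p| ≤ C := by
  have h : |(1 - (k : ℝ)) * G.s + k * G.m p| ≤ C := by
    refine (abs_convex_comb_le ?_ ?_ (le_max_left _ _) (abs_m_le p)).trans hC
    · exact Nat.cast_nonneg k
    · rcases hk with rfl | rfl <;> simp
  exact abs_convex_comb_le δ_pos.le δ_lt_one.le h (abs_integral_le_of_abs_le hw.abs_le)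

theorem abs_bestReply_le (κ : ℕ) (p : unitInterval) {w : unitInterval → ℝ} {C : ℝ}
    (hC : G.payoffBound ≤ C) (hw : IsValue C w) : |bestReply X κ w p| ≤ C :=
  abs_max_le_max_abs_abs.trans
    (max_le (abs_oneStep_le (by simp) _ p hC hw) (abs_oneStep_le (by simp) _ p hC hw))

theorem measurable_oneStep (k K : ℕ) {w : unitInterval → ℝ} {C : ℝ} (hw : IsValue C w) :
    Measurable (oneStep X k K w) := by
  have h1 := measurable_expect X K hw.measurable hw.abs_le
  have hp : Measurable fun p : unitInterval => (p : ℝ) := measurable_subtype_coe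
  unfold oneStep m
  fun_prop

theorem measurable_bestReply (κ : ℕ) {w : unitInterval → ℝ} {C : ℝ} (hw : IsValue C w) :
    Measurable (bestReply X κ w) :=
  (measurable_oneStep _ _ hw).max (measurable_oneStep _ _ hw)

theorem measurableSet_enforceable (κ : ℕ) {wbar wlow : unitInterval → ℝ} {C C' : ℝ}
    (hb : IsValue C wbar) (hl : IsValue C' wlow) :
    MeasurableSet {p | κ ∈ enforceable X wbar wlow p} :=
  (MeasurableSet.const _).inter
    (measurableSet_le (measurable_bestReply κ hl) (measurable_oneStep κ _ hb))

theorem tendsto_oneStep (k K : ℕ) (p : unitInterval) {w : ℕ → unitInterval → ℝ}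
    {v : unitInterval → ℝ} {C : ℝ} (hw : ∀ n, IsValue C (w n))
    (h : ∀ q, Filter.Tendsto (fun n => w n q) .atTop (nhds (v q))) :
    Filter.Tendsto (fun n => oneStep X k K (w n) p) .atTop (nhds (oneStep X k K v p)) := by
  have : Filter.Tendsto (fun n => expect X K (w n) p) .atTop (nhds (expect X K v p)) :=
    tendsto_integral_of_dominated_convergence (fun _ => C)
      (fun n => (hw n).measurable.aestronglyMeasurable) (integrable_const C)
      (fun n => .of_forall (hw n).abs_le) (.of_forall h)
  exact (this.const_mul _).const_add _

theorem tendsto_bestReply (κ : ℕ) (p : unitInterval) {w : ℕ → unitInterval → ℝ}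
    {v : unitInterval → ℝ} {C : ℝ} (hw : ∀ n, IsValue C (w n))
    (h : ∀ q, Filter.Tendsto (fun n => w n q) .atTop (nhds (v q))) :
    Filter.Tendsto (fun n => bestReply X κ (w n) p) .atTop (nhds (bestReply X κ v p)) :=
  (tendsto_oneStep _ _ p hw h).max (tendsto_oneStep _ _ p hw h)

/-! ### Iterating the functional equations -/

variable (X)

/-- Right-hand sides of the functional equations. -/
noncomputable def bellman (w : (unitInterval → ℝ) × (unitInterval → ℝ)) :
    (unitInterval → ℝ) × (unitInterval → ℝ) :=
  (fun p => binaryMax (enforceable X w.1 w.2 p) fun κ => oneStep X κ (G.N * κ) w.1 p,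
    fun p => binaryMin (enforceable X w.1 w.2 p) fun κ => bestReply X κ w.2 p)

/-- Successive approximations of the extremal solution, from trivial bounds. -/
noncomputable def approx : ℕ → (unitInterval → ℝ) × (unitInterval → ℝ)
  | 0 => (fun _ => G.payoffBound, fun _ => -G.payoffBound)
  | n + 1 => bellman X (approx n)

variable {X}

theorem isValue_bellman {w : (unitInterval → ℝ) × (unitInterval → ℝ)} {C : ℝ}
    (hC : G.payoffBound ≤ C) (h : IsValue C w.1 ∧ IsValue C w.2) :
    IsValue C (bellman X w).1 ∧ IsValue C (bellman X w).2 :=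
  ⟨⟨measurable_binaryMax (fun κ => measurableSet_enforceable κ h.1 h.2)
      fun κ _ => measurable_oneStep κ _ h.1,
    fun p => abs_binaryMax_le _ fun _ hκ => abs_oneStep_le hκ _ p hC h.1⟩,
  ⟨measurable_binaryMin (fun κ => measurableSet_enforceable κ h.1 h.2)
      fun κ _ => measurable_bestReply κ h.2,
    fun p => abs_binaryMin_le _ fun κ _ => abs_bestReply_le κ p hC h.2⟩⟩

theorem isValue_approx (n : ℕ) :
    IsValue G.payoffBound (approx X n).1 ∧ IsValue G.payoffBound (approx X n).2 := by
  induction n with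
  | zero =>
    exact ⟨⟨measurable_const, fun _ => (abs_of_nonneg payoffBound_nonneg).le⟩,
      ⟨measurable_const, fun _ => by
        change |-G.payoffBound| ≤ _
        rw [abs_neg, abs_of_nonneg payoffBound_nonneg]⟩⟩
  | succ n ih => exact isValue_bellman le_rfl ih

/-- Tighter bounds shrink the enforceable set, so the new upper bound maximizes a smaller function
over a smaller set; the lower bound behaves dually. Nonemptiness matters because `binaryMax` and
`binaryMin` over the empty set return a default value. -/
theorem approx_succ_le (hne : ∀ n p, (enforceable X (approx X n).1 (approx X n).2 p).Nonempty)
    (n : ℕ) : (∀ p, (approx X (n + 1)).1 p ≤ (approx X n).1 p) ∧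
      ∀ p, (approx X n).2 p ≤ (approx X (n + 1)).2 p := by
  induction n with
  | zero =>
    have h := isValue_approx (X := X) 1
    exact ⟨fun p => (abs_le.1 (h.1.abs_le p)).2, fun p => (abs_le.1 (h.2.abs_le p)).1⟩
  | succ n ih =>
    have h0 := isValue_approx (X := X) n
    have h1 := isValue_approx (X := X) (n + 1)
    have hsub : ∀ p, enforceable X (approx X (n + 1)).1 (approx X (n + 1)).2 p ⊆
        enforceable X (approx X n).1 (approx X n).2 p := fun p =>
      enforceable_mono p h1.1 h0.1 h1.2 h0.2 ih.1 ih.2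
    constructor
    · intro p
      obtain ⟨κ, hκ, e⟩ := (isGreatest_binaryMax (enforceable_subset _ _ p) (hne (n + 1) p)
        fun κ => oneStep X κ (G.N * κ) (approx X (n + 1)).1 p).1
      refine e.symm.le.trans ((oneStep_mono _ _ p h1.1 h0.1 ih.1).trans ?_)
      exact (isGreatest_binaryMax (enforceable_subset _ _ p) (hne n p)
        fun κ => oneStep X κ (G.N * κ) (approx X n).1 p).2 ⟨κ, hsub p hκ, rfl⟩
    · intro p
      obtain ⟨κ, hκ, e⟩ := (isLeast_binaryMin (enforceable_subset _ _ p) (hne (n + 1) p)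
        fun κ => bestReply X κ (approx X (n + 1)).2 p).1
      refine le_trans ?_ ((bestReply_mono κ p h0.2 h1.2 ih.2).trans e.le)
      exact (isLeast_binaryMin (enforceable_subset _ _ p) (hne n p)
        fun κ => bestReply X κ (approx X n).2 p).2 ⟨κ, hsub p hκ, rfl⟩

/-- If the approximations are well defined, they converge to a solution. -/
theorem exists_isSolution (hne : ∀ n p, (enforceable X (approx X n).1 (approx X n).2 p).Nonempty) :
    ∃ wbar wlow, IsSolution X wbar wlow ∧ ∀ p v,
      ((∀ n, v ≤ (approx X n).1 p) → v ≤ wbar p) ∧ ((∀ n, (approx X n).2 p ≤ v) → wlow p ≤ v) := by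
  have hval := isValue_approx (X := X)
  have hstep := approx_succ_le hne
  have hanti : ∀ p, Antitone fun n => (approx X n).1 p := fun p =>
    antitone_nat_of_succ_le fun n => (hstep n).1 p
  have hmono : ∀ p, Monotone fun n => (approx X n).2 p := fun p =>
    monotone_nat_of_le_succ fun n => (hstep n).2 p
  have hbb : ∀ p, BddBelow (Set.range fun n => (approx X n).1 p) := fun p =>
    ⟨-G.payoffBound, by rintro _ ⟨n, rfl⟩; exact (abs_le.1 ((hval n).1.abs_le p)).1⟩
  have hba : ∀ p, BddAbove (Set.range fun n => (approx X n).2 p) := fun p =>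
    ⟨G.payoffBound, by rintro _ ⟨n, rfl⟩; exact (abs_le.1 ((hval n).2.abs_le p)).2⟩
  let wbar : unitInterval → ℝ := fun p => ⨅ n, (approx X n).1 p
  let wlow : unitInterval → ℝ := fun p => ⨆ n, (approx X n).2 p
  have tbar : ∀ p, Filter.Tendsto (fun n => (approx X n).1 p) .atTop (nhds (wbar p)) := fun p =>
    tendsto_atTop_ciInf (hanti p) (hbb p)
  have tlow : ∀ p, Filter.Tendsto (fun n => (approx X n).2 p) .atTop (nhds (wlow p)) := fun p =>
    tendsto_atTop_ciSup (hmono p) (hba p)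
  have vbar : IsValue G.payoffBound wbar :=
    ⟨measurable_of_tendsto_metrizable (fun n => (hval n).1.measurable) (tendsto_pi_nhds.2 tbar),
      fun p => le_of_tendsto (tbar p).abs (.of_forall fun n => (hval n).1.abs_le p)⟩
  have vlow : IsValue G.payoffBound wlow :=
    ⟨measurable_of_tendsto_metrizable (fun n => (hval n).2.measurable) (tendsto_pi_nhds.2 tlow),
      fun p => le_of_tendsto (tlow p).abs (.of_forall fun n => (hval n).2.abs_le p)⟩
  have lebar : ∀ n p, wbar p ≤ (approx X n).1 p := fun n p => ciInf_le (hbb p) n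
  have lelow : ∀ n p, (approx X n).2 p ≤ wlow p := fun n p => le_ciSup (hba p) n
  have tone : ∀ k K p, Filter.Tendsto (fun n => oneStep X k K (approx X n).1 p) .atTop
      (nhds (oneStep X k K wbar p)) := fun k K p =>
    tendsto_oneStep k K p (fun n => (hval n).1) tbar
  have tbest : ∀ κ p, Filter.Tendsto (fun n => bestReply X κ (approx X n).2 p) .atTop
      (nhds (bestReply X κ wlow p)) := fun κ p =>
    tendsto_bestReply κ p (fun n => (hval n).2) tlow
  have hSanti : ∀ p, Antitone fun n => enforceable X (approx X n).1 (approx X n).2 p := fun p =>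
    antitone_nat_of_succ_le fun n => enforceable_mono p (hval (n + 1)).1 (hval n).1
      (hval (n + 1)).2 (hval n).2 (hstep n).1 (hstep n).2
  -- The incentive constraint is a weak inequality between convergent quantities and so passes to
  -- the limit. The other inclusion is monotonicity.
  have hS : ∀ p, ⋂ n, enforceable X (approx X n).1 (approx X n).2 p =
      enforceable X wbar wlow p := by
    intro p
    ext κ
    rw [Set.mem_iInter]
    refine ⟨fun h => ⟨(h 0).1, le_of_tendsto_of_tendsto' (tbest κ p) (tone κ _ p)
      fun n => (h n).2⟩, fun h n => ?_⟩
    exact enforceable_mono p vbar (hval n).1 vlow (hval n).2 (lebar n) (lelow n) h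
  -- With binary actions the feasible set at each belief stops changing, so from then on only the
  -- objective varies along the sequence.
  have hev : ∀ p, ∀ᶠ n in .atTop, enforceable X (approx X n).1 (approx X n).2 p =
      enforceable X wbar wlow p := fun p =>
    hS p ▸ eventually_eq_iInter_of_antitone (fun n => enforceable_subset _ _ p) (hSanti p)
  have hSne : ∀ p, (enforceable X wbar wlow p).Nonempty := fun p => by
    obtain ⟨n, hn⟩ := (hev p).exists
    exact hn ▸ hne n p
  have ebar : ∀ p, wbar p = binaryMax (enforceable X wbar wlow p)
      fun κ => oneStep X κ (G.N * κ) wbar p := by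
    intro p
    -- The shifted sequence has the same limit, and its terms are the Bellman images of the original
    -- ones.
    refine tendsto_nhds_unique ((Filter.tendsto_add_atTop_iff_nat 1).2 (tbar p)) ?_
    refine (tendsto_binaryMax (enforceable X wbar wlow p)
      fun κ _ => tone κ (G.N * κ) p).congr' ?_
    filter_upwards [hev p] with n hn
    rw [← hn]
    rfl
  have elow : ∀ p, wlow p = binaryMin (enforceable X wbar wlow p)
      fun κ => bestReply X κ wlow p := by
    intro p
    refine tendsto_nhds_unique ((Filter.tendsto_add_atTop_iff_nat 1).2 (tlow p)) ?_
    refine (tendsto_binaryMin (enforceable X wbar wlow p) fun κ _ => tbest κ p).congr' ?_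
    filter_upwards [hev p] with n hn
    rw [← hn]
    rfl
  refine ⟨wbar, wlow, ⟨vbar.measurable, vlow.measurable, ⟨_, vbar.abs_le⟩, ⟨_, vlow.abs_le⟩,
    fun p => ?_, fun p => ?_⟩, fun p v => ⟨fun h => le_ciInf h, fun h => ciSup_le h⟩⟩
  · have := isGreatest_binaryMax (enforceable_subset wbar wlow p) (hSne p)
      fun κ => oneStep X κ (G.N * κ) wbar p
    rwa [← ebar p] at this
  · have := isLeast_binaryMin (enforceable_subset wbar wlow p) (hSne p)
      fun κ => bestReply X κ wlow p
    rwa [← elow p] at this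

end BanditGame

namespace BanditGame

variable {G : BanditGame} {Ω : Type*} [MeasurableSpace Ω] {X : ArmNoise G Ω}

/-! ### Pure actions as degenerate mixed actions -/

/-- The degenerate mixed action that corresponds to `k ∈ {0, 1}`. -/
def binaryAct (k : ℕ) : unitInterval := if k = 1 then 1 else 0

theorem binaryAct_eq (k : ℕ) : binaryAct k = 0 ∨ binaryAct k = 1 := by
  unfold binaryAct
  split_ifs <;> simp

theorem binaryAct_eq_one_iff (k : ℕ) : binaryAct k = 1 ↔ k = 1 := by
  unfold binaryAct
  split_ifs with h <;> simp [h]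

theorem exists_binaryAct {a : unitInterval} (ha : a = 0 ∨ a = 1) :
    ∃ k ∈ ({0, 1} : Set ℕ), a = binaryAct k := by
  rcases ha with rfl | rfl
  · exact ⟨0, by simp, by simp [binaryAct]⟩
  · exact ⟨1, by simp, by simp [binaryAct]⟩

theorem beliefFlow_binaryAct (p : unitInterval) {k : ℕ} (hk : k ∈ ({0, 1} : Set ℕ)) :
    G.beliefFlow p (binaryAct k) = (1 - k) * G.s + k * G.m p := by
  rcases hk with rfl | rfl <;> simp [beliefFlow, binaryAct]

theorem one_le_N (G : BanditGame) : 1 ≤ G.N := (by norm_num : 1 ≤ 2).trans G.two_le_N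

theorem N_sub_one_mul_add (G : BanditGame) (κ : ℕ) : (G.N - 1) * κ + κ = G.N * κ := by
  rw [← Nat.succ_mul, Nat.succ_eq_add_one, Nat.sub_add_cancel G.one_le_N]

theorem card_update_binaryAct {κ k : ℕ} (hκ : κ ∈ ({0, 1} : Set ℕ)) (hk : k ∈ ({0, 1} : Set ℕ))
    (i : Fin G.N) :
    Nat.card {j // Function.update (fun _ : Fin G.N => binaryAct κ) i (binaryAct k) j = 1} =
      (G.N - 1) * κ + k := by
  have h : ∀ j, Function.update (fun _ : Fin G.N => binaryAct κ) i (binaryAct k) j = 1 ↔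
      (if j = i then k else κ) = 1 := by
    intro j
    by_cases hj : j = i
    · subst hj; simp [binaryAct_eq_one_iff]
    · simp [hj, binaryAct_eq_one_iff]
  simp_rw [h]
  rw [Nat.card_eq_fintype_card, Fintype.card_subtype]
  have hsum : ∑ j : Fin G.N, (if j = i then k else κ) = (G.N - 1) * κ + k := by
    rw [← Finset.add_sum_erase _ _ (Finset.mem_univ i), if_pos rfl,
      Finset.sum_congr rfl fun j hj => if_neg (Finset.ne_of_mem_erase hj), Finset.sum_const,
      Finset.card_erase_of_mem (Finset.mem_univ i), Finset.card_univ, Fintype.card_fin,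
      smul_eq_mul, add_comm]
  rw [← hsum, Finset.card_filter]
  refine Finset.sum_congr rfl fun j _ => ?_
  rcases hκ with rfl | rfl <;> rcases hk with rfl | rfl <;> split_ifs <;> simp_all

theorem update_binaryAct_pure (κ k : ℕ) (i j : Fin G.N) :
    Function.update (fun _ : Fin G.N => binaryAct κ) i (binaryAct k) j = 0 ∨
      Function.update (fun _ : Fin G.N => binaryAct κ) i (binaryAct k) j = 1 := by
  by_cases hj : j = i
  · subst hj; simpa using binaryAct_eq k
  · simpa [Function.update_of_ne hj] using binaryAct_eq κ

/-- `oneStep` as an expected value of playing `k` against opponents who all play `κ`. -/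
theorem oneStep_eq_integral (p : unitInterval) {κ k : ℕ} (hκ : κ ∈ ({0, 1} : Set ℕ))
    (hk : k ∈ ({0, 1} : Set ℕ)) (i : Fin G.N) {w : unitInterval → ℝ} (hw : Measurable w) :
    oneStep X k ((G.N - 1) * κ + k) w p = (1 - G.δ) * G.beliefFlow p (binaryAct k) +
      G.δ * ∫ z, w (bayesUpdate p z.1) ∂(mixedOutcomeLaw X p
        (Function.update (fun _ => binaryAct κ) i (binaryAct k))) := by
  rw [integral_mixedOutcomeLaw_of_pure X p (update_binaryAct_pure κ k i)
    (card_update_binaryAct hκ hk i) hw, beliefFlow_binaryAct p hk, oneStep]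

theorem oneStep_le_bestReply (p : unitInterval) (κ : ℕ) {k : ℕ} (hk : k ∈ ({0, 1} : Set ℕ))
    (w : unitInterval → ℝ) : oneStep X k ((G.N - 1) * κ + k) w p ≤ bestReply X κ w p := by
  rcases hk with rfl | rfl
  exacts [le_max_left _ _, le_max_right _ _]

/-! ### Bounds for equilibrium payoffs -/

/-- The strategy that plays `a` in period `t` and otherwise follows `τ`. -/
def deviateAt (τ : G.Strategy) (t : ℕ) (a : unitInterval) : G.Strategy where
  act t' x := if t' = t then a else τ.act t' x
  measurable_act t' := by
    by_cases h : t' = t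
    · simp only [h, if_true]
      exact measurable_const
    · simp only [h, if_false]
      exact τ.measurable_act t'

theorem actions_update (σ : Fin G.N → G.Strategy) (i : Fin G.N) (τ : G.Strategy) {t : ℕ}
    (x : G.Node t) :
    actions (Function.update σ i τ) x = Function.update (actions σ x) i (τ.act t x) := by
  funext j
  by_cases hj : j = i
  · subst hj; simp [actions]
  · simp [actions, Function.update_of_ne hj]

/-- From the next period on the deviator follows `σ i` again. The deviation thus changes the current
flow and the law of the next node, but not the payoff at any later node. -/
theorem payoffAt_deviateAt (p : unitInterval) (σ : Fin G.N → G.Strategy) {t : ℕ} (x : G.Node t)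
    (i : Fin G.N) (a : unitInterval) :
    payoffAt X p (Function.update σ i (deviateAt (σ i) t a)) x i =
      (1 - G.δ) * G.beliefFlow (belief p x.1) a +
        G.δ * ∫ z, payoffAt X p σ (nextNode x z) i ∂(mixedOutcomeLaw X (belief p x.1)
          (Function.update (actions σ x) i a)) := by
  have h : ∀ n t', t + 1 ≤ t' →
      (Function.update σ i (deviateAt (σ i) t a) n).act t' = (σ n).act t' := by
    intro n t' ht
    by_cases hn : n = i
    · subst hn
      funext y
      simp [deviateAt, (show t' ≠ t by omega)]
    · rw [Function.update_of_ne hn]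
  have ha : (deviateAt (σ i) t a).act t x = a := if_pos rfl
  rw [payoffAt_recursion, actions_update, ha, Function.update_self]
  simp_rw [payoffAt_congr X p h]

theorem measurable_payoffAt_nextNode (p : unitInterval) (σ : Fin G.N → G.Strategy) {t : ℕ}
    (x : G.Node t) (i : Fin G.N) : Measurable fun z => payoffAt X p σ (nextNode x z) i :=
  (measurable_payoffAt X p σ (t + 1) i).comp (measurable_nextNode measurable_const measurable_id)

/-- Payoffs of a pure-strategy SSE at a node, given bounds for payoffs at all later nodes. -/
theorem IsPureSSE.exists_enforceable {p : unitInterval} {σ : Fin G.N → G.Strategy}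
    (hσ : IsPureSSE X p σ) {wbar wlow : unitInterval → ℝ} {C : ℝ} (hb : IsValue C wbar)
    (hl : IsValue C wlow) {t : ℕ} (x : G.Node t) (i : Fin G.N)
    (hbar : ∀ y : G.Node (t + 1), payoffAt X p σ y i ≤ wbar (belief p y.1))
    (hlow : ∀ y : G.Node (t + 1), wlow (belief p y.1) ≤ payoffAt X p σ y i) :
    ∃ κ ∈ enforceable X wbar wlow (belief p x.1),
      bestReply X κ wlow (belief p x.1) ≤ payoffAt X p σ x i ∧
        payoffAt X p σ x i ≤ oneStep X κ (G.N * κ) wbar (belief p x.1) := by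
  obtain ⟨κ, hκ, hκi⟩ := exists_binaryAct (hσ.2 i t x)
  have hact : actions σ x = fun _ => binaryAct κ := by
    funext j
    rw [← hκi]
    exact hσ.1.2 j i t x
  set b := belief p x.1 with hbdef
  have hint : ∀ {w : unitInterval → ℝ}, IsValue C w → ∀ q : Fin G.N → unitInterval,
      Integrable (fun z : G.Outcome => w (bayesUpdate b z.1)) (mixedOutcomeLaw X b q) :=
    fun hw q => integrable_of_abs_le
      (hw.measurable.comp ((measurable_bayesUpdate_right b).comp measurable_fst))
      fun z => hw.abs_le _
  have hpay : ∀ q : Fin G.N → unitInterval,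
      Integrable (fun z => payoffAt X p σ (nextNode x z) i) (mixedOutcomeLaw X b q) :=
    fun q => integrable_of_abs_le (measurable_payoffAt_nextNode p σ x i)
      fun z => abs_payoffAt_le X p σ _ i
  have hupper : payoffAt X p σ x i ≤ oneStep X κ (G.N * κ) wbar b := by
    rw [← N_sub_one_mul_add, oneStep_eq_integral b hκ hκ i hb.measurable, payoffAt_recursion,
      hact, Function.update_eq_self_iff.2 rfl]
    refine add_le_add_right (mul_le_mul_of_nonneg_left
      (integral_mono (hpay _) (hint hb _) fun z => ?_) δ_pos.le) _
    have := hbar (nextNode x z)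
    rwa [belief_nextNode] at this
  -- After a one-period deviation play continues with the same profile at another node. The lower
  -- bound `hlow` holds there too, since it covers nodes off the path of play.
  have hdev : ∀ k ∈ ({0, 1} : Set ℕ),
      oneStep X k ((G.N - 1) * κ + k) wlow b ≤ payoffAt X p σ x i := by
    intro k hk
    refine le_trans ?_ (hσ.1.1 t x i (deviateAt (σ i) t (binaryAct k)))
    rw [payoffAt_deviateAt, hact, oneStep_eq_integral b hκ hk i hl.measurable]
    refine add_le_add_right (mul_le_mul_of_nonneg_left
      (integral_mono (hint hl _) (hpay _) fun z => ?_) δ_pos.le) _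
    have := hlow (nextNode x z)
    rwa [belief_nextNode] at this
  have hbest : bestReply X κ wlow b ≤ payoffAt X p σ x i :=
    max_le (hdev 0 (by simp)) (hdev 1 (by simp))
  exact ⟨κ, ⟨hκ, hbest.trans hupper⟩, hbest, hupper⟩

/-- The induction on `n` is uniform in the node, because the bound at a node uses the previous bound
at all its successors. -/
theorem IsPureSSE.payoffAt_mem {p : unitInterval} {σ : Fin G.N → G.Strategy}
    (hσ : IsPureSSE X p σ) (n : ℕ) {t : ℕ} (x : G.Node t) (i : Fin G.N) :
    payoffAt X p σ x i ∈
      Set.Icc ((approx X n).2 (belief p x.1)) ((approx X n).1 (belief p x.1)) := by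
  induction n generalizing t with
  | zero => exact abs_le.1 (abs_payoffAt_le X p σ x i)
  | succ n ih =>
    obtain ⟨κ, hκ, h1, h2⟩ := hσ.exists_enforceable (isValue_approx n).1 (isValue_approx n).2 x i
      (fun y => (ih y).2) fun y => (ih y).1
    constructor
    · exact ((isLeast_binaryMin (enforceable_subset _ _ _) ⟨κ, hκ⟩ _).2 ⟨κ, hκ, rfl⟩).trans h1
    · exact h2.trans ((isGreatest_binaryMax (enforceable_subset _ _ _) ⟨κ, hκ⟩
        fun κ => oneStep X κ (G.N * κ) (approx X n).1 (belief p x.1)).2 ⟨κ, hκ, rfl⟩)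

/-- The action that an equilibrium for the prior `p` prescribes at an initial node is enforceable
for each pair of bounds. -/
theorem enforceable_approx_nonempty (hex : ∀ p : unitInterval, ∃ σ, IsPureSSE X p σ) (n : ℕ)
    (p : unitInterval) : (enforceable X (approx X n).1 (approx X n).2 p).Nonempty := by
  obtain ⟨σ, hσ⟩ := hex p
  obtain ⟨κ, hκ, -⟩ := hσ.exists_enforceable (isValue_approx n).1 (isValue_approx n).2
    (((Fin.elim0 : G.Hist 0), 0) : G.Node 0) ⟨0, G.one_le_N⟩
    (fun y => (hσ.payoffAt_mem n y _).2) fun y => (hσ.payoffAt_mem n y _).1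
  exact ⟨κ, hκ⟩

theorem IsPureSSE.payoff_mem {p : unitInterval} {σ : Fin G.N → G.Strategy}
    (hσ : IsPureSSE X p σ) (n : ℕ) (i : Fin G.N) :
    payoff X p σ i ∈ Set.Icc ((approx X n).2 p) ((approx X n).1 p) := by
  have hint : Integrable (fun u : unitInterval =>
      payoffAt X p σ (((Fin.elim0 : G.Hist 0), u) : G.Node 0) i) volume :=
    integrable_of_abs_le ((measurable_payoffAt X p σ 0 i).comp measurable_prodMk_left)
      fun u => abs_payoffAt_le X p σ _ i
  have h : ∀ u : unitInterval, payoffAt X p σ (((Fin.elim0 : G.Hist 0), u) : G.Node 0) i ∈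
      Set.Icc ((approx X n).2 p) ((approx X n).1 p) := fun u =>
    hσ.payoffAt_mem n (((Fin.elim0 : G.Hist 0), u) : G.Node 0) i
  rw [payoff]
  constructor
  · have := integral_mono (integrable_const _) hint fun u => (h u).1
    simpa using this
  · have := integral_mono hint (integrable_const _) fun u => (h u).2
    simpa using this

end BanditGame

namespace BanditGame

variable {G : BanditGame} {Ω : Type*} [MeasurableSpace Ω] {X : ArmNoise G Ω}

/-! ### Two-state automata -/

/-- A symmetric strategy profile with a good state `true` and a bad state `false`: in state `b` and
at belief `q` all players use the pure action `act b q`; the next state is bad if some player does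
not, and otherwise it is good with probability `prob b q`. -/
structure Automaton where
  act : Bool → unitInterval → ℕ
  prob : Bool → unitInterval → unitInterval
  measurable_act : ∀ b, Measurable (act b)
  measurable_prob : ∀ b, Measurable (prob b)

namespace Automaton

variable (A : Automaton)

open Classical in
/-- The next state. -/
noncomputable def transition (b : Bool) (q : unitInterval) (z : G.Outcome) : Bool :=
  -- The public draw that opens the next period decides between the two states. The clause `= 1`
  -- includes the draw `1`, so that probability one means certainty.
  decide ((∀ i, (z.1 i).isRight ↔ A.act b q = 1) ∧ (z.2 < A.prob b q ∨ A.prob b q = 1))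

/-- The state at a node, starting from the state `b₀` and the belief `p`. -/
noncomputable def stateAt (b₀ : Bool) (p : unitInterval) : {t : ℕ} → G.Node t → Bool
  | 0, _ => b₀
  | t + 1, x =>
    A.transition (G := G) (stateAt b₀ p (t := t) (Fin.init x.1, (x.1 (Fin.last t)).1))
      (belief p (Fin.init x.1)) ((x.1 (Fin.last t)).2, x.2)

@[simp]
theorem stateAt_nextNode (b₀ : Bool) (p : unitInterval) {t : ℕ} (x : G.Node t) (z : G.Outcome) :
    A.stateAt b₀ p (nextNode x z) = A.transition (A.stateAt b₀ p x) (belief p x.1) z := by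
  simp only [nextNode, stateAt, Fin.init_snoc, Fin.snoc_last]

theorem measurable_transition :
    Measurable fun e : Bool × unitInterval × G.Outcome => A.transition e.1 e.2.1 e.2.2 := by
  refine measurable_from_prod_countable_right fun b => ?_
  have hone : MeasurableSet {e : unitInterval × G.Outcome | A.act b e.1 = 1} :=
    ((A.measurable_act b).comp measurable_fst) (measurableSet_singleton 1)
  have hright : MeasurableSet {o : G.Obs | o.isRight} :=
    measurableSet_sum_iff.2 ⟨by simp, by simp⟩
  have hobs : ∀ i, MeasurableSet {e : unitInterval × G.Outcome | (e.2.1 i).isRight} := fun i =>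
    (measurable_pi_apply i |>.comp (measurable_fst.comp measurable_snd) :
      Measurable fun e : unitInterval × G.Outcome => e.2.1 i) hright
  have hp : Measurable fun e : unitInterval × G.Outcome => A.prob b e.1 :=
    (A.measurable_prob b).comp measurable_fst
  refine measurable_to_bool ?_
  have : (fun e : unitInterval × G.Outcome => A.transition b e.1 e.2) ⁻¹' {true} =
      {e | (∀ i, (e.2.1 i).isRight ↔ A.act b e.1 = 1) ∧
        (e.2.2 < A.prob b e.1 ∨ A.prob b e.1 = 1)} := by
    ext e
    simp [transition]
  rw [this]
  refine MeasurableSet.inter ?_ ?_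
  · exact measurableSet_setOfPred.2 (Measurable.forall fun i =>
      (measurableSet_setOfPred.1 (hobs i)).iff (measurableSet_setOfPred.1 hone))
  · exact (measurableSet_lt (measurable_snd.comp measurable_snd) hp).union
      (hp (measurableSet_singleton 1))

theorem measurable_stateAt (b₀ : Bool) (p : unitInterval) (t : ℕ) :
    Measurable fun x : G.Node t => A.stateAt b₀ p x := by
  induction t with
  | zero => exact measurable_const
  | succ t ih =>
    have hinit : Measurable fun x : G.Node (t + 1) => (Fin.init x.1 : G.Hist t) :=
      measurable_pi_lambda _ fun i => (measurable_pi_apply _).comp measurable_fst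
    have hlast : Measurable fun x : G.Node (t + 1) => x.1 (Fin.last t) :=
      (measurable_pi_apply _).comp measurable_fst
    exact A.measurable_transition.comp ((ih.comp (hinit.prodMk (measurable_fst.comp hlast))).prodMk
      (((measurable_belief p t).comp hinit).prodMk
        ((measurable_snd.comp hlast).prodMk measurable_snd)))

/-- The strategy of each player. -/
noncomputable def strategy (b₀ : Bool) (p : unitInterval) : G.Strategy where
  act _ x := binaryAct (A.act (A.stateAt b₀ p x) (belief p x.1))
  measurable_act t := by
    have h : Measurable fun e : Bool × unitInterval => binaryAct (A.act e.1 e.2) :=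
      measurable_from_prod_countable_right fun b =>
        (measurable_of_countable binaryAct).comp (A.measurable_act b)
    exact h.comp ((A.measurable_stateAt b₀ p t).prodMk
      ((measurable_belief p t).comp measurable_fst))

theorem strategy_isPure (b₀ : Bool) (p : unitInterval) :
    (A.strategy b₀ p : G.Strategy).IsPure := fun _ _ => binaryAct_eq _

theorem actions_strategy (b₀ : Bool) (p : unitInterval) {t : ℕ} (x : G.Node t) :
    actions (fun _ => A.strategy b₀ p) x =
      fun _ => binaryAct (A.act (A.stateAt b₀ p x) (belief p x.1)) := rfl

end Automaton

/-- The function `wbar` in the good state, and `wlow` in the bad state. -/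
def valueIn (wbar wlow : unitInterval → ℝ) : Bool → unitInterval → ℝ
  | true => wbar
  | false => wlow

/-- `A` has the values `wbar` and `wlow` in its two states, and supports its actions by the threat
of moving to the bad state. -/
structure Automaton.Supports (A : Automaton) (X : ArmNoise G Ω) (wbar wlow : unitInterval → ℝ) :
    Prop where
  act_mem : ∀ b q, A.act b q ∈ ({0, 1} : Set ℕ)
  bestReply_le : ∀ b q, bestReply X (A.act b q) wlow q ≤ valueIn wbar wlow b q
  promise : ∀ b q, A.prob b q * oneStep X (A.act b q) (G.N * A.act b q) wbar q +
    (1 - A.prob b q) * oneStep X (A.act b q) (G.N * A.act b q) wlow q = valueIn wbar wlow b q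

theorem measurable_valueIn {wbar wlow : unitInterval → ℝ} {C : ℝ} (hb : IsValue C wbar)
    (hl : IsValue C wlow) :
    Measurable fun e : Bool × unitInterval => valueIn wbar wlow e.1 e.2 :=
  measurable_from_prod_countable_right fun b => by
    cases b
    exacts [hl.measurable, hb.measurable]

theorem abs_valueIn_le {wbar wlow : unitInterval → ℝ} {C : ℝ} (hb : IsValue C wbar)
    (hl : IsValue C wlow) (b : Bool) (q : unitInterval) : |valueIn wbar wlow b q| ≤ C := by
  cases b
  exacts [hl.abs_le q, hb.abs_le q]

theorem integral_ite_lt (a : unitInterval) (u v : ℝ) [DecidablePred fun s => s < a ∨ a = 1] :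
    ∫ s : unitInterval, (if s < a ∨ a = 1 then u else v) = a * u + (1 - a) * v := by
  by_cases h1 : a = 1
  · simp [h1]
  · have hs : MeasurableSet (Set.Iio a) := measurableSet_Iio
    have e : (fun s : unitInterval => if s < a ∨ a = 1 then u else v) =
        fun s => (Set.Iio a).indicator (fun _ => u - v) s + v := by
      funext s
      by_cases h : s < a <;> simp [h, h1]
    rw [e, integral_add ((integrable_const _).indicator hs) (integrable_const _),
      integral_indicator_const _ hs, integral_const, probReal_univ, measureReal_def,
      unitInterval.volume_Iio, ENNReal.toReal_ofReal a.2.1, smul_eq_mul, smul_eq_mul]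
    ring

/-! ### Automata that support their actions are equilibria with the prescribed values -/

namespace Automaton.Supports

variable {A : Automaton} {wbar wlow : unitInterval → ℝ} {C : ℝ}

theorem measurable_continuation (A : Automaton) (hb : IsValue C wbar) (hl : IsValue C wlow)
    (b : Bool) (q : unitInterval) : Measurable fun z : G.Outcome =>
      valueIn wbar wlow (A.transition b q z) (bayesUpdate q z.1) :=
  (measurable_valueIn hb hl).comp
    ((A.measurable_transition.comp (measurable_const.prodMk
      (measurable_const.prodMk measurable_id))).prodMk
        ((measurable_bayesUpdate_right q).comp measurable_fst))

/-- The value of a state is generated by compliance with the prescribed action. -/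
theorem value_of_comply (hA : A.Supports X wbar wlow) (hb : IsValue C wbar) (hl : IsValue C wlow)
    (b : Bool) (q : unitInterval) :
    (1 - G.δ) * G.beliefFlow q (binaryAct (A.act b q)) +
      G.δ * ∫ z, valueIn wbar wlow (A.transition b q z) (bayesUpdate q z.1)
        ∂(mixedOutcomeLaw X q fun _ => binaryAct (A.act b q)) = valueIn wbar wlow b q := by
  classical
  set κ := A.act b q with hκ
  set a : Fin G.N → unitInterval := fun _ => binaryAct κ with ha
  have hmb : Measurable fun o : Fin G.N → G.Obs => wbar (bayesUpdate q o) :=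
    hb.measurable.comp (measurable_bayesUpdate_right q)
  have hml : Measurable fun o : Fin G.N → G.Obs => wlow (bayesUpdate q o) :=
    hl.measurable.comp (measurable_bayesUpdate_right q)
  have e1 : ∫ z, valueIn wbar wlow (A.transition b q z) (bayesUpdate q z.1)
      ∂(mixedOutcomeLaw X q a) = ∫ z : G.Outcome, (if z.2 < A.prob b q ∨ A.prob b q = 1 then
        wbar (bayesUpdate q z.1) else wlow (bayesUpdate q z.1)) ∂(mixedOutcomeLaw X q a) := by
    refine integral_congr_ae ?_
    filter_upwards [ae_isRight_mixedOutcomeLaw X q (fun _ => binaryAct_eq κ : ∀ i, a i = 0 ∨ a i = 1)]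
      with z hz
    have hc : ∀ i, (z.1 i).isRight ↔ A.act b q = 1 := fun i =>
      (hz i).trans (binaryAct_eq_one_iff κ)
    by_cases hu : z.2 < A.prob b q ∨ A.prob b q = 1
    · rw [if_pos hu, transition, decide_eq_true ⟨hc, hu⟩]
      rfl
    · rw [if_neg hu, transition, decide_eq_false fun h => hu h.2]
      rfl
  have hmi : Measurable fun z : G.Outcome => if z.2 < A.prob b q ∨ A.prob b q = 1 then
        wbar (bayesUpdate q z.1) else wlow (bayesUpdate q z.1) :=
    Measurable.ite ((measurableSet_lt measurable_snd measurable_const).union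
      (MeasurableSet.const _)) (hmb.comp measurable_fst) (hml.comp measurable_fst)
  have hii : Integrable (fun z : G.Outcome => if z.2 < A.prob b q ∨ A.prob b q = 1 then
        wbar (bayesUpdate q z.1) else wlow (bayesUpdate q z.1)) (mixedOutcomeLaw X q a) := by
    refine integrable_of_abs_le (C := C) hmi fun z => ?_
    split_ifs
    exacts [hb.abs_le _, hl.abs_le _]
  have hfst : ∀ {w : unitInterval → ℝ}, IsValue C w →
      ∫ z, w (bayesUpdate q z.1) ∂(mixedOutcomeLaw X q a) =
        ∫ o, w (bayesUpdate q o) ∂(mixedStageLaw X q a) := by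
    intro w hw
    have := integral_fun_fst (μ := mixedStageLaw X q a) (ν := (volume : Measure unitInterval))
      fun o => w (bayesUpdate q o)
    rwa [probReal_univ, one_smul] at this
  have e2 : ∫ z : G.Outcome, (if z.2 < A.prob b q ∨ A.prob b q = 1 then
        wbar (bayesUpdate q z.1) else wlow (bayesUpdate q z.1)) ∂(mixedOutcomeLaw X q a) =
      A.prob b q * ∫ z, wbar (bayesUpdate q z.1) ∂(mixedOutcomeLaw X q a) +
        (1 - A.prob b q) * ∫ z, wlow (bayesUpdate q z.1) ∂(mixedOutcomeLaw X q a) := by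
    rw [hfst hb, hfst hl, mixedOutcomeLaw, integral_prod _ hii]
    simp_rw [integral_ite_lt]
    rw [integral_add, integral_const_mul, integral_const_mul]
    · exact (integrable_of_abs_le hmb fun o => hb.abs_le _).const_mul _
    · exact (integrable_of_abs_le hml fun o => hl.abs_le _).const_mul _
  have hupd : Function.update a ⟨0, G.one_le_N⟩ (binaryAct κ) = a := by
    rw [Function.update_eq_self_iff]
  have ho : ∀ {w : unitInterval → ℝ}, IsValue C w → oneStep X κ (G.N * κ) w q =
      (1 - G.δ) * G.beliefFlow q (binaryAct κ) +
        G.δ * ∫ z, w (bayesUpdate q z.1) ∂(mixedOutcomeLaw X q a) := by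
    intro w hw
    rw [← N_sub_one_mul_add, oneStep_eq_integral q (hA.act_mem b q) (hA.act_mem b q)
      ⟨0, G.one_le_N⟩ hw.measurable]
    rw [← hκ, ← ha, hupd]
  rw [← hA.promise b q, ← hκ, ho hb, ho hl, e1, e2]
  ring

/-- No pure action yields more than the value of a state. -/
theorem value_of_deviate (hA : A.Supports X wbar wlow) (hb : IsValue C wbar) (hl : IsValue C wlow)
    (b : Bool) (q : unitInterval) (i : Fin G.N) {k : ℕ} (hk : k ∈ ({0, 1} : Set ℕ)) :
    (1 - G.δ) * G.beliefFlow q (binaryAct k) +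
      G.δ * ∫ z, valueIn wbar wlow (A.transition b q z) (bayesUpdate q z.1)
        ∂(mixedOutcomeLaw X q (Function.update (fun _ => binaryAct (A.act b q)) i (binaryAct k))) ≤
      valueIn wbar wlow b q := by
  by_cases hkκ : k = A.act b q
  · rw [Function.update_eq_self_iff.2 (by rw [hkκ]), hkκ]
    exact (hA.value_of_comply hb hl b q).le
  · refine le_trans (le_of_eq ?_) ((oneStep_le_bestReply q (A.act b q) hk wlow).trans
      (hA.bestReply_le b q))
    rw [oneStep_eq_integral q (hA.act_mem b q) hk i hl.measurable]
    congr 2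
    -- The deviation is seen almost surely and leads to the bad state, so the continuation value is
    -- `wlow`.
    refine integral_congr_ae ?_
    filter_upwards [ae_isRight_mixedOutcomeLaw X q (update_binaryAct_pure (A.act b q) k i)]
      with z hz
    have hi := hz i
    rw [Function.update_self, binaryAct_eq_one_iff] at hi
    have hne : ¬((z.1 i).isRight ↔ A.act b q = 1) := by
      rw [hi]
      have hκ := hA.act_mem b q
      intro h
      rcases hk with rfl | rfl <;> rcases hκ with h' | h' <;> simp_all
    rw [transition, decide_eq_false fun h => hne (h.1 i)]
    rfl

/-- No mixed action yields more than the value of a state. -/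
theorem value_of_deviate_mixed (hA : A.Supports X wbar wlow) (hb : IsValue C wbar)
    (hl : IsValue C wlow) (b : Bool) (q : unitInterval) (i : Fin G.N) (a : unitInterval) :
    (1 - G.δ) * G.beliefFlow q a +
      G.δ * ∫ z, valueIn wbar wlow (A.transition b q z) (bayesUpdate q z.1)
        ∂(mixedOutcomeLaw X q (Function.update (fun _ => binaryAct (A.act b q)) i a)) ≤
      valueIn wbar wlow b q := by
  have h1 := hA.value_of_deviate hb hl b q i (k := 1) (by simp)
  have h0 := hA.value_of_deviate hb hl b q i (k := 0) (by simp)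
  rw [integral_mixedOutcomeLaw_update X q _ i a (measurable_continuation A hb hl b q)
    fun z => abs_valueIn_le hb hl _ _]
  rw [beliefFlow_binaryAct q (by simp)] at h0 h1
  rw [show binaryAct 1 = 1 from if_pos rfl] at h1
  rw [show binaryAct 0 = 0 from if_neg (by norm_num)] at h0
  push_cast at h0 h1
  have ha0 := a.2.1
  have ha1 := sub_nonneg.2 a.2.2
  have h1' := mul_le_mul_of_nonneg_left h1 ha0
  have h0' := mul_le_mul_of_nonneg_left h0 ha1
  rw [beliefFlow]
  linarith

variable (b₀ : Bool) (p : unitInterval)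

/-- Optimality in a single period is applied `j` times along an arbitrary deviation. Beyond this
horizon, payoff and value differ by at most `2 * C`, discounted by `δ ^ j`. -/
theorem payoffAt_update_le_add (hA : A.Supports X wbar wlow) (hC : G.payoffBound ≤ C)
    (hb : IsValue C wbar) (hl : IsValue C wlow) (i : Fin G.N) (τ : G.Strategy) (j : ℕ) {t : ℕ}
    (x : G.Node t) :
    payoffAt X p (Function.update (fun _ => A.strategy b₀ p) i τ) x i ≤
      valueIn wbar wlow (A.stateAt b₀ p x) (belief p x.1) + G.δ ^ j * (2 * C) := by
  induction j generalizing t with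
  | zero =>
    have h1 := (abs_le.1 ((abs_payoffAt_le X p
      (Function.update (fun _ => A.strategy b₀ p) i τ) x i).trans hC)).2
    have h2 := (abs_le.1 (abs_valueIn_le hb hl (A.stateAt b₀ p x) (belief p x.1))).1
    linarith
  | succ j ih =>
    have hmix := hA.value_of_deviate_mixed hb hl (A.stateAt b₀ p x) (belief p x.1) i (τ.act t x)
    rw [payoffAt_recursion, actions_update, Function.update_self, actions_strategy]
    set μ := mixedOutcomeLaw X (belief p x.1) (Function.update
      (fun _ : Fin G.N => binaryAct (A.act (A.stateAt b₀ p x) (belief p x.1))) i (τ.act t x))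
    have hic : Integrable (fun z => valueIn wbar wlow
        (A.transition (A.stateAt b₀ p x) (belief p x.1) z) (bayesUpdate (belief p x.1) z.1)) μ :=
      integrable_of_abs_le (measurable_continuation A hb hl _ _) fun z => abs_valueIn_le hb hl _ _
    have hle : ∫ z, payoffAt X p (Function.update (fun _ => A.strategy b₀ p) i τ)
        (nextNode x z) i ∂μ ≤ ∫ z, (valueIn wbar wlow
          (A.transition (A.stateAt b₀ p x) (belief p x.1) z) (bayesUpdate (belief p x.1) z.1) +
            G.δ ^ j * (2 * C)) ∂μ := by
      refine integral_mono (integrable_of_abs_le (measurable_payoffAt_nextNode p _ x i)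
        fun z => abs_payoffAt_le X p _ _ i) (hic.add (integrable_const _)) fun z => ?_
      have := ih (nextNode x z)
      rwa [stateAt_nextNode, belief_nextNode] at this
    rw [integral_add hic (integrable_const _), integral_const, probReal_univ, one_smul] at hle
    have := mul_le_mul_of_nonneg_left hle (δ_pos (G := G)).le
    rw [pow_succ']
    linarith

/-- The matching lower bound under compliance, by the same truncation. With the upper bound for the
trivial deviation it identifies the payoff with the value of the state. -/
theorem payoffAt_ge_sub (hA : A.Supports X wbar wlow) (hC : G.payoffBound ≤ C)
    (hb : IsValue C wbar) (hl : IsValue C wlow) (i : Fin G.N) (j : ℕ) {t : ℕ}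
    (x : G.Node t) :
    valueIn wbar wlow (A.stateAt b₀ p x) (belief p x.1) - G.δ ^ j * (2 * C) ≤
      payoffAt X p (fun _ => A.strategy b₀ p) x i := by
  induction j generalizing t with
  | zero =>
    have h1 := (abs_le.1 ((abs_payoffAt_le X p (fun _ => A.strategy b₀ p) x i).trans hC)).1
    have h2 := (abs_le.1 (abs_valueIn_le hb hl (A.stateAt b₀ p x) (belief p x.1))).2
    linarith
  | succ j ih =>
    have hcomply := hA.value_of_comply hb hl (A.stateAt b₀ p x) (belief p x.1)
    rw [payoffAt_recursion, actions_strategy]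
    set μ := mixedOutcomeLaw X (belief p x.1)
      (fun _ : Fin G.N => binaryAct (A.act (A.stateAt b₀ p x) (belief p x.1)))
    have hic : Integrable (fun z => valueIn wbar wlow
        (A.transition (A.stateAt b₀ p x) (belief p x.1) z) (bayesUpdate (belief p x.1) z.1)) μ :=
      integrable_of_abs_le (measurable_continuation A hb hl _ _) fun z => abs_valueIn_le hb hl _ _
    have hle : ∫ z, (valueIn wbar wlow
          (A.transition (A.stateAt b₀ p x) (belief p x.1) z) (bayesUpdate (belief p x.1) z.1) -
            G.δ ^ j * (2 * C)) ∂μ ≤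
        ∫ z, payoffAt X p (fun _ => A.strategy b₀ p) (nextNode x z) i ∂μ := by
      refine integral_mono (hic.sub (integrable_const _)) (integrable_of_abs_le
        (measurable_payoffAt_nextNode p _ x i) fun z => abs_payoffAt_le X p _ _ i) fun z => ?_
      have := ih (nextNode x z)
      rwa [stateAt_nextNode, belief_nextNode] at this
    rw [integral_sub hic (integrable_const _), integral_const, probReal_univ, one_smul] at hle
    have := mul_le_mul_of_nonneg_left hle (δ_pos (G := G)).le
    rw [pow_succ']
    linarith

theorem tendsto_pow_mul (C : ℝ) :
    Filter.Tendsto (fun j : ℕ => G.δ ^ j * (2 * C)) .atTop (nhds 0) := by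
  simpa using (tendsto_pow_atTop_nhds_zero_of_lt_one (δ_pos (G := G)).le δ_lt_one).mul_const (2 * C)

theorem payoffAt_update_le (hA : A.Supports X wbar wlow) (hC : G.payoffBound ≤ C)
    (hb : IsValue C wbar) (hl : IsValue C wlow) (i : Fin G.N) (τ : G.Strategy) {t : ℕ}
    (x : G.Node t) :
    payoffAt X p (Function.update (fun _ => A.strategy b₀ p) i τ) x i ≤
      valueIn wbar wlow (A.stateAt b₀ p x) (belief p x.1) := by
  refine ge_of_tendsto' (x := Filter.atTop) ?_ fun j => hA.payoffAt_update_le_add b₀ p hC hb hl i τ j x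
  simpa using (tendsto_pow_mul (G := G) C).const_add
    (valueIn wbar wlow (A.stateAt b₀ p x) (belief p x.1))

theorem payoffAt_eq (hA : A.Supports X wbar wlow) (hC : G.payoffBound ≤ C)
    (hb : IsValue C wbar) (hl : IsValue C wlow) (i : Fin G.N) {t : ℕ} (x : G.Node t) :
    payoffAt X p (fun _ => A.strategy b₀ p) x i =
      valueIn wbar wlow (A.stateAt b₀ p x) (belief p x.1) := by
  refine le_antisymm ?_ ?_
  · have := hA.payoffAt_update_le b₀ p hC hb hl i (A.strategy b₀ p) x
    rwa [Function.update_eq_self_iff.2 rfl] at this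
  · refine le_of_tendsto' (x := Filter.atTop) ?_ fun j => hA.payoffAt_ge_sub b₀ p hC hb hl i j x
    simpa using (tendsto_pow_mul (G := G) C).const_sub
      (valueIn wbar wlow (A.stateAt b₀ p x) (belief p x.1))

theorem isPureSSE (hA : A.Supports X wbar wlow) (hC : G.payoffBound ≤ C)
    (hb : IsValue C wbar) (hl : IsValue C wlow) :
    IsPureSSE X p (fun _ => A.strategy b₀ p) := by
  refine ⟨⟨fun t x i τ => ?_, fun _ _ _ _ => rfl⟩, fun _ => A.strategy_isPure b₀ p⟩
  rw [hA.payoffAt_eq b₀ p hC hb hl i x]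
  exact hA.payoffAt_update_le b₀ p hC hb hl i τ x

theorem valueIn_mem_pureSSEPayoffs (hA : A.Supports X wbar wlow) (hC : G.payoffBound ≤ C)
    (hb : IsValue C wbar) (hl : IsValue C wlow) :
    valueIn wbar wlow b₀ p ∈ pureSSEPayoffs X p := by
  refine ⟨_, hA.isPureSSE b₀ p hC hb hl, fun i => ?_⟩
  have h : ∀ u : unitInterval, payoffAt X p (fun _ => A.strategy b₀ p)
      (((Fin.elim0 : G.Hist 0), u) : G.Node 0) i = valueIn wbar wlow b₀ p := fun u =>
    hA.payoffAt_eq b₀ p hC hb hl i _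
  simp only [payoff, h, integral_const, probReal_univ, one_smul]

end Automaton.Supports

end BanditGame

namespace BanditGame

variable {G : BanditGame} {Ω : Type*} [MeasurableSpace Ω] {X : ArmNoise G Ω}

/-! ### Solutions of the functional equations are supported by automata -/

namespace IsSolution

variable {wbar wlow : unitInterval → ℝ}

theorem exists_isValue (h : IsSolution X wbar wlow) :
    ∃ C, G.payoffBound ≤ C ∧ IsValue C wbar ∧ IsValue C wlow := by
  obtain ⟨C₁, h₁⟩ := h.bounded_bar
  obtain ⟨C₂, h₂⟩ := h.bounded_low
  exact ⟨max G.payoffBound (max C₁ C₂), le_max_left _ _,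
    ⟨h.measurable_bar, fun p => (h₁ p).trans ((le_max_left _ _).trans (le_max_right _ _))⟩,
    ⟨h.measurable_low, fun p => (h₂ p).trans ((le_max_right _ _).trans (le_max_right _ _))⟩⟩

theorem low_le_bar (h : IsSolution X wbar wlow) (p : unitInterval) : wlow p ≤ wbar p := by
  obtain ⟨⟨κ, hκ, -⟩, hub⟩ := h.eq_bar p
  exact ((h.eq_low p).2 ⟨κ, hκ, rfl⟩).trans (hκ.2.trans (hub ⟨κ, hκ, rfl⟩))

variable (X wbar wlow) in
open Classical in
/-- An optimal enforceable action in the good state, and a worst one in the bad state. -/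
noncomputable def extremalAct : Bool → unitInterval → ℕ
  | true, q => if 0 ∈ enforceable X wbar wlow q ∧ oneStep X 0 (G.N * 0) wbar q = wbar q
      then 0 else 1
  | false, q => if 0 ∈ enforceable X wbar wlow q ∧ bestReply X 0 wlow q = wlow q then 0 else 1

theorem extremalAct_true (h : IsSolution X wbar wlow) (q : unitInterval) :
    extremalAct X wbar wlow true q ∈ enforceable X wbar wlow q ∧
      oneStep X (extremalAct X wbar wlow true q) (G.N * extremalAct X wbar wlow true q) wbar q =
        wbar q := by
  simp only [extremalAct]
  split_ifs with h0
  · exact h0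
  · obtain ⟨κ, hκ, e⟩ := (h.eq_bar q).1
    rcases hκ.1 with rfl | rfl
    · exact (h0 ⟨hκ, e⟩).elim
    · exact ⟨hκ, e⟩

theorem extremalAct_false (h : IsSolution X wbar wlow) (q : unitInterval) :
    extremalAct X wbar wlow false q ∈ enforceable X wbar wlow q ∧
      bestReply X (extremalAct X wbar wlow false q) wlow q = wlow q := by
  simp only [extremalAct]
  split_ifs with h0
  · exact h0
  · obtain ⟨κ, hκ, e⟩ := (h.eq_low q).1
    rcases hκ.1 with rfl | rfl
    · exact (h0 ⟨hκ, e⟩).elim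
    · exact ⟨hκ, e⟩

theorem extremalAct_mem (h : IsSolution X wbar wlow) (b : Bool) (q : unitInterval) :
    extremalAct X wbar wlow b q ∈ enforceable X wbar wlow q := by
  cases b
  exacts [(h.extremalAct_false q).1, (h.extremalAct_true q).1]

theorem measurable_extremalAct (h : IsSolution X wbar wlow) (b : Bool) :
    Measurable (extremalAct X wbar wlow b) := by
  classical
  obtain ⟨C, -, hb, hl⟩ := h.exists_isValue
  have h0 := measurableSet_enforceable (X := X) 0 hb hl
  cases b
  · exact Measurable.ite (h0.inter (measurableSet_eq_fun (measurable_bestReply 0 hl)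
      h.measurable_low)) measurable_const measurable_const
  · exact Measurable.ite (h0.inter (measurableSet_eq_fun (measurable_oneStep 0 _ hb)
      h.measurable_bar)) measurable_const measurable_const

variable (X wbar wlow) in
/-- Probability of moving from the bad to the good state after compliance, before truncation. -/
noncomputable def forgiveness (q : unitInterval) : ℝ :=
  (wlow q - oneStep X (extremalAct X wbar wlow false q)
      (G.N * extremalAct X wbar wlow false q) wlow q) /
    (oneStep X (extremalAct X wbar wlow false q)
        (G.N * extremalAct X wbar wlow false q) wbar q -
      oneStep X (extremalAct X wbar wlow false q)
        (G.N * extremalAct X wbar wlow false q) wlow q)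

/-- Compliance is one of the possible replies, and the best one yields `wlow`. Together with
`le_oneStep_bar` this places `wlow` between the payoffs from compliance followed by the bad and by
the good state, so some randomization yields it exactly. -/
theorem oneStep_low_le (h : IsSolution X wbar wlow) (q : unitInterval) :
    oneStep X (extremalAct X wbar wlow false q)
      (G.N * extremalAct X wbar wlow false q) wlow q ≤ wlow q := by
  obtain ⟨h1, h2⟩ := h.extremalAct_false q
  have := oneStep_le_bestReply (X := X) q (extremalAct X wbar wlow false q) h1.1 wlow
  rwa [N_sub_one_mul_add, h2] at this

theorem le_oneStep_bar (h : IsSolution X wbar wlow) (q : unitInterval) :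
    wlow q ≤ oneStep X (extremalAct X wbar wlow false q)
      (G.N * extremalAct X wbar wlow false q) wbar q := by
  obtain ⟨h1, h2⟩ := h.extremalAct_false q
  exact h2.symm.le.trans h1.2

theorem forgiveness_mem (h : IsSolution X wbar wlow) (q : unitInterval) :
    forgiveness X wbar wlow q ∈ Set.Icc (0 : ℝ) 1 := by
  have h1 := h.oneStep_low_le q
  have h2 := h.le_oneStep_bar q
  exact ⟨div_nonneg (by linarith) (by linarith), div_le_one_of_le₀ (by linarith) (by linarith)⟩

theorem measurable_oneStep_extremalAct (h : IsSolution X wbar wlow) {w : unitInterval → ℝ}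
    {C : ℝ} (hw : IsValue C w) :
    Measurable fun q => oneStep X (extremalAct X wbar wlow false q)
      (G.N * extremalAct X wbar wlow false q) w q := by
  have hF : Measurable fun e : ℕ × unitInterval => oneStep X e.1 (G.N * e.1) w e.2 :=
    measurable_from_prod_countable_right fun k => measurable_oneStep (X := X) k (G.N * k) hw
  have hact := h.measurable_extremalAct false
  generalize extremalAct X wbar wlow false = f at hact
  exact hF.comp (g := fun e : ℕ × unitInterval => oneStep X e.1 (G.N * e.1) w e.2)
    (f := fun q => (f q, q)) (hact.prodMk measurable_id)

theorem measurable_forgiveness (h : IsSolution X wbar wlow) :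
    Measurable (forgiveness X wbar wlow) := by
  obtain ⟨C, -, hb, hl⟩ := h.exists_isValue
  exact (h.measurable_low.sub (h.measurable_oneStep_extremalAct hl)).div
    ((h.measurable_oneStep_extremalAct hb).sub (h.measurable_oneStep_extremalAct hl))

/-- The automaton that generates a solution of the functional equations. -/
noncomputable def automaton (h : IsSolution X wbar wlow) : Automaton where
  act := extremalAct X wbar wlow
  prob
    | true => fun _ => 1
    | false => fun q => ⟨forgiveness X wbar wlow q, h.forgiveness_mem q⟩
  measurable_act := h.measurable_extremalAct
  measurable_prob b := by
    cases b
    exacts [h.measurable_forgiveness.subtype_mk, measurable_const]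

/-- In the good state compliance attains `wbar`, so no randomization is needed. In the bad state
`wlow` is the value of a best reply, which may differ from the prescribed action; the chance of
returning to the good state compensates compliance. -/
theorem automaton_supports (h : IsSolution X wbar wlow) :
    h.automaton.Supports X wbar wlow where
  act_mem b q := (h.extremalAct_mem b q).1
  bestReply_le b q := by
    cases b
    · exact (h.extremalAct_false q).2.le
    · exact (h.extremalAct_true q).1.2.trans (h.extremalAct_true q).2.le
  promise b q := by
    cases b
    · change forgiveness X wbar wlow q * _ + (1 - forgiveness X wbar wlow q) * _ = wlow q
      have h1 := h.oneStep_low_le q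
      have h2 := h.le_oneStep_bar q
      change forgiveness X wbar wlow q * oneStep X (extremalAct X wbar wlow false q)
          (G.N * extremalAct X wbar wlow false q) wbar q +
        (1 - forgiveness X wbar wlow q) * oneStep X (extremalAct X wbar wlow false q)
          (G.N * extremalAct X wbar wlow false q) wlow q = wlow q
      unfold forgiveness
      set u := oneStep X (extremalAct X wbar wlow false q)
        (G.N * extremalAct X wbar wlow false q) wbar q
      set v := oneStep X (extremalAct X wbar wlow false q)
        (G.N * extremalAct X wbar wlow false q) wlow q
      -- If both continuations yield the same, `forgiveness` is `0` by the convention for division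
      -- by zero. Then `wlow` equals the common value and any probability would do.
      rcases (h1.trans h2).eq_or_lt with e | e
      · rw [e, sub_self, div_zero]
        linarith
      · have : u - v ≠ 0 := (sub_pos.2 e).ne'
        field_simp
        ring
    · change ((1 : unitInterval) : ℝ) * _ + (1 - ((1 : unitInterval) : ℝ)) * _ = wbar q
      rw [Set.Icc.coe_one, one_mul, sub_self, zero_mul, add_zero]
      exact (h.extremalAct_true q).2

theorem mem_pureSSEPayoffs (h : IsSolution X wbar wlow) (p : unitInterval) :
    wbar p ∈ pureSSEPayoffs X p ∧ wlow p ∈ pureSSEPayoffs X p := by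
  obtain ⟨C, hC, hb, hl⟩ := h.exists_isValue
  exact ⟨h.automaton_supports.valueIn_mem_pureSSEPayoffs true p hC hb hl,
    h.automaton_supports.valueIn_mem_pureSSEPayoffs false p hC hb hl⟩

end IsSolution

theorem pureSSEPayoffs_subset (p : unitInterval) (n : ℕ) :
    pureSSEPayoffs X p ⊆ Set.Icc ((approx X n).2 p) ((approx X n).1 p) := by
  rintro v ⟨σ, hσ, hv⟩
  rw [← hv ⟨0, G.one_le_N⟩]
  exact hσ.payoff_mem n _

end BanditGame

/-- If the discrete game admits a pure-strategy SSE for every prior belief, then the best and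
worst pure-strategy SSE payoffs solve the coupled functional equations, and they bound every
bounded measurable solution. -/
theorem proposition10 (G : BanditGame) {Ω : Type*} [MeasurableSpace Ω] (X : ArmNoise G Ω)
    (hex : ∀ p : unitInterval, ∃ σ, BanditGame.IsPureSSE X p σ) :
    BanditGame.IsSolution X (BanditGame.Wsup X) (BanditGame.Winf X) ∧
    ∀ wbar wlow : unitInterval → ℝ, BanditGame.IsSolution X wbar wlow →
      ∀ p, BanditGame.Winf X p ≤ wlow p ∧ wlow p ≤ wbar p ∧ wbar p ≤ BanditGame.Wsup X p := by
  -- The crude bounds of the zeroth approximation already ensure that `sSup` and `sInf` are not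
  -- default values.
  have hbdd := fun p => BanditGame.pureSSEPayoffs_subset (X := X) p 0
  have hle : ∀ {p v}, v ∈ BanditGame.pureSSEPayoffs X p → v ≤ BanditGame.Wsup X p :=
    fun {p} _ hv => le_csSup ⟨_, fun _ h => (hbdd p h).2⟩ hv
  have hge : ∀ {p v}, v ∈ BanditGame.pureSSEPayoffs X p → BanditGame.Winf X p ≤ v :=
    fun {p} _ hv => csInf_le ⟨_, fun _ h => (hbdd p h).1⟩ hv
  refine ⟨?_, fun wbar wlow h p => ⟨hge (h.mem_pureSSEPayoffs p).2, h.low_le_bar p,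
    hle (h.mem_pureSSEPayoffs p).1⟩⟩
  obtain ⟨wbar, wlow, h, hlim⟩ :=
    BanditGame.exists_isSolution (BanditGame.enforceable_approx_nonempty hex)
  -- The limit of the upper bounds dominates every equilibrium payoff and, being part of a solution,
  -- is itself one. Thus the supremum is attained and inherits Borel measurability.
  have hsup : BanditGame.Wsup X = wbar := by
    funext p
    exact le_antisymm (csSup_le ⟨_, (h.mem_pureSSEPayoffs p).1⟩ fun v hv =>
      (hlim p v).1 fun n => (BanditGame.pureSSEPayoffs_subset p n hv).2)
      (hle (h.mem_pureSSEPayoffs p).1)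
  have hinf : BanditGame.Winf X = wlow := by
    funext p
    exact le_antisymm (hge (h.mem_pureSSEPayoffs p).2) (le_csInf ⟨_, (h.mem_pureSSEPayoffs p).2⟩
      fun v hv => (hlim p v).2 fun n => (BanditGame.pureSSEPayoffs_subset p n hv).1)
  rwa [hsup, hinf]
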